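/- Let $N=\dim_S\ge 2$, $\Delta>0$, and let $H_S=\sum_{i=1}^{N}\lambda_S(i)\,|i\rangle\langle i|$ with $\lambda_S(i)=i\Delta+b$ ($b\in\mathbb R$ an arbitrary offset) be a truncated harmonic oscillator, written in its energy eigenbasis. The environment is one qubit with $H_E=\mathrm{diag}(0,\gamma)$, $\gamma=\Delta$, and $H=H_S\otimes 1+1\otimes H_E$ has total dimension $2N$. Let $G=UDU^\dagger$ with $U$ Haar distributed on the unitary group of dimension $2N$ and, independently, $D$ diagonal with i.i.d. standard normal entries. For $\beta\in[0,\infty]$ put $\rho_S(\beta)=e^{-\beta H_S}/\mathrm{Tr}\,e^{-\beta H_S}$ and $\rho_E(\beta)=e^{-\beta H_E}/\mathrm{Tr}\,e^{-\beta H_E}=\mathrm{diag}(q_0,q_1)$, so $q_0=\frac1{1+e^{-\beta\gamma}}$ and $q_1=1-q_0$ (at $\beta=\infty$ these are the ground states). The thermalizing channel is $$\Phi_\beta(\rho)=\mathrm{Tr}_E\,\mathbb E_G\big[e^{i(H+\alpha G)t}(\rho\otimes\rho_E(\beta))e^{-i(H+\alpha G)t}\big].$$ Put $\widetilde\alpha=\alpha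 t/\sqrt{2N+1}$. The on-resonance transition matrix $T=T(\beta)$ has, for $i\ne j$, $$T_{ji}=\widetilde\alpha^2\Big(q_0\,\mathbf I\big[|\Delta_S(i,j)-\gamma|<\delta_{\min}\big]\,\mathrm{sinc}^2\tfrac{(\Delta_S(i,j)-\gamma)t}{2}+q_1\,\mathbf I\big[|\Delta_S(i,j)+\gamma|<\delta_{\min}\big]\,\mathrm{sinc}^2\tfrac{(\Delta_S(i,j)+\gamma)t}{2}\Big),$$ where $\Delta_S(i,j)=\lambda_S(i)-\lambda_S(j)$, $\mathrm{sinc}\,x=\sin x/x$, and $\delta_{\min}$ is the least distance between two distinct values of $\Delta_S$; the diagonal entries make every column sum to zero. The induced Markov chain has transition matrix $1+T$. Let $\widetilde\lambda_\star(\beta)$ be the spectral gap of $T/\widetilde\alpha^2$, i.e. the least modulus of its eigenvalues after one copy of the eigenvalue $0$ is removed. (1) For all $\alpha,t>0$ and $0\le\beta<\infty$: $T_{ji}=\widetilde\alpha^2\big(q_0\mathbf I[j=i-1]+q_1\mathbf I[j=i+1]\big)$ for $i\neq j$; if $\widetilde\alpha\le1$, then $1+T$ is column stochastic; the populations $e^{-\beta\lambda_S(i)}/\mathcal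 Z_S(\beta)$ of $\rho_S(\beta)$ form the unique probability vector fixed by $1+T$; and $\widetilde\lambda_\star(\beta)>0$. (2) For all $\alpha,t>0$, as $\beta\to\infty$: $T(\beta)$ converges to $T(\infty)$, the nearest-neighbour matrix as in (1) with $q_0=1$, $q_1=0$. It is upper triangular with characteristic polynomial $x(x+\widetilde\alpha^2)^{N-1}$ and spectrum $\{0,-\widetilde\alpha^2\}$, and the ground state is its unique fixed probability vector. Moreover $\widetilde\lambda_\star(\beta)\to1=\widetilde\lambda_\star(\infty)$, $\rho_E(\beta)\to|0\rangle\langle0|$, $\rho_S(\beta)\to|1\rangle\langle1|$, and $\Phi_\beta(\rho)\to\Phi_\infty(\rho)$ for every $\rho$. (3) There are universal constants $c>0$ and $k\in\mathbb N$ such that for every $K>0$ there is a constant $C>0$, depending only on $K$, with the following property. Let $N\ge2$, $\Delta>0$, $b\in\mathbb R$, $0<\varepsilon\le1$, $\beta\in[0,\infty]$, $\widetilde\lambda=\widetilde\lambda_\star(\beta)$ (so $\widetilde\lambda=1$ for $\beta=\infty$), and $$\alpha=\frac{\varepsilon^{3/2}\,\widetilde\lambda^{3/2}\Delta}{N^4},\qquad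 t=\frac{N}{\Delta\sqrt{\varepsilon\widetilde\lambda}},\qquad \ell=\log\frac{N}{\varepsilon\widetilde\lambda}.$$ Then for every $L\in\mathbb N$ with $c\,\frac{N^2}{\alpha^2t^2\widetilde\lambda}\,\ell^k\le L\le K\,\frac{N^2}{\alpha^2t^2\widetilde\lambda}\,\ell^k$, i.e. $L=\widetilde O\big(\frac{N^2}{\alpha^2t^2\widetilde\lambda}\big)$, and every density matrix $\rho$ that commutes with $H_S$, $$\big\|\rho_S(\beta)-\Phi_\beta^{\circ L}(\rho)\big\|_1\le C\,\varepsilon\,\ell^k=\widetilde O(\varepsilon),\qquad L\,t\le C\,\frac{N^9}{\Delta\,\varepsilon^{5/2}\,\widetilde\lambda^{7/2}}\,\ell^k .$$ In particular, at $\beta=\infty$ the ground state is prepared with total simulation time $\widetilde O\big(\frac{N^9}{\Delta\varepsilon^{5/2}}\big)$. -/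

import Mathlib

open Matrix MeasureTheory Filter Topology
open scoped ComplexOrder

noncomputable section

namespace OscThermal

/-! ## Random interaction -/

section Haar

variable {ι : Type} [Fintype ι] [DecidableEq ι]

/-- The unitary group is compact (closed, with entries of modulus at most one). -/
instance unitaryGroup_compactSpace : CompactSpace (Matrix.unitaryGroup ι ℂ) := by
  have hc : IsCompact ((Metric.closedBall (0 : ℂ) 1).matrix : Set (Matrix ι ι ℂ)) :=
    (isCompact_closedBall (0 : ℂ) 1).matrix
  have hcl : IsClosed ((Matrix.unitaryGroup ι ℂ : Submonoid (Matrix ι ι ℂ)) :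
      Set (Matrix ι ι ℂ)) := isClosed_unitary
  refine isCompact_iff_compactSpace.mp (hc.of_isClosed_subset hcl ?_)
  intro U hU i j
  simpa using entry_norm_bound_of_unitary hU i j

instance unitaryGroup_measurableSpace : MeasurableSpace (Matrix.unitaryGroup ι ℂ) := borel _

instance unitaryGroup_borelSpace : BorelSpace (Matrix.unitaryGroup ι ℂ) := ⟨rfl⟩

variable (ι) in
/-- Haar measure on the unitary group, normalised to total mass one. -/
def haarUnitary : Measure (Matrix.unitaryGroup ι ℂ) := Measure.haarMeasure ⊤

variable (ι) in
/-- The law of the pair `(U, D)`: a Haar unitary and, independently, i.i.d. standard Gaussian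
eigenvalues. -/
def interactionLaw : Measure (Matrix.unitaryGroup ι ℂ × (ι → ℝ)) :=
  (haarUnitary ι).prod (Measure.pi fun _ => ProbabilityTheory.gaussianReal 0 1)

/-- The random interaction `G = U D U†`. -/
def interaction (ω : Matrix.unitaryGroup ι ℂ × (ι → ℝ)) : Matrix ι ι ℂ :=
  (ω.1 : Matrix ι ι ℂ) * Matrix.diagonal (fun i => (ω.2 i : ℂ)) * (ω.1 : Matrix ι ι ℂ)ᴴ

end Haar

/-! ## The thermalizing channel -/

section Channel

variable {S : Type} [Fintype S] [DecidableEq S]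

/-- The operator that is diagonal in the energy eigenbasis, with real eigenvalues `v`. -/
def diagOp {κ : Type} [DecidableEq κ] (v : κ → ℝ) : Matrix κ κ ℂ :=
  Matrix.diagonal fun i => (v i : ℂ)

/-- Partial trace over the environment qubit. -/
def traceEnv (A : Matrix (S × Fin 2) (S × Fin 2) ℂ) : Matrix S S ℂ :=
  Matrix.of fun i j => ∑ a, A (i, a) (j, a)

/-- Eigenvalues of the environment qubit Hamiltonian `diag(0, γ)`. -/
def envEnergy (γ : ℝ) : Fin 2 → ℝ := ![0, γ]

/-- The total free Hamiltonian `H_S ⊗ 1 + 1 ⊗ H_E`. -/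
def freeHamiltonian (E : S → ℝ) (γ : ℝ) : Matrix (S × Fin 2) (S × Fin 2) ℂ :=
  Matrix.kronecker (diagOp E) (1 : Matrix (Fin 2) (Fin 2) ℂ) +
    Matrix.kronecker (1 : Matrix S S ℂ) (diagOp (envEnergy γ))

/-- Evolution of `ρ ⊗ ρ_E` for one fixed interaction `G`:
`e^{i (H + α G) t} (ρ ⊗ ρ_E) e^{-i (H + α G) t}`. -/
def fixedEvolution (E : S → ℝ) (γ α t : ℝ) (G : Matrix (S × Fin 2) (S × Fin 2) ℂ)
    (σ : Matrix (S × Fin 2) (S × Fin 2) ℂ) : Matrix (S × Fin 2) (S × Fin 2) ℂ :=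
  NormedSpace.exp ((Complex.I * (t : ℂ)) • (freeHamiltonian E γ + (α : ℂ) • G)) * σ *
    NormedSpace.exp (-((Complex.I * (t : ℂ)) • (freeHamiltonian E γ + (α : ℂ) • G)))

/-- The channel `Φ(ρ) = Tr_E 𝔼_G [e^{i(H+αG)t} (ρ ⊗ diag q) e^{-i(H+αG)t}]`, where the environment
qubit is prepared with populations `q`. The expectation is taken entry by entry. -/
def channel (E : S → ℝ) (γ : ℝ) (q : Fin 2 → ℝ) (α t : ℝ) (ρ : Matrix S S ℂ) : Matrix S S ℂ :=
  traceEnv (Matrix.of fun x y => ∫ ω, fixedEvolution E γ α t (interaction ω)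
    (Matrix.kronecker ρ (diagOp q)) x y ∂(interactionLaw (S × Fin 2)))

/-- Trace norm: the sum of the singular values. -/
def traceNorm (A : Matrix S S ℂ) : ℝ :=
  ∑ i, Real.sqrt ((Matrix.isHermitian_conjTranspose_mul_self A).eigenvalues i)

/-- Density matrices. -/
def IsDensity (ρ : Matrix S S ℂ) : Prop := ρ.PosSemidef ∧ ρ.trace = 1

end Channel

/-! ## Thermal populations -/

/-- Boltzmann populations `e^{-β E i} / Z(β)`; the thermal state is `diagOp (gibbs E β)`. -/
def gibbs {κ : Type} [Fintype κ] (E : κ → ℝ) (β : ℝ) (i : κ) : ℝ :=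
  Real.exp (-β * E i) / ∑ j, Real.exp (-β * E j)

/-- Populations of the pure state on the lowest level (the `β = ∞` state of a system whose
energies are strictly increasing). -/
def ground (n : ℕ) (i : Fin n) : ℝ := if (i : ℕ) = 0 then 1 else 0

/-! ## The on-resonance Markov chain -/

section Chain

variable {S : Type} [Fintype S] [DecidableEq S]

/-- The rescaled coupling `α t / √(dim + 1)`, with `dim = 2 dim_S`. -/
def rescaledCoupling (S : Type) [Fintype S] (α t : ℝ) : ℝ :=
  α * t / Real.sqrt (2 * (Fintype.card S : ℝ) + 1)

/-- The least distance between two distinct differences of system energies. -/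
def deltaMin (E : S → ℝ) : ℝ :=
  sInf {x | ∃ i j k l, E i - E j ≠ E k - E l ∧ x = |(E i - E j) - (E k - E l)|}

/-- The `sinc²` factor of a transition with energy mismatch `x`, kept only on resonance, that is
for a mismatch smaller than `δ`. -/
def resonant (δ t x : ℝ) : ℝ := if |x| < δ then Real.sinc (x * t / 2) ^ 2 else 0

/-- The on-resonance transition amplitude from level `i` to level `j ≠ i`. -/
def onRate (E : S → ℝ) (γ : ℝ) (q : Fin 2 → ℝ) (α t : ℝ) (i j : S) : ℝ :=
  rescaledCoupling S α t ^ 2 *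
    (q 0 * resonant (deltaMin E) t (E i - E j - γ) + q 1 * resonant (deltaMin E) t (E i - E j + γ))

/-- The on-resonance transition matrix `T`. The entry in row `j`, column `i` is the transition
`i → j`, and every column sums to zero. The Markov chain is `1 + T`. -/
def transition (E : S → ℝ) (γ : ℝ) (q : Fin 2 → ℝ) (α t : ℝ) : Matrix S S ℝ :=
  Matrix.of fun j i =>
    if j = i then -∑ k ∈ Finset.univ.erase i, onRate E γ q α t i k else onRate E γ q α t i j

/-- Spectral gap of a matrix with eigenvalue `0`: remove one copy of the eigenvalue `0` (with
algebraic multiplicity) from the complex spectrum and take the least modulus of the rest. -/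
def spectralGap (A : Matrix S S ℝ) : ℝ :=
  sInf {x | ∃ μ ∈ (A.map (algebraMap ℝ ℂ)).charpoly.roots.erase 0, x = ‖μ‖}

end Chain

/-! ## The truncated harmonic oscillator -/

/-- Energy levels `Δ, 2Δ, …, NΔ`, up to a constant offset `b`. -/
def oscEnergy (N : ℕ) (Δ b : ℝ) (i : Fin N) : ℝ := ((i : ℕ) + 1 : ℝ) * Δ + b

/-- The nearest-neighbour generator with rate `q 0` one level down and `q 1` one level up (row:
target, column: source; columns sum to zero). -/
def ladder (N : ℕ) (q : Fin 2 → ℝ) : Matrix (Fin N) (Fin N) ℝ :=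
  Matrix.of fun j i =>
    if (j : ℕ) + 1 = i then q 0
    else if (j : ℕ) = i + 1 then q 1
    else if j = i then
      -((if 0 < (i : ℕ) then q 0 else 0) + (if (i : ℕ) + 1 < N then q 1 else 0))
    else 0

/-- The spectral gap of the rescaled transition matrix at inverse temperature `β`. -/
def oscGap (N : ℕ) (Δ β : ℝ) : ℝ := spectralGap (ladder N (gibbs (envEnergy Δ) β))

/-- The coupling constant `α = ε^{3/2} λ^{3/2} Δ / N⁴`. -/
def oscAlpha (N : ℕ) (Δ ε lam : ℝ) : ℝ :=
  ε ^ (3 / 2 : ℝ) * lam ^ (3 / 2 : ℝ) * Δ / (N : ℝ) ^ 4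

/-- The time per interaction `t = N / (Δ √(ε λ))`. -/
def oscTime (N : ℕ) (Δ ε lam : ℝ) : ℝ := (N : ℝ) / (Δ * Real.sqrt (ε * lam))

/-- The number of interactions without logarithms, `N² / (α² t² λ)`. -/
def oscSteps (N : ℕ) (Δ ε lam : ℝ) : ℝ :=
  (N : ℝ) ^ 2 / (oscAlpha N Δ ε lam ^ 2 * oscTime N Δ ε lam ^ 2 * lam)

/-- The logarithmic factor that soft-O notation hides. -/
def oscLog (N : ℕ) (ε lam : ℝ) : ℝ := Real.log ((N : ℝ) / (ε * lam))

end OscThermal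

end

/-!
On diagonal states the averaged channel is a Markov chain on the levels of `S`: flipping the sign of
one level preserves the law of `G = U D U†` and reverses the coherences with that level, so these
average to zero. Up to an error of third order in `α t`, the transition probabilities are given by
Fermi's golden rule, and the Haar and Gaussian second moments turn `α² t²` into
`rescaledCoupling ^ 2 = α² t² / (2 N + 1)`. For the oscillator only neighbouring levels are
resonant, and the detuned transitions are smaller by a factor `O(1 / (Δ t)²)`. Hence one
interaction is close to `1 + rescaledCoupling ^ 2 • ladder N q`, and since stochastic matrices
contract the `ℓ¹` norm, the errors of `L` interactions add up.

The matrix `ladder N q` is diagonalised by passing to the probability flux through the cuts between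
neighbouring levels, where it becomes a tridiagonal Toeplitz matrix with Dirichlet boundary values
and eigenvectors `j ↦ (q₁ / q₀) ^ (j / 2) sin (j k π / N)`. Its gap is
`q₀ + q₁ - 2 √(q₀ q₁) cos (π / N)`. Mixing needs more than the gap, because the eigenbasis
degenerates as `q₁ → 0`: one uses a positive weight on the cuts whose weighted `ℓ¹` norm contracts
at rate at least `gap / 8`, and whose condition number is only exponential in `N`, uniformly in the
temperature. The factor `exp (O(N))` costs `O(N)` relaxation times, which the `N²` in the prescribed
number of interactions absorbs.
-/

noncomputable section

namespace OscThermal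

/-! ## The nearest-neighbour generator -/

section Ladder

variable {N : ℕ} {q : Fin 2 → ℝ}

/-- The discrete divergence `i ↦ F i - F (i + 1)` of a sequence `F` attached to the cuts
`0, …, N` of the ladder; cut `j` separates the levels `j - 1` and `j`. -/
def diffVec (N : ℕ) : (ℕ → ℝ) →ₗ[ℝ] Fin N → ℝ where
  toFun F i := F i - F (i + 1)
  map_add' F G := by ext i; simp only [Pi.add_apply]; ring
  map_smul' c F := by ext i; simp only [Pi.smul_apply, smul_eq_mul, RingHom.id_apply]; ring

/-- The upward probability flux through cut `j` for the populations `p`; nothing flows through the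
outer cuts `0` and `N`. -/
def flux (N : ℕ) (q : Fin 2 → ℝ) (p : ℕ → ℝ) (j : ℕ) : ℝ :=
  if 0 < j ∧ j < N then q 1 * p (j - 1) - q 0 * p j else 0

/-- The action of the generator on cut sequences: `ladder N q` intertwines with it along
`diffVec N`. -/
def cutGen (N : ℕ) (q : Fin 2 → ℝ) (F : ℕ → ℝ) (j : ℕ) : ℝ :=
  if 0 < j ∧ j < N then q 1 * F (j - 1) + q 0 * F (j + 1) - (q 0 + q 1) * F j else 0

theorem diffVec_apply (F : ℕ → ℝ) (i : Fin N) : diffVec N F i = F i - F (i + 1) := rfl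

theorem diffVec_congr {F G : ℕ → ℝ} (h : ∀ j ≤ N, F j = G j) : diffVec N F = diffVec N G := by
  ext i
  rw [diffVec_apply, diffVec_apply, h _ i.2.le, h _ i.2]

theorem diffVec_eq_zero_iff {F : ℕ → ℝ} (hF : F 0 = 0) :
    diffVec N F = 0 ↔ ∀ j ≤ N, F j = 0 := by
  refine ⟨fun h j hj => ?_, fun h => (diffVec_congr h).trans (map_zero _)⟩
  induction j with
  | zero => exact hF
  | succ j ih =>
    have := congrFun h ⟨j, hj⟩
    simp only [diffVec_apply, ih (by omega), Pi.zero_apply] at this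
    linarith

theorem sum_ite_val_eq {M : Type*} [AddCommMonoid M] (f : ℕ → M) (k : ℕ) :
    ∑ i : Fin N, (if (i : ℕ) = k then f i else 0) = if k < N then f k else 0 := by
  rw [Fin.sum_univ_eq_sum_range fun i => if i = k then f i else 0]
  simp only [Finset.sum_ite_eq', Finset.mem_range]

theorem sum_ite_val_add_one_eq {M : Type*} [AddCommMonoid M] (f : ℕ → M) {k : ℕ} (hk : k ≤ N) :
    ∑ i : Fin N, (if (i : ℕ) + 1 = k then f i else 0) = if 0 < k then f (k - 1) else 0 := by
  obtain rfl | ⟨k, rfl⟩ : k = 0 ∨ ∃ l, k = l + 1 := by cases k <;> simp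
  · simp
  · simp only [Nat.add_right_cancel_iff, sum_ite_val_eq, Nat.succ_pos, if_true,
      Nat.add_sub_cancel, if_pos (Nat.lt_of_succ_le hk)]

theorem ladder_apply_eq_add (i j : Fin N) :
    ladder N q j i = (if (i : ℕ) = j + 1 then q 0 else 0) +
      (if (i : ℕ) + 1 = j then q 1 else 0) -
      (if (i : ℕ) = j then
        (if 0 < (j : ℕ) then q 0 else 0) + (if (j : ℕ) + 1 < N then q 1 else 0) else 0) := by
  simp only [ladder, of_apply, Fin.ext_iff]
  grind

theorem ladder_mulVec_eq_diffVec_flux (p : ℕ → ℝ) :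
    (ladder N q *ᵥ fun i : Fin N => p i) = diffVec N (flux N q p) := by
  ext j
  have hj := j.2
  simp only [mulVec, dotProduct, ladder_apply_eq_add, sub_mul, add_mul, ite_mul, zero_mul,
    Finset.sum_sub_distrib, Finset.sum_add_distrib]
  rw [sum_ite_val_eq (fun i => q 0 * p i), sum_ite_val_add_one_eq (fun i => q 1 * p i) hj.le,
    sum_ite_val_eq fun i => (if 0 < (j : ℕ) then q 0 * p i else 0) +
      if (j : ℕ) + 1 < N then q 1 * p i else 0]
  simp only [diffVec_apply, flux]
  grind

theorem ladder_mulVec_diffVec (F : ℕ → ℝ) :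
    ladder N q *ᵥ diffVec N F = diffVec N (cutGen N q F) := by
  have h := ladder_mulVec_eq_diffVec_flux (N := N) (q := q) fun i => F i - F (i + 1)
  refine h.trans (diffVec_congr fun j _ => ?_)
  simp only [flux, cutGen]
  split_ifs with hj
  · rw [Nat.sub_add_cancel hj.1]; ring
  · rfl

/-- The geometric weights `(q₁ / q₀) ^ i`, which satisfy detailed balance. -/
def geometricVec (N : ℕ) (q : Fin 2 → ℝ) (i : Fin N) : ℝ := (q 1 / q 0) ^ (i : ℕ)

theorem ladder_mulVec_eq_zero_iff (hq : q 0 ≠ 0) {v : Fin N → ℝ} :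
    ladder N q *ᵥ v = 0 ↔ ∃ a : ℝ, v = a • geometricVec N q := by
  obtain ⟨p, rfl⟩ := Fin.val_injective.surjective_comp_right v
  have detailed_balance : ladder N q *ᵥ (fun i : Fin N => p i) = 0 ↔
      ∀ j, j + 1 < N → p (j + 1) = q 1 / q 0 * p j := by
    rw [ladder_mulVec_eq_diffVec_flux, diffVec_eq_zero_iff (by simp [flux])]
    constructor
    · intro h j hj
      have := h (j + 1) hj.le
      rw [flux, if_pos ⟨j.succ_pos, hj⟩, Nat.add_sub_cancel] at this
      field_simp
      linarith
    · intro h j _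
      rw [flux]
      split_ifs with hj
      · have := h (j - 1) (by omega)
        rw [Nat.sub_add_cancel hj.1] at this
        rw [this]
        field_simp
        ring
      · rfl
  refine detailed_balance.trans ⟨fun h => ⟨p 0, ?_⟩, fun ⟨a, ha⟩ j hj => ?_⟩
  · have : ∀ j, j < N → p j = p 0 * (q 1 / q 0) ^ j := fun j => by
      induction j with
      | zero => simp
      | succ j ih => intro hj; rw [h j hj, ih (by omega)]; ring
    exact funext fun i => this i i.2
  · have hp : ∀ i, i < N → p i = a * (q 1 / q 0) ^ i := fun i hi => congrFun ha ⟨i, hi⟩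
    rw [hp _ hj, hp _ (by omega)]
    ring

theorem eq_of_ladder_mulVec_eq_zero (hq : q 0 ≠ 0) {p p' : Fin N → ℝ}
    (hp : ladder N q *ᵥ p = 0) (hp' : ladder N q *ᵥ p' = 0)
    (hs : ∑ i, p i = 1) (hs' : ∑ i, p' i = 1) : p = p' := by
  obtain ⟨a, rfl⟩ := (ladder_mulVec_eq_zero_iff hq).1 hp
  obtain ⟨a', rfl⟩ := (ladder_mulVec_eq_zero_iff hq).1 hp'
  simp only [Pi.smul_apply, smul_eq_mul, ← Finset.mul_sum] at hs hs'
  rw [mul_right_cancel₀ (right_ne_zero_of_mul (hs.trans_ne one_ne_zero)) (hs.trans hs'.symm)]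

end Ladder

section Spectrum

open Polynomial

variable {N : ℕ} {q : Fin 2 → ℝ}

theorem charpoly_eq_prod_of_injective_eigenvalues {ι K : Type*} [Fintype ι] [DecidableEq ι]
    [Field K] {A : Matrix ι ι K} {μ : ι → K} (hμ : Function.Injective μ) {v : ι → ι → K}
    (hv : ∀ k, v k ≠ 0) (hA : ∀ k, A *ᵥ v k = μ k • v k) :
    A.charpoly = ∏ k, (X - C (μ k)) := by
  have isRoot (k : ι) : A.charpoly.IsRoot (μ k) := by
    rw [← mem_spectrum_iff_isRoot_charpoly, ← spectrum_toLin',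
      ← Module.End.hasEigenvalue_iff_mem_spectrum]
    exact Module.End.hasEigenvalue_of_hasEigenvector
      ⟨Module.End.mem_eigenspace_iff.2 ((toLin'_apply _ _).trans (hA k)), hv k⟩
  refine eq_of_monic_of_dvd_of_natDegree_le (monic_prod_X_sub_C μ Finset.univ) A.charpoly_monic
    (Finset.prod_dvd_of_coprime ((pairwise_coprime_X_sub_C hμ).set_pairwise _)
      fun k _ => dvd_iff_isRoot.2 (isRoot k)) ?_
  rw [charpoly_natDegree_eq_dim, natDegree_finsetProd_X_sub_C_eq_card, Finset.card_univ]

theorem spectralGap_eq_iInf_of_charpoly {S κ : Type} [Fintype S] [DecidableEq S] [Fintype κ]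
    {A : Matrix S S ℝ} {μ : κ → ℝ} (hA : A.charpoly = X * ∏ k, (X - C (μ k))) :
    spectralGap A = ⨅ k, |μ k| := by
  have hroots : (A.map (algebraMap ℝ ℂ)).charpoly.roots =
      0 ::ₘ Finset.univ.val.map fun k => (μ k : ℂ) := by
    rw [charpoly_map, hA, Polynomial.map_mul, Polynomial.map_prod, map_X, roots_mul, roots_X,
      Multiset.singleton_add]
    · simp only [Polynomial.map_sub, map_X, map_C, Complex.coe_algebraMap]
      rw [roots_prod _ _ (Finset.prod_ne_zero_iff.2 fun k _ => X_sub_C_ne_zero _)]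
      simp only [roots_X_sub_C, Multiset.bind_singleton]
    · refine mul_ne_zero X_ne_zero (Finset.prod_ne_zero_iff.2 fun k _ => ?_)
      rw [Polynomial.map_sub, map_X, map_C]
      exact X_sub_C_ne_zero _
  rw [spectralGap, hroots, Multiset.erase_cons_head, iInf]
  congr 1
  ext x
  simp [eq_comm]

/-- The sequence `j ↦ (b / a) ^ j sin (j θ)`: an eigenvector of `cutGen` for `a² = q 0`,
`b² = q 1`, and of its transpose with `a` and `b` exchanged. -/
def sineMode (a b θ : ℝ) (j : ℕ) : ℝ := (b / a) ^ j * Real.sin (j * θ)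

theorem sineMode_recurrence {a : ℝ} (ha : a ≠ 0) (b θ : ℝ) (j : ℕ) :
    b ^ 2 * sineMode a b θ j + a ^ 2 * sineMode a b θ (j + 2) =
      2 * (a * b) * Real.cos θ * sineMode a b θ (j + 1) := by
  have hb : b = b / a * a := by field_simp
  have h1 : (j : ℝ) * θ = (j + 1 : ℕ) * θ - θ := by push_cast; ring
  have h2 : ((j + 2 : ℕ) : ℝ) * θ = (j + 1 : ℕ) * θ + θ := by push_cast; ring
  simp only [sineMode]
  rw [h1, h2, Real.sin_sub, Real.sin_add]
  generalize b / a = r at *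
  subst hb
  ring

/-- For `0 < k < N` these are the nonzero eigenvalues of the generator, up to sign. -/
def ladderRate (N : ℕ) (q : Fin 2 → ℝ) (k : ℕ) : ℝ :=
  q 0 + q 1 - 2 * √(q 0 * q 1) * Real.cos (k * (Real.pi / N))

theorem nat_mul_pi_div_mem_Icc {j : ℕ} (hj : j ≤ N) :
    j * (Real.pi / N) ∈ Set.Icc 0 Real.pi := by
  refine ⟨by positivity, ?_⟩
  rw [mul_div_assoc', mul_div_right_comm]
  exact mul_le_of_le_one_left Real.pi_pos.le (div_le_one_of_le₀ (by exact_mod_cast hj) (by simp))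

theorem cos_nat_mul_pi_div_lt {k l : ℕ} (hkl : k < l) (hl : l ≤ N) :
    Real.cos (l * (Real.pi / N)) < Real.cos (k * (Real.pi / N)) := by
  have hN : (0 : ℝ) < N := by exact_mod_cast (by omega : 0 < N)
  refine Real.strictAntiOn_cos (nat_mul_pi_div_mem_Icc (hkl.le.trans hl))
    (nat_mul_pi_div_mem_Icc hl) ?_
  gcongr

theorem sin_nat_mul_pi_div_pos {j : ℕ} (hj : 0 < j) (hjN : j < N) :
    0 < Real.sin (j * (Real.pi / N)) := by
  have hN : (0 : ℝ) < N := by exact_mod_cast (by omega : 0 < N)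
  refine Real.sin_pos_of_pos_of_lt_pi (by positivity) ?_
  rw [mul_div_assoc', div_lt_iff₀ hN, mul_comm]
  gcongr

theorem ladderRate_strictMonoOn (h0 : 0 < q 0) (h1 : 0 < q 1) :
    StrictMonoOn (ladderRate N q) (Set.Iic N) := by
  intro k _ l hl hkl
  have := cos_nat_mul_pi_div_lt hkl hl
  unfold ladderRate
  gcongr

theorem ladderRate_pos (h0 : 0 < q 0) (h1 : 0 ≤ q 1) {k : ℕ} (hk : 0 < k) (hkN : k < N) :
    0 < ladderRate N q k := by
  have hcos : Real.cos (k * (Real.pi / N)) < 1 := by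
    simpa using cos_nat_mul_pi_div_lt hk hkN.le
  have hsquare : ladderRate N q k =
      (√(q 0) - √(q 1)) ^ 2 + 2 * √(q 0 * q 1) * (1 - Real.cos (k * (Real.pi / N))) := by
    rw [ladderRate, Real.sqrt_mul h0.le, sub_sq, Real.sq_sqrt h0.le, Real.sq_sqrt h1]
    ring
  rw [hsquare]
  obtain h1 | h1 := h1.eq_or_lt
  · rw [← h1, Real.sqrt_zero, sub_zero, Real.sq_sqrt h0.le]
    simpa using h0
  · have := mul_pos (Real.sqrt_pos.2 (mul_pos h0 h1)) (sub_pos.2 hcos)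
    nlinarith [sq_nonneg (√(q 0) - √(q 1))]

theorem ladder_mulVec_diffVec_sineMode (h0 : 0 < q 0) (h1 : 0 ≤ q 1) (hN : N ≠ 0) (k : ℕ) :
    ladder N q *ᵥ diffVec N (sineMode (√(q 0)) (√(q 1)) (k * (Real.pi / N))) =
      (-ladderRate N q k) • diffVec N (sineMode (√(q 0)) (√(q 1)) (k * (Real.pi / N))) := by
  rw [ladder_mulVec_diffVec, ← map_smul]
  refine diffVec_congr fun j hj => ?_
  rw [Pi.smul_apply, smul_eq_mul, cutGen]
  split_ifs with hj'
  · obtain ⟨m, rfl⟩ := Nat.exists_eq_add_of_le' hj'.1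
    have hrec := sineMode_recurrence (Real.sqrt_ne_zero'.2 h0) (√(q 1)) (k * (Real.pi / N)) m
    rw [Real.sq_sqrt h0.le, Real.sq_sqrt h1, ← Real.sqrt_mul h0.le] at hrec
    rw [Nat.add_sub_cancel, ladderRate]
    linarith
  · suffices sineMode (√(q 0)) (√(q 1)) (k * (Real.pi / N)) j = 0 by rw [this, mul_zero]
    obtain rfl | rfl : j = 0 ∨ j = N := by omega
    · simp [sineMode]
    · have : (j : ℝ) * (k * (Real.pi / j)) = k * Real.pi := by field_simp
      rw [sineMode, this, Real.sin_nat_mul_pi, mul_zero]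

theorem charpoly_ladder (h0 : 0 < q 0) (h1 : 0 < q 1) :
    (ladder (N + 1) q).charpoly =
      X * ∏ k : Fin N, (X - C (-ladderRate (N + 1) q (k + 1))) := by
  have hpos (k : Fin N) : 0 < ladderRate (N + 1) q (k + 1) :=
    ladderRate_pos h0 h1.le k.val.succ_pos (by omega)
  rw [charpoly_eq_prod_of_injective_eigenvalues
    (μ := Fin.cons 0 fun k : Fin N => -ladderRate (N + 1) q (k + 1))
    (v := Fin.cons (geometricVec (N + 1) q) fun k : Fin N => diffVec (N + 1)
      (sineMode (√(q 0)) (√(q 1)) ((k + 1 : ℕ) * (Real.pi / (N + 1 : ℕ))))),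
    Fin.prod_univ_succ]
  · simp only [Fin.cons_zero, Fin.cons_succ, C_0, sub_zero]
  · refine Fin.cons_injective_iff.2 ⟨fun ⟨k, hk⟩ => (hpos k).ne' (neg_eq_zero.1 hk),
      fun k l hkl => ?_⟩
    have := (ladderRate_strictMonoOn h0 h1).injOn (Set.mem_Iic.2 (by omega))
      (Set.mem_Iic.2 (by omega)) (neg_injective hkl)
    exact Fin.ext (Nat.succ_injective this)
  · refine Fin.cases (fun h => ?_) fun k h => ?_
    · simpa [geometricVec] using congrFun h 0
    · have hmode := (diffVec_eq_zero_iff (by simp [sineMode])).1 h 1 (by omega)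
      have hsin := sin_nat_mul_pi_div_pos k.val.succ_pos (Nat.succ_lt_succ k.2)
      simp only [sineMode, Nat.cast_one, one_mul, pow_one] at hmode
      exact (mul_pos (div_pos (Real.sqrt_pos.2 h1) (Real.sqrt_pos.2 h0)) hsin).ne' hmode
  · refine Fin.cases ?_ fun k => ?_
    · simpa using (ladder_mulVec_eq_zero_iff h0.ne').2 ⟨1, (one_smul ℝ _).symm⟩
    · exact ladder_mulVec_diffVec_sineMode h0 h1.le N.succ_ne_zero _

theorem smul_ladder_blockTriangular (h1 : q 1 = 0) (c : ℝ) :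
    (c • ladder N q).BlockTriangular id := by
  intro j i (hij : (i : ℕ) < j)
  simp only [ladder, Matrix.smul_apply, smul_eq_mul, of_apply, h1, Fin.ext_iff]
  grind

theorem charpoly_smul_ladder_of_eq_zero (hN : 0 < N) (h1 : q 1 = 0) (c : ℝ) :
    (c • ladder N q).charpoly = X * (X + C (c * q 0)) ^ (N - 1) := by
  obtain ⟨n, rfl⟩ := Nat.exists_eq_add_of_le' hN
  rw [charpoly_of_isUpperTriangular _ (smul_ladder_blockTriangular h1 c), Fin.prod_univ_succ]
  simp [ladder, h1]

/-- At `q₁ = 0` the nonzero eigenvalue `-q₀` is degenerate and is read off the triangular form. -/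
theorem spectralGap_ladder (h0 : 0 < q 0) (h1 : 0 ≤ q 1) (hN : 2 ≤ N) :
    spectralGap (ladder N q) = ladderRate N q 1 := by
  obtain ⟨M, rfl⟩ := Nat.exists_eq_add_of_le' (one_le_two.trans hN)
  have : NeZero M := ⟨by omega⟩
  obtain h1 | h1 := h1.eq_or_lt
  · have hchar := charpoly_smul_ladder_of_eq_zero (N := M + 1) M.succ_pos h1.symm 1
    rw [one_smul, one_mul, Nat.add_sub_cancel] at hchar
    rw [spectralGap_eq_iInf_of_charpoly (κ := Fin M) (μ := fun _ => -q 0) (by simp [hchar]),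
      ciInf_const, abs_neg, abs_of_pos h0, ladderRate, ← h1]
    simp
  · have habs (k : Fin M) : |-ladderRate (M + 1) q (k + 1)| = ladderRate (M + 1) q (k + 1) := by
      rw [abs_neg, abs_of_pos (ladderRate_pos h0 h1.le k.val.succ_pos (by omega))]
    rw [spectralGap_eq_iInf_of_charpoly (charpoly_ladder h0 h1)]
    simp only [habs]
    refine le_antisymm ((ciInf_le (Set.finite_range _).bddBelow 0).trans_eq (by simp))
      (le_ciInf fun k => ?_)
    exact (ladderRate_strictMonoOn h0 h1).monotoneOn (by simp) (by simp) (by omega)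

end Spectrum

/-! ## Mixing of the ladder -/

section LadderMixing

variable {N : ℕ} {q : Fin 2 → ℝ}

/-- A weight on the cuts of the ladder which the transpose of `cutGen` decreases at rate at least
`κ`. Its values at the outer cuts `0` and `N` only have to be nonnegative. -/
structure IsCutWeight (N : ℕ) (q : Fin 2 → ℝ) (κ : ℝ) (v : ℕ → ℝ) : Prop where
  nonneg : ∀ j ≤ N, 0 ≤ v j
  contract : ∀ j, 0 < j → j < N → q 1 * v (j + 1) + q 0 * v (j - 1) ≤ (q 0 + q 1 - κ) * v j

theorem IsCutWeight.mono {κ κ' : ℝ} {v : ℕ → ℝ} (h : IsCutWeight N q κ v) (hκ : κ' ≤ κ) :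
    IsCutWeight N q κ' v where
  nonneg := h.nonneg
  contract j hj hjN := (h.contract j hj hjN).trans <| by
    have := h.nonneg j hjN.le
    gcongr

theorem isCutWeight_two_pow : IsCutWeight N q (q 0 / 2 - q 1) fun j => 2 ^ j where
  nonneg j _ := by positivity
  contract j hj _ := by
    obtain ⟨m, rfl⟩ := Nat.exists_eq_add_of_le' hj
    rw [Nat.add_sub_cancel, pow_succ, pow_succ]
    linarith

theorem isCutWeight_sineMode (h0 : 0 ≤ q 0) (h1 : 0 < q 1) :
    IsCutWeight N q (ladderRate N q 1) (sineMode (√(q 1)) (√(q 0)) (Real.pi / N)) where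
  nonneg j hj := by
    have hmem := nat_mul_pi_div_mem_Icc hj
    exact mul_nonneg (by positivity) (Real.sin_nonneg_of_nonneg_of_le_pi hmem.1 hmem.2)
  contract j hj _ := by
    obtain ⟨m, rfl⟩ := Nat.exists_eq_add_of_le' hj
    have hrec := sineMode_recurrence (Real.sqrt_ne_zero'.2 h1) (√(q 0)) (Real.pi / N) m
    rw [Real.sq_sqrt h0, Real.sq_sqrt h1.le, mul_comm √(q 1), ← Real.sqrt_mul h0] at hrec
    rw [Nat.add_sub_cancel, ladderRate, Nat.cast_one, one_mul]
    linarith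

theorem one_div_le_sin_nat_mul_pi_div {j : ℕ} (hj : 0 < j) (hjN : j < N) :
    1 / (N : ℝ) ≤ Real.sin (j * (Real.pi / N)) := by
  have hN : (0 : ℝ) < N := by exact_mod_cast (by omega : 0 < N)
  have left_half (m : ℕ) (hm : 0 < m) (hmN : 2 * m ≤ N) :
      1 / (N : ℝ) ≤ Real.sin (m * (Real.pi / N)) := by
    have hm' : (1 : ℝ) ≤ m := by exact_mod_cast hm
    have hmN' : 2 * (m : ℝ) ≤ N := by exact_mod_cast hmN
    calc 1 / (N : ℝ) ≤ 2 * m / N := by gcongr; linarith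
      _ = 2 / Real.pi * (m * (Real.pi / N)) := by field_simp
      _ ≤ Real.sin (m * (Real.pi / N)) := by
        refine Real.mul_le_sin (by positivity) ?_
        rw [mul_div_assoc', div_le_div_iff₀ hN two_pos]
        nlinarith [Real.pi_pos]
  obtain h | h := le_total (2 * j) N
  · exact left_half j hj h
  · have hrefl : ((N - j : ℕ) : ℝ) * (Real.pi / N) = Real.pi - j * (Real.pi / N) := by
      rw [Nat.cast_sub hjN.le]
      field_simp
    have hright := left_half (N - j) (by omega) (by omega)
    rwa [hrefl, Real.sin_pi_sub] at hright

/-- As `q₁ / q₀ → 0` the exact eigenvector `sineMode` grows without bound, but then the weight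
`2 ^ j` contracts at a rate comparable to the gap. -/
theorem exists_isCutWeight (h0 : 0 < q 0) (h10 : q 1 ≤ q 0) {κ : ℝ}
    (hκ : κ ≤ ladderRate N q 1) (hκ' : κ ≤ q 0 / 4) :
    ∃ v, IsCutWeight N q κ v ∧ ∀ j, 0 < j → j < N → 1 / (N : ℝ) ≤ v j ∧ v j ≤ 3 ^ N := by
  have hpow {r : ℝ} (hr : 0 ≤ r) (hr3 : r ≤ 3) {j : ℕ} (hj : j < N) : r ^ j ≤ 3 ^ N :=
    (pow_le_pow_left₀ hr hr3 j).trans (pow_le_pow_right₀ (by norm_num) hj.le)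
  obtain hsmall | hlarge := le_total (4 * q 1) (q 0)
  · refine ⟨_, isCutWeight_two_pow.mono (by linarith), fun j _ hj => ⟨?_, ?_⟩⟩
    · exact (div_le_self one_pos.le (Nat.one_le_cast.2 (by omega))).trans (one_le_pow₀ one_le_two)
    · exact hpow two_pos.le (by norm_num) hj
  · have h1 : 0 < q 1 := by linarith
    have hs : 0 < √(q 1) := Real.sqrt_pos.2 h1
    have hr1 : 1 ≤ √(q 0) / √(q 1) := (one_le_div hs).2 (Real.sqrt_le_sqrt h10)
    have hr3 : √(q 0) / √(q 1) ≤ 3 := by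
      rw [div_le_iff₀ hs]
      refine Real.sqrt_le_iff.2 ⟨by positivity, ?_⟩
      rw [mul_pow, Real.sq_sqrt h1.le]
      linarith
    refine ⟨_, (isCutWeight_sineMode h0.le h1).mono hκ, fun j hj hjN => ?_⟩
    have hsin := one_div_le_sin_nat_mul_pi_div hj hjN
    have hsin0 : 0 ≤ Real.sin (j * (Real.pi / N)) := le_trans (by positivity) hsin
    exact ⟨hsin.trans (le_mul_of_one_le_left hsin0 (one_le_pow₀ hr1)),
      (mul_le_of_le_one_right (by positivity) (Real.sin_le_one _)).trans
        (hpow (by positivity) hr3 hjN)⟩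

/-- The `ℓ¹` norm, with weights `v`, of a sequence on the inner cuts `1, …, N - 1`. -/
def cutNorm (N : ℕ) (v F : ℕ → ℝ) : ℝ := ∑ j ∈ Finset.range (N - 1), v (j + 1) * |F (j + 1)|

/-- One step of the Markov chain `1 + s • ladder N q`, read on cut sequences. -/
def cutStep (N : ℕ) (q : Fin 2 → ℝ) (s : ℝ) (F : ℕ → ℝ) : ℕ → ℝ := F + s • cutGen N q F

theorem cutStep_eq_zero {s : ℝ} {F : ℕ → ℝ} {j : ℕ} (hj : ¬(0 < j ∧ j < N)) (hF : F j = 0) :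
    cutStep N q s F j = 0 := by
  rw [cutStep, Pi.add_apply, Pi.smul_apply, cutGen, if_neg hj, hF, smul_zero, add_zero]

theorem one_add_smul_ladder_pow_mulVec_diffVec (s : ℝ) (F : ℕ → ℝ) (L : ℕ) :
    (1 + s • ladder N q) ^ L *ᵥ diffVec N F = diffVec N ((cutStep N q s)^[L] F) := by
  induction L with
  | zero => rw [pow_zero, one_mulVec, Function.iterate_zero_apply]
  | succ L ih =>
    rw [pow_succ', ← mulVec_mulVec, ih, Function.iterate_succ_apply', add_mulVec, one_mulVec,
      smul_mulVec, ladder_mulVec_diffVec, ← map_smul, ← map_add, cutStep]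

theorem sum_mul_neighbours_le (M : ℕ) {a b : ℝ} (ha : 0 ≤ a) (hb : 0 ≤ b) {v f : ℕ → ℝ}
    (hv : ∀ j ≤ M + 1, 0 ≤ v j) (hf : ∀ j, 0 ≤ f j) (hf0 : f 0 = 0) (hfM : f (M + 1) = 0) :
    ∑ j ∈ Finset.range M, v (j + 1) * (a * f j + b * f (j + 2)) ≤
      ∑ j ∈ Finset.range M, (a * v (j + 2) + b * v j) * f (j + 1) := by
  have shift_left : ∑ j ∈ Finset.range M, v (j + 1) * f j ≤
      ∑ j ∈ Finset.range M, v (j + 2) * f (j + 1) := by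
    have h := (Finset.sum_range_succ (fun j => v (j + 1) * f j) M).symm.trans
      (Finset.sum_range_succ' _ _)
    simp only [hf0, mul_zero, add_zero] at h
    exact h ▸ le_add_of_nonneg_right (mul_nonneg (hv _ le_rfl) (hf M))
  have shift_right : ∑ j ∈ Finset.range M, v (j + 1) * f (j + 2) ≤
      ∑ j ∈ Finset.range M, v j * f (j + 1) := by
    have h := (Finset.sum_range_succ (fun j => v j * f (j + 1)) M).symm.trans
      (Finset.sum_range_succ' _ _)
    simp only [hfM, mul_zero, add_zero] at h
    exact h ▸ le_add_of_nonneg_right (mul_nonneg (hv _ (by omega)) (hf _))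
  calc ∑ j ∈ Finset.range M, v (j + 1) * (a * f j + b * f (j + 2))
      = a * ∑ j ∈ Finset.range M, v (j + 1) * f j +
          b * ∑ j ∈ Finset.range M, v (j + 1) * f (j + 2) := by
        simp only [Finset.mul_sum, ← Finset.sum_add_distrib]
        exact Finset.sum_congr rfl fun j _ => by ring
    _ ≤ a * ∑ j ∈ Finset.range M, v (j + 2) * f (j + 1) +
          b * ∑ j ∈ Finset.range M, v j * f (j + 1) := by gcongr
    _ = ∑ j ∈ Finset.range M, (a * v (j + 2) + b * v j) * f (j + 1) := by
        simp only [Finset.mul_sum, ← Finset.sum_add_distrib]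
        exact Finset.sum_congr rfl fun j _ => by ring

theorem abs_cutStep_succ_le (h0 : ∀ a, 0 ≤ q a) {s : ℝ} (hs : 0 ≤ s) (hs1 : s * (q 0 + q 1) ≤ 1)
    (F : ℕ → ℝ) {j : ℕ} (hj : j + 1 < N) :
    |cutStep N q s F (j + 1)| ≤
      (1 - s * (q 0 + q 1)) * |F (j + 1)| + s * (q 1 * |F j| + q 0 * |F (j + 2)|) := by
  have hstep : cutStep N q s F (j + 1) =
      (1 - s * (q 0 + q 1)) * F (j + 1) + s * (q 1 * F j + q 0 * F (j + 2)) := by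
    rw [cutStep, Pi.add_apply, Pi.smul_apply, smul_eq_mul, cutGen, if_pos ⟨j.succ_pos, hj⟩,
      Nat.add_sub_cancel]
    ring
  rw [hstep]
  refine (abs_add_le _ _).trans ?_
  rw [abs_mul, abs_mul, abs_of_nonneg (sub_nonneg.2 hs1), abs_of_nonneg hs]
  gcongr
  refine (abs_add_le _ _).trans_eq ?_
  rw [abs_mul, abs_mul, abs_of_nonneg (h0 0), abs_of_nonneg (h0 1)]

theorem cutNorm_cutStep_le {κ s : ℝ} {v F : ℕ → ℝ} (h : IsCutWeight N q κ v) (h0 : ∀ a, 0 ≤ q a)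
    (hs : 0 ≤ s) (hs1 : s * (q 0 + q 1) ≤ 1) (hF0 : F 0 = 0) (hFN : F N = 0) :
    cutNorm N v (cutStep N q s F) ≤ (1 - s * κ) * cutNorm N v F := by
  obtain rfl | ⟨M, rfl⟩ : N = 0 ∨ ∃ M, N = M + 1 := by cases N <;> simp
  · simp [cutNorm]
  simp only [cutNorm, Nat.add_sub_cancel]
  calc ∑ j ∈ Finset.range M, v (j + 1) * |cutStep (M + 1) q s F (j + 1)|
      ≤ ∑ j ∈ Finset.range M, v (j + 1) * ((1 - s * (q 0 + q 1)) * |F (j + 1)| +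
          s * (q 1 * |F j| + q 0 * |F (j + 2)|)) := by
        refine Finset.sum_le_sum fun j hj => ?_
        have hj := Finset.mem_range.1 hj
        exact mul_le_mul_of_nonneg_left (abs_cutStep_succ_le h0 hs hs1 F (by omega))
          (h.nonneg _ (by omega))
    _ = (1 - s * (q 0 + q 1)) * ∑ j ∈ Finset.range M, v (j + 1) * |F (j + 1)| +
          s * ∑ j ∈ Finset.range M, v (j + 1) * (q 1 * |F j| + q 0 * |F (j + 2)|) := by
        simp only [Finset.mul_sum, ← Finset.sum_add_distrib]
        exact Finset.sum_congr rfl fun j _ => by ring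
    _ ≤ (1 - s * (q 0 + q 1)) * ∑ j ∈ Finset.range M, v (j + 1) * |F (j + 1)| +
          s * ∑ j ∈ Finset.range M, (q 1 * v (j + 2) + q 0 * v j) * |F (j + 1)| := by
        gcongr _ + s * ?_
        exact sum_mul_neighbours_le M (h0 1) (h0 0) h.nonneg (fun j => abs_nonneg (F j))
          (by rw [hF0, abs_zero]) (by rw [hFN, abs_zero])
    _ ≤ (1 - s * (q 0 + q 1)) * ∑ j ∈ Finset.range M, v (j + 1) * |F (j + 1)| +
          s * ∑ j ∈ Finset.range M, (q 0 + q 1 - κ) * v (j + 1) * |F (j + 1)| := by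
        gcongr with j hj
        have hj := Finset.mem_range.1 hj
        exact h.contract (j + 1) j.succ_pos (by omega)
    _ = (1 - s * κ) * ∑ j ∈ Finset.range M, v (j + 1) * |F (j + 1)| := by
        simp only [mul_assoc, ← Finset.mul_sum]
        ring

theorem cutNorm_iterate_cutStep_le {κ s : ℝ} {v F : ℕ → ℝ} (h : IsCutWeight N q κ v)
    (h0 : ∀ a, 0 ≤ q a) (hs : 0 ≤ s) (hs1 : s * (q 0 + q 1) ≤ 1) (hκ : s * κ ≤ 1)
    (hF0 : F 0 = 0) (hFN : F N = 0) (L : ℕ) :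
    cutNorm N v ((cutStep N q s)^[L] F) ≤ (1 - s * κ) ^ L * cutNorm N v F := by
  induction L generalizing F with
  | zero => rw [Function.iterate_zero_apply, pow_zero, one_mul]
  | succ L ih =>
    rw [Function.iterate_succ_apply, pow_succ, mul_assoc]
    exact (ih (cutStep_eq_zero (by omega) hF0) (cutStep_eq_zero (by omega) hFN)).trans
      (mul_le_mul_of_nonneg_left (cutNorm_cutStep_le h h0 hs hs1 hF0 hFN)
        (pow_nonneg (sub_nonneg.2 hκ) L))

theorem exists_diffVec_eq (d : Fin N → ℝ) (hd : ∑ i, d i = 0) :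
    ∃ F : ℕ → ℝ, F 0 = 0 ∧ F N = 0 ∧ diffVec N F = d ∧ ∀ j ≤ N, |F j| ≤ ∑ i, |d i| := by
  obtain ⟨w, rfl⟩ := Fin.val_injective.surjective_comp_right d
  simp only [Function.comp_apply] at hd ⊢
  rw [Fin.sum_univ_eq_sum_range] at hd
  refine ⟨fun j => -∑ i ∈ Finset.range j, w i, by simp, by simp [hd], ?_, fun j hj => ?_⟩
  · ext i
    rw [diffVec_apply, Finset.sum_range_succ, Function.comp_apply]
    ring
  · rw [abs_neg, Fin.sum_univ_eq_sum_range fun i => |w i|]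
    exact (Finset.abs_sum_le_sum_abs _ _).trans
      (Finset.sum_le_sum_of_subset_of_nonneg (Finset.range_subset_range.2 hj)
        fun _ _ _ => abs_nonneg _)

theorem sum_abs_diffVec_le {F : ℕ → ℝ} (hF0 : F 0 = 0) (hFN : F N = 0) :
    ∑ i, |diffVec N F i| ≤ 2 * ∑ j ∈ Finset.range (N - 1), |F (j + 1)| := by
  obtain rfl | ⟨M, rfl⟩ : N = 0 ∨ ∃ M, N = M + 1 := by cases N <;> simp
  · simp
  calc ∑ i, |diffVec (M + 1) F i|
      ≤ ∑ i : Fin (M + 1), (|F i| + |F (i + 1)|) := Finset.sum_le_sum fun i _ => abs_sub _ _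
    _ = ∑ j ∈ Finset.range (M + 1), |F j| + ∑ j ∈ Finset.range (M + 1), |F (j + 1)| := by
        rw [Fin.sum_univ_eq_sum_range fun j => |F j| + |F (j + 1)|, Finset.sum_add_distrib]
    _ = 2 * ∑ j ∈ Finset.range (M + 1 - 1), |F (j + 1)| := by
        rw [Finset.sum_range_succ', Finset.sum_range_succ (fun j => |F (j + 1)|), hF0, hFN,
          abs_zero, add_zero, ← two_mul, Nat.add_sub_cancel]

theorem sum_abs_one_add_smul_ladder_pow_mulVec_le {κ s m M : ℝ} {v : ℕ → ℝ}
    (h : IsCutWeight N q κ v) (hm : 0 < m) (hv : ∀ j, 0 < j → j < N → m ≤ v j ∧ v j ≤ M)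
    (h0 : ∀ a, 0 ≤ q a) (hs : 0 ≤ s) (hs1 : s * (q 0 + q 1) ≤ 1) (hκ : s * κ ≤ 1)
    {d : Fin N → ℝ} (hd : ∑ i, d i = 0) (L : ℕ) :
    ∑ i, |((1 + s • ladder N q) ^ L *ᵥ d) i| ≤
      2 * (1 - s * κ) ^ L * ((N - 1 : ℕ) * (M / m) * ∑ i, |d i|) := by
  obtain ⟨F, hF0, hFN, rfl, hFd⟩ := exists_diffVec_eq d hd
  set D := ∑ i, |diffVec N F i|
  set F' := (cutStep N q s)^[L] F
  have hpow : 0 ≤ (1 - s * κ) ^ L := pow_nonneg (sub_nonneg.2 hκ) L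
  have zero_of_zero (j : ℕ) (hj : ¬(0 < j ∧ j < N)) (hF : F j = 0) : F' j = 0 :=
    Function.Iterate.rec (fun G : ℕ → ℝ => G j = 0) hF (fun _ => cutStep_eq_zero hj) L
  have lower : m * ∑ j ∈ Finset.range (N - 1), |F' (j + 1)| ≤ cutNorm N v F' := by
    rw [cutNorm, Finset.mul_sum]
    refine Finset.sum_le_sum fun j hj => ?_
    have hj := Finset.mem_range.1 hj
    exact mul_le_mul_of_nonneg_right (hv _ j.succ_pos (by omega)).1 (abs_nonneg _)
  have upper : cutNorm N v F ≤ (N - 1 : ℕ) * (M * D) := by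
    refine (Finset.sum_le_card_nsmul _ _ (M * D) fun j hj => ?_).trans_eq
      (by rw [Finset.card_range, nsmul_eq_mul])
    have hj := Finset.mem_range.1 hj
    obtain ⟨hmv, hvM⟩ := hv (j + 1) j.succ_pos (by omega)
    exact mul_le_mul hvM (hFd _ (by omega)) (abs_nonneg _) (hm.le.trans (hmv.trans hvM))
  rw [one_add_smul_ladder_pow_mulVec_diffVec]
  calc ∑ i, |diffVec N F' i|
      ≤ 2 * ∑ j ∈ Finset.range (N - 1), |F' (j + 1)| :=
        sum_abs_diffVec_le (zero_of_zero 0 (by omega) hF0) (zero_of_zero N (by omega) hFN)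
    _ ≤ 2 * (cutNorm N v F' / m) := by gcongr; exact (le_div_iff₀' hm).2 lower
    _ ≤ 2 * ((1 - s * κ) ^ L * ((N - 1 : ℕ) * (M * D)) / m) := by
        gcongr
        exact (cutNorm_iterate_cutStep_le h h0 hs hs1 hκ hF0 hFN L).trans
          (mul_le_mul_of_nonneg_left upper hpow)
    _ = 2 * (1 - s * κ) ^ L * ((N - 1 : ℕ) * (M / m) * D) := by ring

end LadderMixing

/-! ## Second-order perturbation theory for one interaction -/

section InteractionPicture

variable {𝔸 : Type*} [NormedRing 𝔸] [NormedAlgebra ℝ 𝔸]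

/-- The perturbation `c` in the interaction picture with respect to the generator `a`. -/
def interactionPicture (a c : 𝔸) (u : ℝ) : 𝔸 :=
  NormedSpace.exp (u • -a) * c * NormedSpace.exp (u • a)

/-- The propagator of `a + c` in the interaction picture with respect to `a`; it solves
`V' = interactionPicture a c * V`, `V 0 = 1`. -/
def interactionPropagator (a c : 𝔸) (u : ℝ) : 𝔸 :=
  NormedSpace.exp (u • -a) * NormedSpace.exp (u • (a + c))

theorem interactionPropagator_zero (a c : 𝔸) : interactionPropagator a c 0 = 1 := by
  simp [interactionPropagator]

variable [CompleteSpace 𝔸]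

theorem continuous_exp_real_smul (a : 𝔸) : Continuous fun u : ℝ => NormedSpace.exp (u • a) :=
  continuous_iff_continuousAt.2 fun u => (hasDerivAt_exp_smul_const a u).continuousAt

theorem continuous_interactionPicture (a c : 𝔸) : Continuous (interactionPicture a c) :=
  ((continuous_exp_real_smul (-a)).mul continuous_const).mul (continuous_exp_real_smul a)

theorem hasDerivAt_interactionPropagator (a c : 𝔸) (u : ℝ) :
    HasDerivAt (interactionPropagator a c)
      (interactionPicture a c u * interactionPropagator a c u) u := by
  let _ : NormedAlgebra ℚ 𝔸 := NormedAlgebra.restrictScalars ℚ ℝ _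
  have hinv : NormedSpace.exp (u • a) * NormedSpace.exp (u • -a) = 1 := by
    rw [smul_neg, ← NormedSpace.exp_add_of_commute (Commute.refl (u • a)).neg_right,
      add_neg_cancel, NormedSpace.exp_zero]
  refine ((hasDerivAt_exp_smul_const (-a) u).mul
    (hasDerivAt_exp_smul_const' (a + c) u)).congr_deriv ?_
  calc NormedSpace.exp (u • -a) * -a * NormedSpace.exp (u • (a + c)) +
        NormedSpace.exp (u • -a) * ((a + c) * NormedSpace.exp (u • (a + c)))
      = NormedSpace.exp (u • -a) * c * 1 * NormedSpace.exp (u • (a + c)) := by noncomm_ring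
    _ = interactionPicture a c u * interactionPropagator a c u := by
        simp only [← hinv, interactionPicture, interactionPropagator, mul_assoc]

variable [StarRing 𝔸] [CStarRing 𝔸] [StarModule ℝ 𝔸] {a c : 𝔸}

theorem exp_real_smul_mem_unitary (ha : a ∈ skewAdjoint 𝔸) (u : ℝ) :
    NormedSpace.exp (u • a) ∈ unitary 𝔸 := by
  let _ : NormedAlgebra ℚ 𝔸 := NormedAlgebra.restrictScalars ℚ ℝ _
  exact NormedSpace.exp_mem_unitary_of_mem_skewAdjoint (skewAdjoint.smul_mem u ha)

theorem norm_interactionPicture (ha : a ∈ skewAdjoint 𝔸) (c : 𝔸) (u : ℝ) :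
    ‖interactionPicture a c u‖ = ‖c‖ := by
  rw [interactionPicture, CStarRing.norm_mul_mem_unitary _ (exp_real_smul_mem_unitary ha u),
    CStarRing.norm_mem_unitary_mul _ (exp_real_smul_mem_unitary (neg_mem ha) u)]

theorem interactionPropagator_mem_unitary (ha : a ∈ skewAdjoint 𝔸) (hc : c ∈ skewAdjoint 𝔸)
    (u : ℝ) : interactionPropagator a c u ∈ unitary 𝔸 :=
  mul_mem (exp_real_smul_mem_unitary (neg_mem ha) u)
    (exp_real_smul_mem_unitary (add_mem ha hc) u)

theorem norm_interactionPropagator_sub_one_le (ha : a ∈ skewAdjoint 𝔸) (hc : c ∈ skewAdjoint 𝔸)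
    {t : ℝ} (ht : 0 ≤ t) : ‖interactionPropagator a c t - 1‖ ≤ t * ‖c‖ := by
  have h := norm_image_sub_le_of_norm_deriv_le_segment' (a := 0) (b := t) (C := ‖c‖)
    (fun u _ => (hasDerivAt_interactionPropagator a c u).hasDerivWithinAt)
    (fun u _ => by
      rw [CStarRing.norm_mul_mem_unitary _ (interactionPropagator_mem_unitary ha hc u),
        norm_interactionPicture ha]) t ⟨ht, le_rfl⟩
  rwa [interactionPropagator_zero, sub_zero, mul_comm] at h

theorem norm_interactionPropagator_sub_one_sub_integral_le (ha : a ∈ skewAdjoint 𝔸)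
    (hc : c ∈ skewAdjoint 𝔸) {t : ℝ} (ht : 0 ≤ t) :
    ‖interactionPropagator a c t - 1 - ∫ u in (0 : ℝ)..t, interactionPicture a c u‖ ≤
      (t * ‖c‖) ^ 2 := by
  have hderiv (u : ℝ) :
      HasDerivAt (fun u => interactionPropagator a c u - 1 -
          ∫ x in (0 : ℝ)..u, interactionPicture a c x)
        (interactionPicture a c u * (interactionPropagator a c u - 1)) u := by
    have hcont := continuous_interactionPicture a c
    have hintegral := intervalIntegral.integral_hasDerivAt_right (hcont.intervalIntegrable 0 u)
      hcont.aestronglyMeasurable.stronglyMeasurableAtFilter hcont.continuousAt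
    rw [mul_sub, mul_one]
    exact ((hasDerivAt_interactionPropagator a c u).sub_const 1).sub hintegral
  have h := norm_image_sub_le_of_norm_deriv_le_segment' (a := 0) (b := t)
    (C := ‖c‖ * (t * ‖c‖)) (fun u _ => (hderiv u).hasDerivWithinAt)
    (fun u hu => (norm_mul_le _ _).trans <| by
      rw [norm_interactionPicture ha]
      gcongr
      exact (norm_interactionPropagator_sub_one_le ha hc hu.1).trans (by gcongr; exact hu.2.le))
    t ⟨ht, le_rfl⟩
  simp only [interactionPropagator_zero, intervalIntegral.integral_same, sub_self, sub_zero] at h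
  exact h.trans_eq (by ring)

end InteractionPicture

section TransitionProbability

open scoped Matrix.Norms.L2Operator

theorem abs_sq_norm_add_sub_sq_norm_le {E : Type*} [SeminormedAddCommGroup E] (x y : E) :
    |‖x + y‖ ^ 2 - ‖x‖ ^ 2| ≤ 2 * (‖x‖ * ‖y‖) + ‖y‖ ^ 2 := by
  have hxy : |‖x + y‖ - ‖x‖| ≤ ‖y‖ := by
    simpa only [add_sub_cancel_left] using abs_norm_sub_norm_le (x + y) x
  calc |‖x + y‖ ^ 2 - ‖x‖ ^ 2| = |‖x + y‖ - ‖x‖| * (‖x + y‖ + ‖x‖) := by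
        rw [sq_sub_sq, abs_mul, abs_of_nonneg (by positivity : 0 ≤ ‖x + y‖ + ‖x‖), mul_comm]
    _ ≤ ‖y‖ * (‖x‖ + ‖y‖ + ‖x‖) := by gcongr; exact norm_add_le x y
    _ = 2 * (‖x‖ * ‖y‖) + ‖y‖ ^ 2 := by ring

theorem norm_integral_exp_I_mul (δ : ℝ) {t : ℝ} (ht : 0 ≤ t) :
    ‖∫ u in (0 : ℝ)..t, Complex.exp (Complex.I * (δ * u : ℝ))‖ = t * |Real.sinc (δ * t / 2)| := by
  obtain rfl | hδ := eq_or_ne δ 0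
  · simp [abs_of_nonneg ht]
  obtain rfl | ht' := ht.eq_or_lt
  · simp
  have hassoc (u : ℝ) : Complex.I * (δ * u : ℝ) = Complex.I * δ * u := by push_cast; ring
  simp only [hassoc]
  rw [integral_exp_mul_complex (mul_ne_zero Complex.I_ne_zero (Complex.ofReal_ne_zero.2 hδ)),
    Complex.ofReal_zero, mul_zero, Complex.exp_zero, norm_div, ← hassoc,
    Complex.norm_exp_I_mul_ofReal_sub_one, norm_mul, norm_mul, Complex.norm_I, one_mul,
    Complex.norm_real, Real.sinc_of_ne_zero (by positivity), Real.norm_two, Real.norm_eq_abs,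
    Real.norm_eq_abs, abs_div, abs_div, abs_mul, abs_of_pos ht', abs_two]
  have := abs_ne_zero.2 hδ
  field_simp

variable {κ : Type}

theorem I_smul_mem_skewAdjoint {A : Matrix κ κ ℂ} (hA : A.IsHermitian) :
    Complex.I • A ∈ skewAdjoint (Matrix κ κ ℂ) := by
  rw [skewAdjoint.mem_iff, star_smul, Matrix.star_eq_conjTranspose, hA.eq, Complex.star_def,
    Complex.conj_I, neg_smul]

variable [DecidableEq κ]

theorem diagOp_isHermitian (e : κ → ℝ) : (diagOp e).IsHermitian := by
  simp [diagOp, Matrix.IsHermitian, Matrix.diagonal_conjTranspose, Pi.star_def]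

theorem isHermitian_diagOp_add_smul (e : κ → ℝ) (α : ℝ) {G : Matrix κ κ ℂ}
    (hG : G.IsHermitian) : (diagOp e + (α : ℂ) • G).IsHermitian :=
  (diagOp_isHermitian e).add (hG.smul (Complex.conj_ofReal α))

variable [Fintype κ]

theorem sum_norm_sq_col_le (A : Matrix κ κ ℂ) (y : κ) : ∑ x, ‖A x y‖ ^ 2 ≤ ‖A‖ ^ 2 := by
  have h := Matrix.l2_opNorm_mulVec A (EuclideanSpace.single y (1 : ℂ))
  rw [PiLp.norm_single, norm_one, mul_one, EuclideanSpace.norm_eq,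
    Real.sqrt_le_left (norm_nonneg _)] at h
  simpa using h

theorem sum_abs_sq_norm_add_col_sub_le {A B : Matrix κ κ ℂ} {a b : ℝ} (hA : ‖A‖ ≤ a)
    (hB : ‖B‖ ≤ b) (y : κ) :
    ∑ x, |‖(A + B) x y‖ ^ 2 - ‖A x y‖ ^ 2| ≤ 2 * (a * b) + b ^ 2 := by
  have ha : 0 ≤ a := (norm_nonneg A).trans hA
  have hb : 0 ≤ b := (norm_nonneg B).trans hB
  have hAcol : ∑ x, ‖A x y‖ ^ 2 ≤ a ^ 2 := (sum_norm_sq_col_le A y).trans (by gcongr)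
  have hBcol : ∑ x, ‖B x y‖ ^ 2 ≤ b ^ 2 := (sum_norm_sq_col_le B y).trans (by gcongr)
  calc ∑ x, |‖(A + B) x y‖ ^ 2 - ‖A x y‖ ^ 2|
      ≤ ∑ x, (2 * (‖A x y‖ * ‖B x y‖) + ‖B x y‖ ^ 2) :=
        Finset.sum_le_sum fun x _ => abs_sq_norm_add_sub_sq_norm_le _ _
    _ = 2 * ∑ x, ‖A x y‖ * ‖B x y‖ + ∑ x, ‖B x y‖ ^ 2 := by
        rw [Finset.sum_add_distrib, Finset.mul_sum]
    _ ≤ 2 * (√(∑ x, ‖A x y‖ ^ 2) * √(∑ x, ‖B x y‖ ^ 2)) + b ^ 2 := by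
        gcongr
        exact Real.sum_mul_le_sqrt_mul_sqrt _ _ _
    _ ≤ 2 * (a * b) + b ^ 2 := by
        gcongr
        · exact Real.sqrt_le_iff.2 ⟨ha, hAcol⟩
        · exact Real.sqrt_le_iff.2 ⟨hb, hBcol⟩

theorem sum_norm_sq_col_eq_one {U : Matrix κ κ ℂ} (hU : U ∈ Matrix.unitaryGroup κ ℂ) (y : κ) :
    ∑ x, ‖U x y‖ ^ 2 = 1 := by
  have h := Matrix.ext_iff.2 (Matrix.mem_unitaryGroup_iff'.1 hU) y y
  simp only [Matrix.star_eq_conjTranspose, Matrix.mul_apply, Matrix.conjTranspose_apply,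
    Matrix.one_apply_eq, Complex.star_def, Complex.conj_mul'] at h
  exact_mod_cast h

/-- The propagator `e^{i (H + α G) t}` for a diagonal Hamiltonian `H`. -/
def propagator (e : κ → ℝ) (α t : ℝ) (G : Matrix κ κ ℂ) : Matrix κ κ ℂ :=
  NormedSpace.exp ((Complex.I * (t : ℂ)) • (diagOp e + (α : ℂ) • G))

theorem continuous_exp_matrix : Continuous (NormedSpace.exp : Matrix κ κ ℂ → Matrix κ κ ℂ) := by
  let _ : NormedAlgebra ℚ (Matrix κ κ ℂ) := NormedAlgebra.restrictScalars ℚ ℂ _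
  exact NormedSpace.exp_continuous

theorem continuous_propagator (e : κ → ℝ) (α t : ℝ) :
    Continuous (propagator e α t : Matrix κ κ ℂ → Matrix κ κ ℂ) :=
  continuous_exp_matrix.comp (by fun_prop)

theorem propagator_eq_exp_real_smul (e : κ → ℝ) (α t : ℝ) (G : Matrix κ κ ℂ) :
    propagator e α t G =
      NormedSpace.exp (t • (Complex.I • diagOp e + Complex.I • ((α : ℂ) • G))) := by
  rw [propagator, ← smul_add, mul_comm, mul_smul, Complex.coe_smul]

theorem propagator_mem_unitary (e : κ → ℝ) (α t : ℝ) {G : Matrix κ κ ℂ} (hG : G.IsHermitian) :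
    propagator e α t G ∈ unitary (Matrix κ κ ℂ) := by
  rw [propagator_eq_exp_real_smul, ← smul_add]
  exact exp_real_smul_mem_unitary
    (I_smul_mem_skewAdjoint (isHermitian_diagOp_add_smul e α hG)) t

theorem exp_real_smul_I_smul_diagOp (e : κ → ℝ) (u : ℝ) :
    NormedSpace.exp (u • (Complex.I • diagOp e)) =
      Matrix.diagonal fun x => Complex.exp (Complex.I * (e x * u : ℝ)) := by
  have : u • (Complex.I • diagOp e) =
      Matrix.diagonal fun x => Complex.I * ((e x * u : ℝ) : ℂ) := by
    ext x y
    by_cases hxy : x = y <;> simp [diagOp, hxy]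
    ring
  rw [this, Matrix.exp_diagonal, Pi.exp_def]
  simp only [Complex.exp_eq_exp_ℂ]

theorem interactionPicture_diagOp_apply (e : κ → ℝ) (C : Matrix κ κ ℂ) (u : ℝ) (x y : κ) :
    interactionPicture (Complex.I • diagOp e) C u x y =
      C x y * Complex.exp (Complex.I * (-(e x - e y) * u : ℝ)) := by
  rw [interactionPicture, smul_neg, ← neg_smul, exp_real_smul_I_smul_diagOp,
    exp_real_smul_I_smul_diagOp, Matrix.mul_diagonal, Matrix.diagonal_mul, mul_right_comm,
    ← Complex.exp_add, mul_comm, ← mul_add, ← Complex.ofReal_add]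
  ring_nf

theorem norm_integral_interactionPicture_diagOp_apply (e : κ → ℝ) (C : Matrix κ κ ℂ) {t : ℝ}
    (ht : 0 ≤ t) (x y : κ) :
    ‖(∫ u in (0 : ℝ)..t, interactionPicture (Complex.I • diagOp e) C u) x y‖ =
      t * |Real.sinc ((e x - e y) * t / 2)| * ‖C x y‖ := by
  have happly : (∫ u in (0 : ℝ)..t, interactionPicture (Complex.I • diagOp e) C u) x y =
      ∫ u in (0 : ℝ)..t, interactionPicture (Complex.I • diagOp e) C u x y :=
    ((Matrix.entryLinearMap ℂ ℂ x y).toContinuousLinearMap.intervalIntegral_comp_comm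
      ((continuous_interactionPicture _ C).intervalIntegrable 0 t)).symm
  simp only [happly, interactionPicture_diagOp_apply]
  rw [intervalIntegral.integral_const_mul, norm_mul, norm_integral_exp_I_mul _ ht, neg_mul,
    neg_div, Real.sinc_neg, mul_comm]

theorem norm_propagator_apply (e : κ → ℝ) (α t : ℝ) (G : Matrix κ κ ℂ) (x y : κ) :
    ‖propagator e α t G x y‖ =
      ‖interactionPropagator (Complex.I • diagOp e) (Complex.I • ((α : ℂ) • G)) t x y‖ := by
  rw [interactionPropagator, smul_neg, ← neg_smul, exp_real_smul_I_smul_diagOp,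
    ← propagator_eq_exp_real_smul, Matrix.diagonal_mul, norm_mul, Complex.norm_exp_I_mul_ofReal,
    one_mul]

theorem sum_abs_norm_sq_propagator_sub_le (e : κ → ℝ) {α t : ℝ} (hα : 0 ≤ α) (ht : 0 ≤ t)
    {G : Matrix κ κ ℂ} (hG : G.IsHermitian) (y : κ) :
    ∑ x ∈ Finset.univ.erase y, |‖propagator e α t G x y‖ ^ 2 -
        (α * t) ^ 2 * Real.sinc ((e x - e y) * t / 2) ^ 2 * ‖G x y‖ ^ 2| ≤
      2 * (α * t * ‖G‖) ^ 3 + (α * t * ‖G‖) ^ 4 := by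
  set A := Complex.I • diagOp e
  set C := Complex.I • ((α : ℂ) • G) with hC_def
  set Γ := ∫ u in (0 : ℝ)..t, interactionPicture A C u
  set R := interactionPropagator A C t - 1 - Γ with hR_def
  have hA : A ∈ skewAdjoint (Matrix κ κ ℂ) := I_smul_mem_skewAdjoint (diagOp_isHermitian e)
  have hC : C ∈ skewAdjoint (Matrix κ κ ℂ) :=
    I_smul_mem_skewAdjoint (hG.smul (Complex.conj_ofReal α))
  have norm_C : ‖C‖ = α * ‖G‖ := by
    rw [hC_def, norm_smul, norm_smul, Complex.norm_I, one_mul, Complex.norm_of_nonneg hα]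
  have hΓ : ‖Γ‖ ≤ α * t * ‖G‖ := by
    refine (intervalIntegral.norm_integral_le_of_norm_le_const fun u _ =>
      (norm_interactionPicture hA C u).le).trans_eq ?_
    rw [sub_zero, abs_of_nonneg ht, norm_C, mul_right_comm]
  have hR : ‖R‖ ≤ (α * t * ‖G‖) ^ 2 := by
    refine (norm_interactionPropagator_sub_one_sub_integral_le hA hC ht).trans_eq ?_
    rw [norm_C, ← mul_assoc, mul_comm t]
  have exact_term {x : κ} (hxy : x ≠ y) : ‖propagator e α t G x y‖ = ‖(Γ + R) x y‖ := by
    rw [norm_propagator_apply, hR_def, add_sub_cancel, Matrix.sub_apply, Matrix.one_apply_ne hxy,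
      sub_zero]
  have first_order (x : κ) :
      (α * t) ^ 2 * Real.sinc ((e x - e y) * t / 2) ^ 2 * ‖G x y‖ ^ 2 = ‖Γ x y‖ ^ 2 := by
    have norm_C_apply : ‖C x y‖ = α * ‖G x y‖ := by
      rw [hC_def, Matrix.smul_apply, Matrix.smul_apply, norm_smul, norm_smul, Complex.norm_I,
        one_mul, Complex.norm_of_nonneg hα]
    rw [norm_integral_interactionPicture_diagOp_apply e C ht, norm_C_apply]
    simp only [mul_pow, sq_abs]
    ring
  calc ∑ x ∈ Finset.univ.erase y, |‖propagator e α t G x y‖ ^ 2 -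
        (α * t) ^ 2 * Real.sinc ((e x - e y) * t / 2) ^ 2 * ‖G x y‖ ^ 2|
      = ∑ x ∈ Finset.univ.erase y, |‖(Γ + R) x y‖ ^ 2 - ‖Γ x y‖ ^ 2| :=
        Finset.sum_congr rfl fun x hx => by
          rw [first_order, exact_term (Finset.ne_of_mem_erase hx)]
    _ ≤ ∑ x, |‖(Γ + R) x y‖ ^ 2 - ‖Γ x y‖ ^ 2| :=
        Finset.sum_le_sum_of_subset_of_nonneg (Finset.erase_subset _ _)
          fun _ _ _ => abs_nonneg _
    _ ≤ 2 * (α * t * ‖G‖ * (α * t * ‖G‖) ^ 2) + ((α * t * ‖G‖) ^ 2) ^ 2 :=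
        sum_abs_sq_norm_add_col_sub_le hΓ hR y
    _ = 2 * (α * t * ‖G‖) ^ 3 + (α * t * ‖G‖) ^ 4 := by ring

end TransitionProbability

/-! ## Moments of the random interaction -/

section HaarMoments

variable {ι : Type} [Fintype ι] [DecidableEq ι]

instance unitaryGroup_secondCountableTopology :
    SecondCountableTopology (Matrix.unitaryGroup ι ℂ) :=
  haveI : SecondCountableTopology (Matrix ι ι ℂ) :=
    inferInstanceAs (SecondCountableTopology (ι → ι → ℂ))
  TopologicalSpace.Subtype.secondCountableTopology _

instance haarUnitary_isProbabilityMeasure : IsProbabilityMeasure (haarUnitary ι) :=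
  ⟨Measure.haarMeasure_self (K₀ := ⊤)⟩

instance haarUnitary_isMulLeftInvariant : (haarUnitary ι).IsMulLeftInvariant :=
  inferInstanceAs (Measure.haarMeasure _).IsMulLeftInvariant

theorem continuous_unitary_apply (x k : ι) :
    Continuous fun U : Matrix.unitaryGroup ι ℂ => U.1 x k :=
  (continuous_apply_apply x k).comp continuous_subtype_val

theorem integrable_haarUnitary_of_continuous {f : Matrix.unitaryGroup ι ℂ → ℝ}
    (hf : Continuous f) : Integrable f (haarUnitary ι) :=
  hf.integrable_of_hasCompactSupport (HasCompactSupport.of_compactSpace f)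

theorem one_sub_smul_vecMulVec_mem_unitaryGroup {c : ℂ} {v : ι → ℂ}
    (h : c + star c = c * star c * (star v ⬝ᵥ v)) :
    1 - c • vecMulVec v (star v) ∈ Matrix.unitaryGroup ι ℂ := by
  set P := vecMulVec v (star v) with hP
  have hPP : P * P = (star v ⬝ᵥ v) • P := by rw [hP, vecMulVec_mul_vecMulVec, vecMulVec_smul]
  have hstar : star (1 - c • P) = 1 - star c • P := by
    rw [star_sub, star_one, star_smul, Matrix.star_eq_conjTranspose P, hP,
      conjTranspose_vecMulVec, star_star]
  rw [Matrix.mem_unitaryGroup_iff, hstar]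
  calc (1 - c • P) * (1 - star c • P)
      = 1 - (c + star c) • P + (c * star c) • (P * P) := by
        rw [mul_sub, mul_one, sub_mul, one_mul, smul_mul_smul_comm, add_smul]
        abel
    _ = 1 := by rw [hPP, smul_smul, ← h, sub_add_cancel]

/-- A unitary that mixes the basis vectors `x` and `y` with equal weights and relative phase `φ`:
it acts as `I` on `e_x + φ e_y` and as the identity on the orthogonal complement. -/
def phaseMixing (x y : ι) (φ : ℂ) : Matrix ι ι ℂ :=
  1 - ((1 - Complex.I) / 2) • vecMulVec (Pi.single x 1 + Pi.single y φ)
    (star (Pi.single x 1 + Pi.single y φ))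

theorem phaseMixing_mem_unitaryGroup {x y : ι} (hxy : x ≠ y) {φ : ℂ} (hφ : ‖φ‖ = 1) :
    phaseMixing x y φ ∈ Matrix.unitaryGroup ι ℂ := by
  refine one_sub_smul_vecMulVec_mem_unitaryGroup ?_
  have hnorm : star (Pi.single x 1 + Pi.single y φ) ⬝ᵥ (Pi.single x 1 + Pi.single y φ) =
      (2 : ℂ) := by
    have hφ2 : star φ * φ = 1 := by
      rw [Complex.star_def, Complex.conj_mul', hφ, Complex.ofReal_one, one_pow]
    rw [star_add, ← Pi.single_star, ← Pi.single_star, add_dotProduct, single_dotProduct,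
      single_dotProduct]
    simp only [Pi.add_apply, Pi.single_eq_same, Pi.single_eq_of_ne hxy,
      Pi.single_eq_of_ne hxy.symm, star_one, mul_add, hφ2]
    norm_num
  rw [hnorm]
  simp only [Complex.star_def, map_div₀, map_sub, map_one, Complex.conj_I, map_ofNat]
  linear_combination (1 / 2 : ℂ) * Complex.I_sq

theorem phaseMixing_mul_apply {x y : ι} (hxy : x ≠ y) (φ : ℂ) (A : Matrix ι ι ℂ) (k : ι) :
    (phaseMixing x y φ * A) x k =
      (1 + Complex.I) / 2 * (A x k + Complex.I * star φ * A y k) := by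
  rw [phaseMixing, sub_mul, one_mul, smul_mul_assoc, vecMulVec_mul, Matrix.sub_apply,
    Matrix.smul_apply, vecMulVec_apply, star_add, ← Pi.single_star, ← Pi.single_star, add_vecMul,
    Pi.add_apply, Pi.add_apply, single_vecMul, single_vecMul, Pi.single_eq_same,
    Pi.single_eq_of_ne hxy, star_one, smul_eq_mul, Pi.smul_apply, Pi.smul_apply, smul_eq_mul,
    smul_eq_mul, row_apply, row_apply]
  linear_combination (-(1 / 2 : ℂ)) * star φ * A y k * Complex.I_sq

theorem sum_phases_norm_add_pow_four (z w : ℂ) :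
    ‖z + 1 * w‖ ^ 4 + ‖z + -1 * w‖ ^ 4 + ‖z + Complex.I * w‖ ^ 4 + ‖z + -Complex.I * w‖ ^ 4 =
      4 * (‖z‖ ^ 2 * ‖z‖ ^ 2 + ‖w‖ ^ 2 * ‖w‖ ^ 2 + 4 * (‖z‖ ^ 2 * ‖w‖ ^ 2)) := by
  simp only [pow_mul _ 2 2, show 4 = 2 * 2 from rfl, Complex.sq_norm, Complex.normSq_apply,
    Complex.add_re, Complex.add_im, Complex.mul_re, Complex.mul_im, Complex.neg_re,
    Complex.neg_im, Complex.I_re, Complex.I_im, Complex.one_re, Complex.one_im]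
  ring

/-- The mixed fourth moment of the entries `x` and `y` of the `k`th column of a Haar unitary. -/
def columnMoment (k x y : ι) : ℝ := ∫ U, ‖U.1 x k‖ ^ 2 * ‖U.1 y k‖ ^ 2 ∂haarUnitary ι

theorem columnMoment_comm (k x y : ι) : columnMoment k x y = columnMoment k y x := by
  simp only [columnMoment, mul_comm]

theorem integrable_norm_sq_mul_norm_sq (k x y : ι) :
    Integrable (fun U => ‖U.1 x k‖ ^ 2 * ‖U.1 y k‖ ^ 2) (haarUnitary ι) :=
  integrable_haarUnitary_of_continuous <|
    ((continuous_unitary_apply x k).norm.pow 2).mul ((continuous_unitary_apply y k).norm.pow 2)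

theorem integral_norm_add_phase_pow_four {x y : ι} (hxy : x ≠ y) (k : ι) {φ : ℂ} (hφ : ‖φ‖ = 1) :
    ∫ U, ‖U.1 x k + φ * U.1 y k‖ ^ 4 ∂haarUnitary ι = 4 * columnMoment k x x := by
  have hφ' : ‖Complex.I * star φ‖ = 1 := by
    rw [norm_mul, Complex.norm_I, norm_star, hφ, one_mul]
  have hphase : Complex.I * star (Complex.I * star φ) = φ := by
    rw [star_mul, star_star, Complex.star_def, Complex.conj_I]
    linear_combination -φ * Complex.I_mul_I
  have hnorm : ‖(1 + Complex.I) / 2‖ ^ 4 = 1 / 4 := by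
    rw [show 4 = 2 * 2 from rfl, pow_mul, Complex.sq_norm, Complex.normSq_apply]
    norm_num
  have hinv := integral_mul_left_eq_self (μ := haarUnitary ι) (fun U => ‖U.1 x k‖ ^ 4)
    ⟨phaseMixing x y (Complex.I * star φ), phaseMixing_mem_unitaryGroup hxy hφ'⟩
  simp only [Submonoid.coe_mul, phaseMixing_mul_apply hxy, hphase, norm_mul, mul_pow, hnorm,
    integral_const_mul] at hinv
  simp only [columnMoment, ← pow_add]
  linarith

theorem three_mul_columnMoment_self {x y : ι} (hxy : x ≠ y) (k : ι) :
    3 * columnMoment k x x = columnMoment k y y + 4 * columnMoment k x y := by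
  have hintg (φ : ℂ) : Integrable (fun U => ‖U.1 x k + φ * U.1 y k‖ ^ 4) (haarUnitary ι) :=
    integrable_haarUnitary_of_continuous <| ((continuous_unitary_apply x k).add
      (continuous_const.mul (continuous_unitary_apply y k))).norm.pow 4
  have hM := integrable_norm_sq_mul_norm_sq (ι := ι) k
  have havg : ∫ U, (‖U.1 x k + 1 * U.1 y k‖ ^ 4 + ‖U.1 x k + -1 * U.1 y k‖ ^ 4 +
        ‖U.1 x k + Complex.I * U.1 y k‖ ^ 4 + ‖U.1 x k + -Complex.I * U.1 y k‖ ^ 4)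
          ∂haarUnitary ι =
      4 * (columnMoment k x x + columnMoment k y y + 4 * columnMoment k x y) := by
    simp only [sum_phases_norm_add_pow_four, columnMoment]
    rw [integral_const_mul, integral_add ((hM x x).fun_add (hM y y)) ((hM x y).const_mul 4),
      integral_add (hM x x) (hM y y), integral_const_mul]
  rw [integral_add (((hintg 1).fun_add (hintg (-1))).fun_add (hintg _)) (hintg _),
    integral_add ((hintg 1).fun_add (hintg (-1))) (hintg _), integral_add (hintg 1) (hintg (-1)),
    integral_norm_add_phase_pow_four hxy k (by simp),
    integral_norm_add_phase_pow_four hxy k (by simp),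
    integral_norm_add_phase_pow_four hxy k (by simp),
    integral_norm_add_phase_pow_four hxy k (by simp)] at havg
  linarith

theorem columnMoment_self_of_ne {x y : ι} (hxy : x ≠ y) (k : ι) :
    columnMoment k x x = 2 * columnMoment k x y := by
  have hx := three_mul_columnMoment_self hxy k
  have hy := three_mul_columnMoment_self hxy.symm k
  rw [columnMoment_comm k y x] at hy
  linarith

theorem sum_columnMoment (k : ι) : ∑ x, ∑ y, columnMoment k x y = 1 := by
  have hM := integrable_norm_sq_mul_norm_sq (ι := ι) k
  have sum_eq_one (U : Matrix.unitaryGroup ι ℂ) : ∑ x, ∑ y, ‖U.1 x k‖ ^ 2 * ‖U.1 y k‖ ^ 2 = 1 := by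
    rw [← Finset.sum_mul_sum, sum_norm_sq_col_eq_one U.2, one_mul]
  calc ∑ x, ∑ y, columnMoment k x y
      = ∫ U, ∑ x, ∑ y, ‖U.1 x k‖ ^ 2 * ‖U.1 y k‖ ^ 2 ∂haarUnitary ι := by
        rw [integral_finsetSum _ fun x _ => integrable_finsetSum _ fun y _ => hM x y]
        exact Finset.sum_congr rfl fun x _ => (integral_finsetSum _ fun y _ => hM x y).symm
    _ = 1 := by simp only [sum_eq_one, integral_const, probReal_univ, one_smul]

theorem columnMoment_of_ne {x y : ι} (hxy : x ≠ y) (k : ι) :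
    columnMoment k x y = 1 / ((Fintype.card ι : ℝ) * (Fintype.card ι + 1)) := by
  have self_eq (z : ι) : columnMoment k z z = 2 * columnMoment k x y := by
    obtain rfl | hzx := eq_or_ne z x
    · exact columnMoment_self_of_ne hxy k
    · rw [columnMoment_self_of_ne hzx, columnMoment_comm, ← columnMoment_self_of_ne hzx.symm,
        columnMoment_self_of_ne hxy]
  have eq_ite (z w : ι) : columnMoment k z w =
      columnMoment k x y + if z = w then columnMoment k x y else 0 := by
    split_ifs with hzw
    · rw [← hzw, self_eq, two_mul]
    · linarith [self_eq z, columnMoment_self_of_ne hzw k]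
  have hsum := sum_columnMoment k
  generalize columnMoment k x y = c at eq_ite ⊢
  simp only [eq_ite, Finset.sum_add_distrib, Finset.sum_ite_eq, Finset.mem_univ, if_true,
    Finset.sum_const, Finset.card_univ, nsmul_eq_mul] at hsum
  have hcard : (0 : ℝ) < Fintype.card ι := by exact_mod_cast Fintype.card_pos_iff.2 ⟨x⟩
  rw [eq_div_iff (by positivity)]
  linarith

end HaarMoments

section GaussianMoments

variable {ι : Type} [Fintype ι]

variable (ι) in
/-- The law of i.i.d. standard Gaussian eigenvalues. -/
def gaussianLaw : Measure (ι → ℝ) := Measure.pi fun _ => ProbabilityTheory.gaussianReal 0 1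

instance gaussianLaw_isProbabilityMeasure : IsProbabilityMeasure (gaussianLaw ι) :=
  inferInstanceAs (IsProbabilityMeasure (Measure.pi _))

theorem measurePreserving_gaussianLaw_eval (k : ι) :
    MeasurePreserving (fun D => D k) (gaussianLaw ι) (ProbabilityTheory.gaussianReal 0 1) :=
  measurePreserving_eval (fun _ => ProbabilityTheory.gaussianReal 0 1) k

theorem memLp_gaussianLaw_eval (k : ι) (p : NNReal) :
    MemLp (fun D => D k) p (gaussianLaw ι) :=
  (ProbabilityTheory.memLp_id_gaussianReal p).comp_measurePreserving
    (measurePreserving_gaussianLaw_eval k)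

theorem integral_gaussianLaw_eval (k : ι) {f : ℝ → ℝ} (hf : Measurable f) :
    ∫ D, f (D k) ∂gaussianLaw ι = ∫ x, f x ∂ProbabilityTheory.gaussianReal 0 1 := by
  have h := measurePreserving_gaussianLaw_eval k
  rw [← h.map_eq, integral_map h.measurable.aemeasurable hf.aestronglyMeasurable]

theorem integrable_gaussianLaw_mul (k l : ι) :
    Integrable (fun D => D k * D l) (gaussianLaw ι) :=
  MemLp.integrable_mul (p := 2) (q := 2) (memLp_gaussianLaw_eval k 2) (memLp_gaussianLaw_eval l 2)

theorem integral_gaussianLaw_mul [DecidableEq ι] (k l : ι) :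
    ∫ D, D k * D l ∂gaussianLaw ι = if k = l then 1 else 0 := by
  have mean_eq_zero (k : ι) : ∫ D, D k ∂gaussianLaw ι = 0 :=
    (integral_gaussianLaw_eval k measurable_id).trans ProbabilityTheory.integral_id_gaussianReal
  split_ifs with hkl
  · have hvar := ProbabilityTheory.variance_id_gaussianReal (μ := 0) (v := 1)
    rw [ProbabilityTheory.variance_of_integral_eq_zero aemeasurable_id
      ProbabilityTheory.integral_id_gaussianReal] at hvar
    rw [hkl, integral_gaussianLaw_eval l (f := fun x => x * x) (by fun_prop)]
    simpa [sq] using hvar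
  · have hindep : ProbabilityTheory.IndepFun (fun D => D k) (fun D => D l) (gaussianLaw ι) :=
      (ProbabilityTheory.iIndepFun_pi (X := fun _ => id) fun _ => aemeasurable_id).indepFun hkl
    rw [hindep.integral_fun_mul_eq_mul_integral
      (measurable_pi_apply k).aestronglyMeasurable (measurable_pi_apply l).aestronglyMeasurable,
      mean_eq_zero, zero_mul]

/-- The sum of the third and fourth absolute moments of a standard Gaussian. -/
def gaussianMoment : ℝ := ∫ x, (|x| ^ 3 + |x| ^ 4) ∂ProbabilityTheory.gaussianReal 0 1

theorem gaussianMoment_nonneg : 0 ≤ gaussianMoment := integral_nonneg fun x => by positivity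

theorem integrable_gaussianLaw_abs_pow (k : ι) (m : ℕ) :
    Integrable (fun D => |D k| ^ m) (gaussianLaw ι) :=
  (memLp_gaussianLaw_eval k m).integrable_norm_pow'

theorem integrable_gaussianLaw_sum_abs_pow :
    Integrable (fun D => ∑ k, (|D k| ^ 3 + |D k| ^ 4)) (gaussianLaw ι) :=
  integrable_finsetSum _ fun k _ =>
    (integrable_gaussianLaw_abs_pow k 3).add (integrable_gaussianLaw_abs_pow k 4)

theorem integral_gaussianLaw_sum_abs_pow :
    ∫ D, ∑ k, (|D k| ^ 3 + |D k| ^ 4) ∂gaussianLaw ι = Fintype.card ι * gaussianMoment := by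
  rw [integral_finsetSum _ fun k _ =>
    (integrable_gaussianLaw_abs_pow k 3).fun_add (integrable_gaussianLaw_abs_pow k 4)]
  simp only [integral_gaussianLaw_eval (f := fun x => |x| ^ 3 + |x| ^ 4) _ (by fun_prop)]
  rw [Finset.sum_const, Finset.card_univ, nsmul_eq_mul, gaussianMoment]

end GaussianMoments

section InteractionMoments

variable {ι : Type} [Fintype ι] [DecidableEq ι]

instance interactionLaw_isProbabilityMeasure : IsProbabilityMeasure (interactionLaw ι) :=
  inferInstanceAs (IsProbabilityMeasure ((haarUnitary ι).prod (gaussianLaw ι)))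

/-- The entry `(x, y)` of the projection onto the `k`th column of `U`. -/
def projectionEntry (U : Matrix.unitaryGroup ι ℂ) (x y k : ι) : ℂ := U.1 x k * star (U.1 y k)

theorem continuous_projectionEntry (x y k : ι) :
    Continuous fun U => projectionEntry U x y k :=
  (continuous_unitary_apply x k).mul (continuous_unitary_apply y k).star

theorem interaction_apply (ω : Matrix.unitaryGroup ι ℂ × (ι → ℝ)) (x y : ι) :
    interaction ω x y = ∑ k, ω.2 k • projectionEntry ω.1 x y k := by
  rw [interaction, Matrix.mul_apply]
  refine Finset.sum_congr rfl fun k _ => ?_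
  rw [Matrix.mul_diagonal, Matrix.conjTranspose_apply, projectionEntry, Complex.real_smul]
  ring

theorem interaction_isHermitian (ω : Matrix.unitaryGroup ι ℂ × (ι → ℝ)) :
    (interaction ω).IsHermitian :=
  isHermitian_mul_mul_conjTranspose _ (diagOp_isHermitian ω.2)

theorem continuous_interaction :
    Continuous (interaction : Matrix.unitaryGroup ι ℂ × (ι → ℝ) → Matrix ι ι ℂ) := by
  have hU : Continuous fun ω : Matrix.unitaryGroup ι ℂ × (ι → ℝ) => (ω.1 : Matrix ι ι ℂ) :=
    continuous_subtype_val.comp continuous_fst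
  exact (hU.matrix_mul (Continuous.matrix_diagonal (by fun_prop))).matrix_mul
    hU.matrix_conjTranspose

theorem norm_sq_sum_smul {κ E : Type*} [Fintype κ] [SeminormedAddCommGroup E]
    [InnerProductSpace ℝ E] (d : κ → ℝ) (c : κ → E) :
    ‖∑ k, d k • c k‖ ^ 2 = ∑ k, ∑ l, inner ℝ (c k) (c l) * (d k * d l) := by
  simp only [← real_inner_self_eq_norm_sq, sum_inner, inner_sum, real_inner_smul_left,
    real_inner_smul_right]
  exact Finset.sum_congr rfl fun k _ => Finset.sum_congr rfl fun l _ => by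
    rw [real_inner_comm]
    ring

theorem norm_sq_interaction_apply (ω : Matrix.unitaryGroup ι ℂ × (ι → ℝ)) (x y : ι) :
    ‖interaction ω x y‖ ^ 2 = ∑ k, ∑ l,
      inner ℝ (projectionEntry ω.1 x y k) (projectionEntry ω.1 x y l) * (ω.2 k * ω.2 l) := by
  rw [interaction_apply, norm_sq_sum_smul]

theorem integrable_inner_projectionEntry_mul (x y k l : ι) :
    Integrable (fun ω : Matrix.unitaryGroup ι ℂ × (ι → ℝ) =>
      inner ℝ (projectionEntry ω.1 x y k) (projectionEntry ω.1 x y l) * (ω.2 k * ω.2 l))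
      (interactionLaw ι) :=
  Integrable.mul_prod (ν := gaussianLaw ι)
    (f := fun U => inner ℝ (projectionEntry U x y k) (projectionEntry U x y l))
    (integrable_haarUnitary_of_continuous
      ((continuous_projectionEntry x y k).inner (continuous_projectionEntry x y l)))
    (integrable_gaussianLaw_mul k l)

theorem integrable_norm_sq_interaction (x y : ι) :
    Integrable (fun ω => ‖interaction ω x y‖ ^ 2) (interactionLaw ι) := by
  simp only [norm_sq_interaction_apply]
  exact integrable_finsetSum _ fun k _ => integrable_finsetSum _ fun l _ =>
    integrable_inner_projectionEntry_mul x y k l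

theorem integral_inner_projectionEntry_mul (x y k l : ι) :
    ∫ ω : Matrix.unitaryGroup ι ℂ × (ι → ℝ),
        inner ℝ (projectionEntry ω.1 x y k) (projectionEntry ω.1 x y l) * (ω.2 k * ω.2 l)
          ∂interactionLaw ι =
      if k = l then columnMoment k x y else 0 := by
  refine (integral_prod_mul (μ := haarUnitary ι) (ν := gaussianLaw ι)
    (fun U => inner ℝ (projectionEntry U x y k) (projectionEntry U x y l))
    (fun D => D k * D l)).trans ?_
  rw [integral_gaussianLaw_mul, mul_ite, mul_one, mul_zero]
  split_ifs with hkl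
  · subst hkl
    simp only [real_inner_self_eq_norm_sq, projectionEntry, norm_mul, norm_star, mul_pow,
      columnMoment]
  · rfl

theorem integral_norm_sq_interaction {x y : ι} (hxy : x ≠ y) :
    ∫ ω, ‖interaction ω x y‖ ^ 2 ∂interactionLaw ι = 1 / ((Fintype.card ι : ℝ) + 1) := by
  simp only [norm_sq_interaction_apply]
  rw [integral_finsetSum _ fun k _ => integrable_finsetSum _ fun l _ =>
    integrable_inner_projectionEntry_mul x y k l]
  simp_rw [integral_finsetSum _ fun l _ => integrable_inner_projectionEntry_mul x y _ l]
  simp only [integral_inner_projectionEntry_mul, Finset.sum_ite_eq, Finset.mem_univ, if_true,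
    columnMoment_of_ne hxy]
  have hcard : (0 : ℝ) < Fintype.card ι := by exact_mod_cast Fintype.card_pos_iff.2 ⟨x⟩
  rw [Finset.sum_const, Finset.card_univ, nsmul_eq_mul]
  field_simp

open scoped Matrix.Norms.L2Operator in
theorem norm_interaction_pow_le [Nonempty ι] (ω : Matrix.unitaryGroup ι ℂ × (ι → ℝ)) (m : ℕ) :
    ‖interaction ω‖ ^ m ≤ ∑ k, |ω.2 k| ^ m := by
  obtain ⟨k, hk⟩ := Finite.exists_max fun i => |ω.2 i|
  have hU : (ω.1 : Matrix ι ι ℂ)ᴴ ∈ unitary (Matrix ι ι ℂ) := Unitary.star_mem ω.1.2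
  have hle : ‖interaction ω‖ ≤ |ω.2 k| := by
    rw [interaction, CStarRing.norm_mul_mem_unitary _ hU,
      CStarRing.norm_mem_unitary_mul _ ω.1.2, Matrix.l2_opNorm_diagonal,
      pi_norm_le_iff_of_nonneg (abs_nonneg _)]
    exact fun i => (Complex.norm_real _).trans_le (hk i)
  exact (pow_le_pow_left₀ (norm_nonneg _) hle m).trans
    (Finset.single_le_sum (f := fun k => |ω.2 k| ^ m) (fun _ _ => by positivity)
      (Finset.mem_univ k))

theorem integrable_interactionLaw_snd {f : (ι → ℝ) → ℝ} (hf : Integrable f (gaussianLaw ι)) :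
    Integrable (fun ω => f ω.2) (interactionLaw ι) :=
  hf.comp_snd (haarUnitary ι)

theorem integral_interactionLaw_snd (f : (ι → ℝ) → ℝ) :
    ∫ ω, f ω.2 ∂interactionLaw ι = ∫ D, f D ∂gaussianLaw ι := by
  refine (integral_fun_snd (μ := haarUnitary ι) (ν := gaussianLaw ι) f).trans ?_
  rw [probReal_univ, one_smul]

theorem integrable_norm_sq_propagator (e : ι → ℝ) (α t : ℝ) (x y : ι) :
    Integrable (fun ω => ‖propagator e α t (interaction ω) x y‖ ^ 2) (interactionLaw ι) := by
  have hcont : Continuous fun ω : Matrix.unitaryGroup ι ℂ × (ι → ℝ) =>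
      ‖propagator e α t (interaction ω) x y‖ ^ 2 :=
    ((((continuous_apply_apply x y).comp (continuous_propagator e α t)).comp
      continuous_interaction).norm).pow 2
  refine Integrable.of_bound hcont.aestronglyMeasurable 1 (Eventually.of_forall fun ω => ?_)
  rw [Real.norm_of_nonneg (by positivity),
    ← sum_norm_sq_col_eq_one (propagator_mem_unitary e α t (interaction_isHermitian ω)) y]
  exact Finset.single_le_sum (f := fun x => ‖propagator e α t (interaction ω) x y‖ ^ 2)
    (fun _ _ => by positivity) (Finset.mem_univ x)

theorem sum_abs_norm_sq_propagator_interaction_sub_le (e : ι → ℝ) {α t : ℝ} (hα : 0 ≤ α)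
    (ht : 0 ≤ t) (y : ι) (ω : Matrix.unitaryGroup ι ℂ × (ι → ℝ)) :
    ∑ x ∈ Finset.univ.erase y, |‖propagator e α t (interaction ω) x y‖ ^ 2 -
        (α * t) ^ 2 * Real.sinc ((e x - e y) * t / 2) ^ 2 * ‖interaction ω x y‖ ^ 2| ≤
      (2 * (α * t) ^ 3 + (α * t) ^ 4) * ∑ k, (|ω.2 k| ^ 3 + |ω.2 k| ^ 4) := by
  have : Nonempty ι := ⟨y⟩
  refine (sum_abs_norm_sq_propagator_sub_le e hα ht (interaction_isHermitian ω) y).trans ?_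
  rw [mul_pow (α * t), mul_pow (α * t), ← mul_assoc, Finset.sum_add_distrib, add_mul]
  gcongr
  · exact (norm_interaction_pow_le ω 3).trans
      (le_add_of_nonneg_right (Finset.sum_nonneg fun _ _ => by positivity))
  · exact (norm_interaction_pow_le ω 4).trans
      (le_add_of_nonneg_left (Finset.sum_nonneg fun _ _ => by positivity))

theorem sum_abs_integral_propagator_sub_le (e : ι → ℝ) {α t : ℝ} (hα : 0 ≤ α) (ht : 0 ≤ t)
    (y : ι) :
    ∑ x ∈ Finset.univ.erase y,
        |∫ ω, ‖propagator e α t (interaction ω) x y‖ ^ 2 ∂interactionLaw ι -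
          (α * t) ^ 2 * Real.sinc ((e x - e y) * t / 2) ^ 2 / ((Fintype.card ι : ℝ) + 1)| ≤
      Fintype.card ι * gaussianMoment * (2 * (α * t) ^ 3 + (α * t) ^ 4) := by
  set f : ι → Matrix.unitaryGroup ι ℂ × (ι → ℝ) → ℝ := fun x ω =>
    ‖propagator e α t (interaction ω) x y‖ ^ 2 -
      (α * t) ^ 2 * Real.sinc ((e x - e y) * t / 2) ^ 2 * ‖interaction ω x y‖ ^ 2
  have hf (x : ι) : Integrable (f x) (interactionLaw ι) :=
    (integrable_norm_sq_propagator e α t x y).sub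
      ((integrable_norm_sq_interaction x y).const_mul _)
  have integral_f {x : ι} (hxy : x ≠ y) :
      ∫ ω, ‖propagator e α t (interaction ω) x y‖ ^ 2 ∂interactionLaw ι -
          (α * t) ^ 2 * Real.sinc ((e x - e y) * t / 2) ^ 2 / ((Fintype.card ι : ℝ) + 1) =
        ∫ ω, f x ω ∂interactionLaw ι := by
    rw [integral_sub (integrable_norm_sq_propagator e α t x y)
      ((integrable_norm_sq_interaction x y).const_mul _), integral_const_mul,
      integral_norm_sq_interaction hxy, mul_one_div]
  calc _ ≤ ∑ x ∈ Finset.univ.erase y, ∫ ω, |f x ω| ∂interactionLaw ι :=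
        Finset.sum_le_sum fun x hx => by
          rw [integral_f (Finset.ne_of_mem_erase hx)]
          exact abs_integral_le_integral_abs
    _ = ∫ ω, ∑ x ∈ Finset.univ.erase y, |f x ω| ∂interactionLaw ι :=
        (integral_finsetSum _ fun x _ => (hf x).abs).symm
    _ ≤ ∫ ω, (2 * (α * t) ^ 3 + (α * t) ^ 4) * ∑ k, (|ω.2 k| ^ 3 + |ω.2 k| ^ 4)
          ∂interactionLaw ι :=
        integral_mono (integrable_finsetSum _ fun x _ => (hf x).abs)
          ((integrable_interactionLaw_snd integrable_gaussianLaw_sum_abs_pow).const_mul _)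
          (sum_abs_norm_sq_propagator_interaction_sub_le e hα ht y)
    _ = Fintype.card ι * gaussianMoment * (2 * (α * t) ^ 3 + (α * t) ^ 4) := by
        rw [integral_const_mul,
          integral_interactionLaw_snd fun D => ∑ k, (|D k| ^ 3 + |D k| ^ 4),
          integral_gaussianLaw_sum_abs_pow, mul_comm]

end InteractionMoments

/-! ## The channel on diagonal states -/

section FixedInteraction

variable {S : Type} [DecidableEq S]

/-- The eigenvalues `E i + envEnergy γ a` of the free Hamiltonian of system and environment. -/
def totalEnergy {S : Type} (E : S → ℝ) (γ : ℝ) (x : S × Fin 2) : ℝ := E x.1 + envEnergy γ x.2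

theorem freeHamiltonian_eq_diagOp (E : S → ℝ) (γ : ℝ) :
    freeHamiltonian E γ = diagOp (totalEnergy E γ) := by
  simp only [freeHamiltonian, diagOp, ← Matrix.diagonal_one, kronecker,
    Matrix.diagonal_kronecker_diagonal, Matrix.diagonal_add, mul_one, one_mul, totalEnergy,
    Complex.ofReal_add]

theorem kronecker_diagOp_diagOp (p : S → ℝ) (q : Fin 2 → ℝ) :
    Matrix.kronecker (diagOp p) (diagOp q) = diagOp fun x : S × Fin 2 => p x.1 * q x.2 := by
  simp only [kronecker, diagOp, Matrix.diagonal_kronecker_diagonal, Complex.ofReal_mul]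

variable [Fintype S]

theorem fixedEvolution_eq (E : S → ℝ) (γ α t : ℝ) {G : Matrix (S × Fin 2) (S × Fin 2) ℂ}
    (hG : G.IsHermitian) (σ : Matrix (S × Fin 2) (S × Fin 2) ℂ) :
    fixedEvolution E γ α t G σ =
      propagator (totalEnergy E γ) α t G * σ * (propagator (totalEnergy E γ) α t G)ᴴ := by
  have hskew : ((Complex.I * (t : ℂ)) • (diagOp (totalEnergy E γ) + (α : ℂ) • G))ᴴ =
      -((Complex.I * (t : ℂ)) • (diagOp (totalEnergy E γ) + (α : ℂ) • G)) := by
    rw [Matrix.conjTranspose_smul, (isHermitian_diagOp_add_smul _ α hG).eq, star_mul', ← neg_smul,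
      Complex.star_def, Complex.conj_I, Complex.conj_ofReal, neg_mul]
  rw [fixedEvolution, freeHamiltonian_eq_diagOp, ← hskew, Matrix.exp_conjTranspose, propagator]

theorem continuous_fixedEvolution (E : S → ℝ) (γ α t : ℝ)
    (σ : Matrix (S × Fin 2) (S × Fin 2) ℂ) :
    Continuous fun ω => fixedEvolution E γ α t (interaction ω) σ := by
  simp only [fixedEvolution_eq E γ α t (interaction_isHermitian _) σ]
  have hU := (continuous_propagator (totalEnergy E γ) α t).comp continuous_interaction
  exact (hU.matrix_mul continuous_const).matrix_mul hU.matrix_conjTranspose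

theorem norm_mul_mul_conjTranspose_apply_le {κ : Type*} [Fintype κ] [DecidableEq κ]
    {U : Matrix κ κ ℂ} (hU : U ∈ Matrix.unitaryGroup κ ℂ) (σ : Matrix κ κ ℂ) (x y : κ) :
    ‖(U * σ * Uᴴ) x y‖ ≤ ∑ l, ∑ k, ‖σ k l‖ := by
  rw [Matrix.mul_apply]
  refine norm_sum_le_of_le _ fun l _ => ?_
  rw [norm_mul, Matrix.conjTranspose_apply, norm_star, Matrix.mul_apply]
  refine (mul_le_of_le_one_right (norm_nonneg _) (entry_norm_bound_of_unitary hU y l)).trans ?_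
  refine norm_sum_le_of_le _ fun k _ => ?_
  rw [norm_mul]
  exact mul_le_of_le_one_left (norm_nonneg _) (entry_norm_bound_of_unitary hU x k)

theorem integrable_fixedEvolution (E : S → ℝ) (γ α t : ℝ)
    (σ : Matrix (S × Fin 2) (S × Fin 2) ℂ) (x y : S × Fin 2) :
    Integrable (fun ω => fixedEvolution E γ α t (interaction ω) σ x y)
      (interactionLaw (S × Fin 2)) := by
  refine Integrable.of_bound ((continuous_apply_apply x y).comp
    (continuous_fixedEvolution E γ α t σ)).aestronglyMeasurable (∑ l, ∑ k, ‖σ k l‖)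
    (Eventually.of_forall fun ω => ?_)
  rw [fixedEvolution_eq E γ α t (interaction_isHermitian ω) σ]
  exact norm_mul_mul_conjTranspose_apply_le
    (propagator_mem_unitary _ α t (interaction_isHermitian ω)) σ x y

theorem kronecker_diagOp_eq_sum {κ : Type*} (ρ : Matrix κ κ ℂ) (q : Fin 2 → ℝ) :
    Matrix.kronecker ρ (diagOp q) =
      ∑ a, (q a : ℂ) • Matrix.kronecker ρ (diagOp (Pi.single a 1)) := by
  ext ⟨i, a⟩ ⟨j, b⟩
  obtain rfl | hab := eq_or_ne a b
  · simp [Matrix.sum_apply, Matrix.kroneckerMap_apply, diagOp, Pi.single_apply,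
      apply_ite Complex.ofReal, -Fin.sum_univ_two, mul_comm]
  · simp [Matrix.sum_apply, Matrix.kroneckerMap_apply, diagOp, hab]

theorem channel_eq_sum (E : S → ℝ) (γ : ℝ) (q : Fin 2 → ℝ) (α t : ℝ) (ρ : Matrix S S ℂ) :
    channel E γ q α t ρ = ∑ a, (q a : ℂ) • channel E γ (Pi.single a 1) α t ρ := by
  have fixedEvolution_sum (ω) (x y : S × Fin 2) :
      fixedEvolution E γ α t (interaction ω) (Matrix.kronecker ρ (diagOp q)) x y =
        ∑ a, (q a : ℂ) * fixedEvolution E γ α t (interaction ω)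
          (Matrix.kronecker ρ (diagOp (Pi.single a 1))) x y := by
    simp only [fixedEvolution, kronecker_diagOp_eq_sum ρ q, Matrix.mul_sum, Matrix.sum_mul,
      Matrix.mul_smul, Matrix.smul_mul, Matrix.sum_apply, Matrix.smul_apply, smul_eq_mul]
  ext i j
  simp only [channel, traceEnv, Matrix.of_apply, fixedEvolution_sum, Matrix.sum_apply,
    Matrix.smul_apply, smul_eq_mul, Finset.mul_sum]
  rw [Finset.sum_comm]
  refine Finset.sum_congr rfl fun b _ => ?_
  rw [integral_finsetSum _ fun a _ => (integrable_fixedEvolution E γ α t _ _ _).const_mul _]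
  simp only [integral_const_mul]

theorem continuous_channel (E : S → ℝ) (γ α t : ℝ) (ρ : Matrix S S ℂ) :
    Continuous fun q => channel E γ q α t ρ :=
  (continuous_congr fun q => channel_eq_sum E γ q α t ρ).2 (by fun_prop)

end FixedInteraction

section SignSymmetry

variable {ι : Type} [Fintype ι] [DecidableEq ι]

theorem propagator_unitary_conj {V : Matrix.unitaryGroup ι ℂ} {e : ι → ℝ}
    (hV : Commute (V : Matrix ι ι ℂ) (diagOp e)) (α t : ℝ) (G : Matrix ι ι ℂ) :
    propagator e α t ((V : Matrix ι ι ℂ) * G * (V : Matrix ι ι ℂ)ᴴ) =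
      (V : Matrix ι ι ℂ) * propagator e α t G * (V : Matrix ι ι ℂ)ᴴ := by
  have hVV : (V : Matrix ι ι ℂ) * (V : Matrix ι ι ℂ)ᴴ = 1 := Matrix.mem_unitaryGroup_iff.1 V.2
  have hdiag : (V : Matrix ι ι ℂ) * diagOp e * (V : Matrix ι ι ℂ)ᴴ = diagOp e := by
    rw [hV.eq, Matrix.mul_assoc, hVV, Matrix.mul_one]
  have hconj := Matrix.exp_units_conj (Unitary.toUnits V)
    ((Complex.I * (t : ℂ)) • (diagOp e + (α : ℂ) • G))
  rw [propagator, propagator]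
  refine Eq.trans ?_ hconj
  change _ = NormedSpace.exp ((V : Matrix ι ι ℂ) * _ * (V : Matrix ι ι ℂ)ᴴ)
  rw [Matrix.mul_smul, Matrix.smul_mul, Matrix.mul_add, Matrix.add_mul, hdiag, Matrix.mul_smul,
    Matrix.smul_mul]

theorem interaction_mul_left (V : Matrix.unitaryGroup ι ℂ)
    (ω : Matrix.unitaryGroup ι ℂ × (ι → ℝ)) :
    interaction (V * ω.1, ω.2) = (V : Matrix ι ι ℂ) * interaction ω * (V : Matrix ι ι ℂ)ᴴ := by
  simp only [interaction, Submonoid.coe_mul, Matrix.conjTranspose_mul, Matrix.mul_assoc]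

theorem integral_interactionLaw_mul_left (V : Matrix.unitaryGroup ι ℂ)
    {f : Matrix.unitaryGroup ι ℂ × (ι → ℝ) → ℂ} (hf : Continuous f) :
    ∫ ω, f (V * ω.1, ω.2) ∂interactionLaw ι = ∫ ω, f ω ∂interactionLaw ι := by
  have hV : MeasurePreserving (fun ω : Matrix.unitaryGroup ι ℂ × (ι → ℝ) => (V * ω.1, ω.2))
      (interactionLaw ι) (interactionLaw ι) :=
    (measurePreserving_mul_left (haarUnitary ι) V).prod (MeasurePreserving.id _)
  nth_rewrite 2 [← hV.map_eq]
  rw [integral_map hV.measurable.aemeasurable hf.aestronglyMeasurable]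

variable {S : Type} [Fintype S] [DecidableEq S]

/-- The unitary that reverses the sign of the system level `i`. -/
def signFlip (i : S) : Matrix.unitaryGroup (S × Fin 2) ℂ :=
  ⟨Matrix.diagonal fun x => if x.1 = i then -1 else 1, by
    rw [Matrix.mem_unitaryGroup_iff, Matrix.star_eq_conjTranspose, Matrix.diagonal_conjTranspose,
      Matrix.diagonal_mul_diagonal, ← Matrix.diagonal_one]
    congr 1
    ext x
    by_cases hx : x.1 = i <;> simp [hx]⟩

theorem commute_signFlip_diagOp (i : S) (v : S × Fin 2 → ℝ) :
    Commute (signFlip i : Matrix (S × Fin 2) (S × Fin 2) ℂ) (diagOp v) :=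
  Matrix.commute_diagonal _ _

theorem signFlip_conj_apply {i j : S} (hij : i ≠ j) (M : Matrix (S × Fin 2) (S × Fin 2) ℂ)
    (a b : Fin 2) :
    ((signFlip i : Matrix (S × Fin 2) (S × Fin 2) ℂ) * M *
      (signFlip i : Matrix (S × Fin 2) (S × Fin 2) ℂ)ᴴ) (i, a) (j, b) = -M (i, a) (j, b) := by
  simp [signFlip, Matrix.diagonal_conjTranspose, Matrix.mul_diagonal, Matrix.diagonal_mul,
    hij.symm]

theorem fixedEvolution_signFlip_conj (E : S → ℝ) (γ α t : ℝ) (v : S × Fin 2 → ℝ) (i : S)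
    (ω : Matrix.unitaryGroup (S × Fin 2) ℂ × (S × Fin 2 → ℝ)) :
    fixedEvolution E γ α t (interaction (signFlip i * ω.1, ω.2)) (diagOp v) =
      (signFlip i : Matrix (S × Fin 2) (S × Fin 2) ℂ) *
        fixedEvolution E γ α t (interaction ω) (diagOp v) *
          (signFlip i : Matrix (S × Fin 2) (S × Fin 2) ℂ)ᴴ := by
  rw [fixedEvolution_eq E γ α t (interaction_isHermitian _),
    fixedEvolution_eq E γ α t (interaction_isHermitian _), interaction_mul_left,
    propagator_unitary_conj (commute_signFlip_diagOp i _)]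
  set V : Matrix (S × Fin 2) (S × Fin 2) ℂ := (signFlip i).1
  set U := propagator (totalEnergy E γ) α t (interaction ω)
  have hVV : Vᴴ * V = 1 := Matrix.mem_unitaryGroup_iff'.1 (signFlip i).2
  have hcomm : Commute V (diagOp v) := commute_signFlip_diagOp i v
  have hdiag : Vᴴ * diagOp v * V = diagOp v := by
    rw [Matrix.mul_assoc, ← hcomm.eq, ← Matrix.mul_assoc, hVV, Matrix.one_mul]
  calc V * U * Vᴴ * diagOp v * (V * U * Vᴴ)ᴴ
      = V * U * (Vᴴ * diagOp v * V) * Uᴴ * Vᴴ := by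
        simp only [Matrix.conjTranspose_mul, Matrix.conjTranspose_conjTranspose, Matrix.mul_assoc]
    _ = V * (U * diagOp v * Uᴴ) * Vᴴ := by simp only [hdiag, Matrix.mul_assoc]

/-- The law of the interaction is invariant under the sign flip of a level, while the coherences
of that level change sign. -/
theorem integral_fixedEvolution_eq_zero (E : S → ℝ) (γ α t : ℝ) (v : S × Fin 2 → ℝ) {i j : S}
    (hij : i ≠ j) (a b : Fin 2) :
    ∫ ω, fixedEvolution E γ α t (interaction ω) (diagOp v) (i, a) (j, b)
      ∂interactionLaw (S × Fin 2) = 0 := by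
  have hinv : ∫ ω : Matrix.unitaryGroup (S × Fin 2) ℂ × (S × Fin 2 → ℝ),
        fixedEvolution E γ α t (interaction (signFlip i * ω.1, ω.2)) (diagOp v) (i, a) (j, b)
          ∂interactionLaw (S × Fin 2) = _ :=
    integral_interactionLaw_mul_left (signFlip i)
      ((continuous_apply_apply (i, a) (j, b)).comp (continuous_fixedEvolution E γ α t (diagOp v)))
  simp only [fixedEvolution_signFlip_conj, signFlip_conj_apply hij,
    integral_neg] at hinv
  exact self_eq_neg.1 hinv.symm

end SignSymmetry

section LevelTransition

variable {S : Type} [Fintype S] [DecidableEq S]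

/-- The average probability, over the interaction and the environment, that the channel moves the
system from the source level (column) to the target level (row). -/
def levelTransition (E : S → ℝ) (γ : ℝ) (q : Fin 2 → ℝ) (α t : ℝ) : Matrix S S ℝ :=
  Matrix.of fun j i => ∑ a, q a * ∑ b,
    ∫ ω, ‖propagator (totalEnergy E γ) α t (interaction ω) (j, b) (i, a)‖ ^ 2
      ∂interactionLaw (S × Fin 2)

theorem mul_diagOp_mul_conjTranspose_apply {κ : Type} [Fintype κ] [DecidableEq κ]
    (U : Matrix κ κ ℂ) (v : κ → ℝ) (x : κ) :
    (U * diagOp v * Uᴴ) x x = ((∑ k, v k * ‖U x k‖ ^ 2 : ℝ) : ℂ) := by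
  rw [Matrix.mul_apply, Complex.ofReal_sum]
  refine Finset.sum_congr rfl fun k _ => ?_
  rw [diagOp, Matrix.mul_diagonal, Matrix.conjTranspose_apply, Complex.ofReal_mul,
    Complex.ofReal_pow, ← Complex.mul_conj', Complex.star_def]
  ring

theorem integral_fixedEvolution_diagOp_self (E : S → ℝ) (γ α t : ℝ) (v : S × Fin 2 → ℝ)
    (x : S × Fin 2) :
    ∫ ω, fixedEvolution E γ α t (interaction ω) (diagOp v) x x ∂interactionLaw (S × Fin 2) =
      ((∑ y, v y * ∫ ω, ‖propagator (totalEnergy E γ) α t (interaction ω) x y‖ ^ 2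
        ∂interactionLaw (S × Fin 2) : ℝ) : ℂ) := by
  simp only [fixedEvolution_eq E γ α t (interaction_isHermitian _),
    mul_diagOp_mul_conjTranspose_apply]
  rw [integral_complex_ofReal, integral_finsetSum _ fun y _ =>
    (integrable_norm_sq_propagator _ α t x y).const_mul _]
  simp only [integral_const_mul]

theorem channel_diagOp (E : S → ℝ) (γ : ℝ) (q : Fin 2 → ℝ) (α t : ℝ) (p : S → ℝ) :
    channel E γ q α t (diagOp p) = diagOp (levelTransition E γ q α t *ᵥ p) := by
  rw [channel, kronecker_diagOp_diagOp]
  ext i j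
  simp only [traceEnv, Matrix.of_apply]
  obtain rfl | hij := eq_or_ne i j
  · simp only [integral_fixedEvolution_diagOp_self, ← Complex.ofReal_sum, Fintype.sum_prod_type]
    rw [diagOp, Matrix.diagonal_apply_eq]
    congr 1
    rw [Finset.sum_comm]
    refine Finset.sum_congr rfl fun k _ => ?_
    change _ = levelTransition E γ q α t i k * p k
    rw [levelTransition, Matrix.of_apply, Finset.sum_comm, Finset.sum_mul]
    refine Finset.sum_congr rfl fun a _ => ?_
    rw [← Finset.mul_sum]
    ring
  · simp only [integral_fixedEvolution_eq_zero E γ α t _ hij, Finset.sum_const_zero]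
    rw [diagOp, Matrix.diagonal_apply_ne _ hij]

theorem iterate_channel_diagOp (E : S → ℝ) (γ : ℝ) (q : Fin 2 → ℝ) (α t : ℝ) (p : S → ℝ) (L : ℕ) :
    (channel E γ q α t)^[L] (diagOp p) = diagOp (levelTransition E γ q α t ^ L *ᵥ p) := by
  induction L with
  | zero => rw [Function.iterate_zero_apply, pow_zero, Matrix.one_mulVec]
  | succ L ih =>
    rw [Function.iterate_succ_apply', ih, channel_diagOp, pow_succ', Matrix.mulVec_mulVec]

theorem levelTransition_mem_colStochastic (E : S → ℝ) (γ : ℝ) {q : Fin 2 → ℝ}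
    (hq : q ∈ stdSimplex ℝ (Fin 2)) (α t : ℝ) :
    levelTransition E γ q α t ∈ Matrix.colStochastic ℝ S := by
  have sum_prob (i : S) (a : Fin 2) :
      ∑ j, ∑ b, ∫ ω, ‖propagator (totalEnergy E γ) α t (interaction ω) (j, b) (i, a)‖ ^ 2
        ∂interactionLaw (S × Fin 2) = 1 := by
    rw [← Fintype.sum_prod_type (f := fun x : S × Fin 2 =>
      ∫ ω, ‖propagator (totalEnergy E γ) α t (interaction ω) x (i, a)‖ ^ 2
        ∂interactionLaw (S × Fin 2)),
      ← integral_finsetSum _ fun x _ => integrable_norm_sq_propagator _ α t x _]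
    simp only [sum_norm_sq_col_eq_one
      (propagator_mem_unitary _ α t (interaction_isHermitian _)), integral_const, probReal_univ,
      one_smul]
  refine Matrix.mem_colStochastic_iff_sum.2 ⟨fun j i => ?_, fun i => ?_⟩
  · rw [levelTransition, Matrix.of_apply]
    exact Finset.sum_nonneg fun a _ => mul_nonneg (hq.1 a) <| Finset.sum_nonneg fun b _ =>
      integral_nonneg fun ω => sq_nonneg _
  · simp only [levelTransition, Matrix.of_apply]
    rw [Finset.sum_comm]
    simp only [← Finset.mul_sum, sum_prob, mul_one, hq.2]

end LevelTransition

section DiagonalStates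

variable {S : Type} [Fintype S] [DecidableEq S]

theorem traceNorm_diagOp (v : S → ℝ) : traceNorm (diagOp v) = ∑ i, |v i| := by
  have hsq : (diagOp v)ᴴ * diagOp v = Matrix.diagonal fun i => ((v i ^ 2 : ℝ) : ℂ) := by
    rw [diagOp_isHermitian v, diagOp, Matrix.diagonal_mul_diagonal]
    simp only [sq, Complex.ofReal_mul]
  have hroots :=
    (Matrix.isHermitian_conjTranspose_mul_self (diagOp v)).roots_charpoly_eq_eigenvalues
  rw [congrArg Matrix.charpoly hsq, Matrix.charpoly_diagonal, Polynomial.roots_prod _ _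
    (Finset.prod_ne_zero_iff.2 fun _ _ => Polynomial.X_sub_C_ne_zero _)] at hroots
  simp only [Polynomial.roots_X_sub_C, Multiset.bind_singleton] at hroots
  have hsum := congrArg (fun m : Multiset ℂ => (m.map fun z => Real.sqrt z.re).sum) hroots
  simp only [Multiset.map_map, Function.comp_def, Complex.ofReal_re, Real.sqrt_sq_eq_abs] at hsum
  exact hsum.symm

theorem eq_diagonal_of_commute_diagOp {E : S → ℝ} (hE : Function.Injective E) {ρ : Matrix S S ℂ}
    (hρ : Commute ρ (diagOp E)) : ρ = Matrix.diagonal fun i => ρ i i := by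
  ext i j
  obtain rfl | hij := eq_or_ne i j
  · rw [Matrix.diagonal_apply_eq]
  · have hcomm := congrFun₂ hρ.eq i j
    rw [diagOp, Matrix.mul_diagonal, Matrix.diagonal_mul, mul_comm] at hcomm
    rw [Matrix.diagonal_apply_ne _ hij]
    by_contra hne
    exact hij (hE (Complex.ofReal_injective (mul_right_cancel₀ hne hcomm))).symm

theorem exists_diagOp_eq_of_commute {E : S → ℝ} (hE : Function.Injective E) {ρ : Matrix S S ℂ}
    (hρ : IsDensity ρ) (hcomm : Commute ρ (diagOp E)) : ∃ p ∈ stdSimplex ℝ S, ρ = diagOp p := by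
  refine ⟨fun i => (ρ i i).re,
    ⟨fun i => (Complex.nonneg_iff.1 (hρ.1.diag_nonneg (i := i))).1, ?_⟩, ?_⟩
  · have htrace := congrArg Complex.re hρ.2
    rwa [Matrix.trace, Complex.re_sum, Complex.one_re] at htrace
  · refine (eq_diagonal_of_commute_diagOp hE hcomm).trans ?_
    rw [diagOp]
    congr 1
    exact funext fun i => (Complex.conj_eq_iff_re.1 (hρ.1.isHermitian.apply i i)).symm

end DiagonalStates

/-! ## The oscillator chain -/

section Resonance

variable {N : ℕ} {Δ : ℝ}

theorem oscEnergy_sub (Δ b : ℝ) (i j : Fin N) :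
    oscEnergy N Δ b i - oscEnergy N Δ b j = ((i - j : ℤ) : ℝ) * Δ := by
  simp only [oscEnergy]
  push_cast
  ring

theorem oscEnergy_injective (hΔ : Δ ≠ 0) (b : ℝ) : Function.Injective (oscEnergy N Δ b) := by
  intro i j hij
  have h : ((i : ℝ) + 1) * Δ = (j + 1) * Δ := add_right_cancel hij
  exact Fin.ext (by simpa [hΔ] using h)

theorem le_abs_intCast_mul (hΔ : 0 ≤ Δ) {m : ℤ} (hm : m ≠ 0) : Δ ≤ |(m : ℝ) * Δ| := by
  rw [abs_mul, abs_of_nonneg hΔ]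
  exact le_mul_of_one_le_left hΔ (by exact_mod_cast Int.one_le_abs hm)

theorem deltaMin_oscEnergy (hN : 2 ≤ N) (hΔ : 0 < Δ) (b : ℝ) :
    deltaMin (oscEnergy N Δ b) = Δ := by
  refine IsLeast.csInf_eq ⟨⟨⟨1, by lia⟩, ⟨0, by lia⟩, ⟨0, by lia⟩, ⟨0, by lia⟩, ?_, ?_⟩, ?_⟩
  · simp [oscEnergy_sub, hΔ.ne']
  · simp [oscEnergy_sub, abs_of_pos hΔ]
  · rintro x ⟨i, j, k, l, hne, rfl⟩
    rw [oscEnergy_sub, oscEnergy_sub, ← sub_mul, ← Int.cast_sub]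
    refine le_abs_intCast_mul hΔ.le fun h => hne ?_
    rw [oscEnergy_sub, oscEnergy_sub, sub_eq_zero.1 h]

theorem resonant_intCast_mul (hΔ : 0 < Δ) (t : ℝ) (m : ℤ) :
    resonant Δ t (m * Δ) = if m = 0 then 1 else 0 := by
  unfold resonant
  split_ifs with h hm hm
  · simp [hm]
  · exact absurd h (le_abs_intCast_mul hΔ.le hm).not_gt
  · simp [hm, hΔ] at h
  · rfl

theorem onRate_oscEnergy (hN : 2 ≤ N) (hΔ : 0 < Δ) (b : ℝ) (q : Fin 2 → ℝ) (α t : ℝ)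
    (i j : Fin N) :
    onRate (oscEnergy N Δ b) Δ q α t i j = rescaledCoupling (Fin N) α t ^ 2 *
      ((if (i : ℕ) = j + 1 then q 0 else 0) + if (i : ℕ) + 1 = j then q 1 else 0) := by
  have hdown : oscEnergy N Δ b i - oscEnergy N Δ b j - Δ = ((i - j - 1 : ℤ) : ℝ) * Δ := by
    rw [oscEnergy_sub]
    push_cast
    ring
  have hup : oscEnergy N Δ b i - oscEnergy N Δ b j + Δ = ((i - j + 1 : ℤ) : ℝ) * Δ := by
    rw [oscEnergy_sub]
    push_cast
    ring
  have hdown_iff : (i - j - 1 : ℤ) = 0 ↔ (i : ℕ) = j + 1 := by omega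
  have hup_iff : (i - j + 1 : ℤ) = 0 ↔ (i : ℕ) + 1 = j := by omega
  rw [onRate, deltaMin_oscEnergy hN hΔ, hdown, hup, resonant_intCast_mul hΔ,
    resonant_intCast_mul hΔ]
  simp only [hdown_iff, hup_iff, mul_ite, mul_one, mul_zero]

theorem ladder_apply_of_ne (q : Fin 2 → ℝ) {i j : Fin N} (hji : j ≠ i) :
    ladder N q j i = (if (i : ℕ) = j + 1 then q 0 else 0) + if (i : ℕ) + 1 = j then q 1 else 0 := by
  rw [ladder_apply_eq_add, if_neg (Fin.val_ne_of_ne hji.symm), sub_zero]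

theorem ladder_apply_self (q : Fin 2 → ℝ) (i : Fin N) :
    ladder N q i i =
      -((if 0 < (i : ℕ) then q 0 else 0) + if (i : ℕ) + 1 < N then q 1 else 0) := by
  simp [ladder]

theorem sum_ladder_apply (q : Fin 2 → ℝ) (i : Fin N) : ∑ j, ladder N q j i = 0 := by
  have hdown := sum_ite_val_add_one_eq (N := N) (fun _ => q 0) i.2.le
  have hup := sum_ite_val_eq (N := N) (fun _ => q 1) (i + 1)
  rw [← Finset.add_sum_erase _ _ (Finset.mem_univ i), ladder_apply_self,
    Finset.sum_congr rfl fun j hj => ladder_apply_of_ne q (Finset.ne_of_mem_erase hj),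
    Finset.sum_erase _ (by simp), Finset.sum_add_distrib]
  simp only [eq_comm (a := (i : ℕ)), eq_comm (a := (i : ℕ) + 1), hdown, hup]
  ring

theorem transition_oscEnergy (hN : 2 ≤ N) (hΔ : 0 < Δ) (b : ℝ) (q : Fin 2 → ℝ) (α t : ℝ) :
    transition (oscEnergy N Δ b) Δ q α t = rescaledCoupling (Fin N) α t ^ 2 • ladder N q := by
  have hoff (i j : Fin N) (hji : j ≠ i) :
      onRate (oscEnergy N Δ b) Δ q α t i j =
        rescaledCoupling (Fin N) α t ^ 2 * ladder N q j i := by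
    rw [onRate_oscEnergy hN hΔ, ladder_apply_of_ne q hji]
  ext j i
  rw [transition, of_apply, Matrix.smul_apply, smul_eq_mul]
  split_ifs with hji
  · subst hji
    have hdiag := Finset.add_sum_erase _ (fun k => ladder N q k j) (Finset.mem_univ j)
    rw [sum_ladder_apply] at hdiag
    rw [Finset.sum_congr rfl fun k hk => hoff j k (Finset.ne_of_mem_erase hk), ← Finset.mul_sum,
      eq_neg_of_add_eq_zero_left hdiag, mul_neg]
  · exact hoff i j hji

theorem rescaledCoupling_sq (S : Type) [Fintype S] (α t : ℝ) :
    rescaledCoupling S α t ^ 2 = (α * t) ^ 2 / (2 * (Fintype.card S : ℝ) + 1) := by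
  rw [rescaledCoupling, div_pow, Real.sq_sqrt (by positivity)]

theorem rescaledCoupling_pos (S : Type) [Fintype S] {α t : ℝ} (hα : 0 < α) (ht : 0 < t) :
    0 < rescaledCoupling S α t := by
  rw [rescaledCoupling]
  positivity

theorem one_add_smul_ladder_mem_colStochastic {q : Fin 2 → ℝ} (h0 : ∀ a, 0 ≤ q a) {s : ℝ}
    (hs : 0 ≤ s) (hs1 : s * ∑ a, q a ≤ 1) :
    1 + s • ladder N q ∈ colStochastic ℝ (Fin N) := by
  rw [Fin.sum_univ_two] at hs1
  refine mem_colStochastic_iff_sum.2 ⟨fun j i => ?_, fun i => ?_⟩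
  · rw [Matrix.add_apply, Matrix.smul_apply, smul_eq_mul]
    by_cases hji : j = i
    · have hexit : (if 0 < (i : ℕ) then q 0 else 0) + (if (i : ℕ) + 1 < N then q 1 else 0) ≤
          q 0 + q 1 := by
        gcongr <;> split_ifs <;> simp [h0]
      rw [hji, one_apply_eq, ladder_apply_self]
      linarith [mul_le_mul_of_nonneg_left hexit hs]
    · rw [one_apply_ne hji, zero_add, ladder_apply_of_ne q hji]
      refine mul_nonneg hs (add_nonneg ?_ ?_) <;> split_ifs <;> simp [h0]
  · simp [Finset.sum_add_distrib, ← Finset.mul_sum, sum_ladder_apply, one_apply]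

theorem one_add_smul_ladder_mulVec_eq_self_iff {q : Fin 2 → ℝ} {s : ℝ} (hs : s ≠ 0)
    {p : Fin N → ℝ} : (1 + s • ladder N q) *ᵥ p = p ↔ ladder N q *ᵥ p = 0 := by
  rw [add_mulVec, one_mulVec, smul_mulVec, add_eq_left, smul_eq_zero, or_iff_right hs]

theorem fixedPoints_one_add_smul_ladder {q : Fin 2 → ℝ} (hq : q 0 ≠ 0) {s : ℝ} (hs : s ≠ 0)
    {π : Fin N → ℝ} (hπ : π ∈ stdSimplex ℝ (Fin N)) (hstat : ladder N q *ᵥ π = 0) :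
    {p ∈ stdSimplex ℝ (Fin N) | (1 + s • ladder N q) *ᵥ p = p} = {π} := by
  ext p
  simp only [one_add_smul_ladder_mulVec_eq_self_iff hs, Set.mem_ofPred_eq, Set.mem_singleton_iff]
  constructor
  · rintro ⟨hp, hfix⟩
    exact eq_of_ladder_mulVec_eq_zero hq hfix hstat hp.2 hπ.2
  · rintro rfl
    exact ⟨hπ, hstat⟩

theorem continuous_ladder (N : ℕ) : Continuous (ladder N) := by
  refine continuous_matrix fun j i => ?_
  simp only [ladder, of_apply]
  split_ifs <;> fun_prop

end Resonance

section ThermalPopulations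

variable {N : ℕ} {Δ : ℝ}

theorem gibbs_pos {κ : Type} [Fintype κ] (E : κ → ℝ) (β : ℝ) (i : κ) : 0 < gibbs E β i :=
  have : Nonempty κ := ⟨i⟩
  div_pos (Real.exp_pos _) (Finset.sum_pos (fun _ _ => Real.exp_pos _) Finset.univ_nonempty)

theorem gibbs_mem_stdSimplex {κ : Type} [Fintype κ] [Nonempty κ] (E : κ → ℝ) (β : ℝ) :
    gibbs E β ∈ stdSimplex ℝ κ := by
  refine ⟨fun i => (gibbs_pos E β i).le, ?_⟩
  simp only [gibbs]
  rw [← Finset.sum_div, div_self]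
  exact (Finset.sum_pos (fun _ _ => Real.exp_pos _) Finset.univ_nonempty).ne'

theorem gibbs_le_gibbs {κ : Type} [Fintype κ] {E : κ → ℝ} {β : ℝ} (hβ : 0 ≤ β) {i j : κ}
    (hij : E i ≤ E j) : gibbs E β j ≤ gibbs E β i := by
  have hexp : -β * E j ≤ -β * E i := mul_le_mul_of_nonpos_left hij (neg_nonpos.2 hβ)
  unfold gibbs
  gcongr

theorem gibbs_add_const {κ : Type} [Fintype κ] (E : κ → ℝ) (c β : ℝ) :
    gibbs (fun i => E i + c) β = gibbs E β := by
  ext i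
  simp only [gibbs, mul_add, Real.exp_add]
  rw [← Finset.sum_mul, mul_div_mul_right _ _ (Real.exp_ne_zero _)]

theorem gibbs_envEnergy_div (Δ β : ℝ) :
    gibbs (envEnergy Δ) β 1 / gibbs (envEnergy Δ) β 0 = Real.exp (-β * Δ) := by
  rw [gibbs, gibbs, div_div_div_cancel_right₀, ← Real.exp_sub]
  · simp [envEnergy]
  · positivity

theorem ladder_mulVec_gibbs (N : ℕ) (Δ b β : ℝ) :
    ladder N (gibbs (envEnergy Δ) β) *ᵥ gibbs (oscEnergy N Δ b) β = 0 := by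
  refine (ladder_mulVec_eq_zero_iff (gibbs_pos _ _ _).ne').2
    ⟨Real.exp (-β * (Δ + b)) / ∑ j, Real.exp (-β * oscEnergy N Δ b j), ?_⟩
  ext i
  rw [Pi.smul_apply, geometricVec, gibbs_envEnergy_div, ← Real.exp_nat_mul, gibbs, smul_eq_mul,
    div_mul_eq_mul_div, ← Real.exp_add, oscEnergy]
  congr 2
  ring

theorem ground_mem_stdSimplex (hN : 0 < N) : ground N ∈ stdSimplex ℝ (Fin N) := by
  refine ⟨fun i => by unfold ground; positivity, ?_⟩
  simpa [ground, hN] using sum_ite_val_eq (N := N) (fun _ => (1 : ℝ)) 0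

@[simp]
theorem ground_two_zero : ground 2 0 = 1 := if_pos rfl

@[simp]
theorem ground_two_one : ground 2 1 = 0 := if_neg one_ne_zero

theorem ladder_mulVec_ground (N : ℕ) : ladder N (ground 2) *ᵥ ground N = 0 := by
  refine (ladder_mulVec_eq_zero_iff (by simp)).2 ⟨1, ?_⟩
  ext i
  rw [one_smul, geometricVec, ground_two_one, zero_div, zero_pow_eq, ground]

theorem charpoly_smul_ladder_ground (hN : 0 < N) (c : ℝ) :
    (c • ladder N (ground 2)).charpoly =
      Polynomial.X * (Polynomial.X + Polynomial.C c) ^ (N - 1) := by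
  rw [charpoly_smul_ladder_of_eq_zero hN ground_two_one, ground_two_zero, mul_one]

theorem spectrum_smul_ladder_ground (hN : 2 ≤ N) (c : ℝ) :
    spectrum ℝ (c • ladder N (ground 2)) = {0, -c} := by
  ext x
  rw [mem_spectrum_iff_isRoot_charpoly, charpoly_smul_ladder_ground (by omega)]
  simp [show N - 1 ≠ 0 by omega, eq_neg_iff_add_eq_zero]

theorem one_add_smul_ladder_gibbs_mem_colStochastic (N : ℕ) (Δ β : ℝ) {s : ℝ} (hs : 0 ≤ s)
    (hs1 : s ≤ 1) : 1 + s • ladder N (gibbs (envEnergy Δ) β) ∈ colStochastic ℝ (Fin N) :=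
  have hq := gibbs_mem_stdSimplex (envEnergy Δ) β
  one_add_smul_ladder_mem_colStochastic hq.1 hs (by rwa [hq.2, mul_one])

theorem fixedPoints_one_add_smul_ladder_gibbs (hN : 0 < N) (Δ b β : ℝ) {s : ℝ} (hs : s ≠ 0) :
    {p ∈ stdSimplex ℝ (Fin N) | (1 + s • ladder N (gibbs (envEnergy Δ) β)) *ᵥ p = p} =
      {gibbs (oscEnergy N Δ b) β} :=
  have : Nonempty (Fin N) := ⟨⟨0, hN⟩⟩
  fixedPoints_one_add_smul_ladder (gibbs_pos _ _ _).ne' hs (gibbs_mem_stdSimplex _ _)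
    (ladder_mulVec_gibbs N Δ b β)

theorem fixedPoints_one_add_smul_ladder_ground (hN : 0 < N) {s : ℝ} (hs : s ≠ 0) :
    {p ∈ stdSimplex ℝ (Fin N) | (1 + s • ladder N (ground 2)) *ᵥ p = p} = {ground N} :=
  fixedPoints_one_add_smul_ladder (by simp) hs (ground_mem_stdSimplex hN) (ladder_mulVec_ground N)

theorem tendsto_gibbs_oscEnergy (hN : 0 < N) (hΔ : 0 < Δ) (b : ℝ) :
    Tendsto (fun β => gibbs (oscEnergy N Δ b) β) atTop (𝓝 (ground N)) := by
  have hshift : oscEnergy N Δ b = fun i : Fin N => (i : ℕ) * Δ + (Δ + b) := by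
    ext i
    rw [oscEnergy]
    ring
  have hweight (i : Fin N) :
      Tendsto (fun β : ℝ => Real.exp (-β * ((i : ℕ) * Δ))) atTop (𝓝 (ground N i)) := by
    unfold ground
    split_ifs with hi
    · simp [hi]
    · have hE : (0 : ℝ) < (i : ℕ) * Δ := by positivity
      simpa only [neg_mul, Function.comp_def, id] using
        Real.tendsto_exp_neg_atTop_nhds_zero.comp (tendsto_id.atTop_mul_const hE)
  have hsum := (ground_mem_stdSimplex hN).2
  refine tendsto_pi_nhds.2 fun i => ?_
  have h := (hweight i).div (tendsto_finsetSum Finset.univ fun j _ => hweight j)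
    (hsum.trans_ne one_ne_zero)
  rw [hsum, div_one] at h
  simp only [hshift, gibbs_add_const]
  exact h

theorem tendsto_gibbs_envEnergy (hΔ : 0 < Δ) :
    Tendsto (fun β => gibbs (envEnergy Δ) β) atTop (𝓝 (ground 2)) := by
  have henv : envEnergy Δ = oscEnergy 2 Δ (-Δ) := by
    ext a
    fin_cases a <;> simp [envEnergy, oscEnergy, add_mul]
  rw [henv]
  exact tendsto_gibbs_oscEnergy two_pos hΔ _

end ThermalPopulations

section Gap

variable {N : ℕ} {q : Fin 2 → ℝ}

theorem spectralGap_ladder_pos (h0 : 0 < q 0) (h1 : 0 ≤ q 1) (hN : 2 ≤ N) :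
    0 < spectralGap (ladder N q) := by
  rw [spectralGap_ladder h0 h1 hN]
  exact ladderRate_pos h0 h1 one_pos hN

theorem spectralGap_ladder_le_add (h0 : 0 < q 0) (h1 : 0 ≤ q 1) (hN : 2 ≤ N) :
    spectralGap (ladder N q) ≤ q 0 + q 1 := by
  have hcos : 0 ≤ Real.cos ((1 : ℕ) * (Real.pi / N)) := by
    have hN' : (2 : ℝ) ≤ N := by exact_mod_cast hN
    apply Real.cos_nonneg_of_mem_Icc
    rw [Nat.cast_one, one_mul]
    exact ⟨by linarith [Real.pi_pos, show 0 ≤ Real.pi / N by positivity], by gcongr⟩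
  rw [spectralGap_ladder h0 h1 hN, ladderRate, sub_le_self_iff]
  positivity

theorem spectralGap_ladder_ground (hN : 2 ≤ N) : spectralGap (ladder N (ground 2)) = 1 := by
  simp [spectralGap_ladder _ _ hN, ladderRate]

theorem oscGap_pos (hN : 2 ≤ N) (Δ β : ℝ) : 0 < oscGap N Δ β :=
  spectralGap_ladder_pos (gibbs_pos _ _ _) (gibbs_pos _ _ _).le hN

theorem tendsto_oscGap {Δ : ℝ} (hN : 2 ≤ N) (hΔ : 0 < Δ) :
    Tendsto (fun β => oscGap N Δ β) atTop (𝓝 1) := by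
  have hrate : Continuous fun q => ladderRate N q 1 := by
    unfold ladderRate
    fun_prop
  have h := (hrate.tendsto _).comp (tendsto_gibbs_envEnergy hΔ)
  simpa [oscGap, spectralGap_ladder (gibbs_pos _ _ _) (gibbs_pos _ _ _).le hN, Function.comp_def,
    ladderRate] using h

end Gap

/-! ## Perturbation of stochastic matrices -/

section Stochastic

variable {S : Type*} [Fintype S]

theorem sum_abs_mulVec_le {A : Matrix S S ℝ} {δ : ℝ} (hA : ∀ i, ∑ j, |A j i| ≤ δ) (p : S → ℝ) :
    ∑ j, |(A *ᵥ p) j| ≤ δ * ∑ i, |p i| := by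
  calc ∑ j, |(A *ᵥ p) j| ≤ ∑ j, ∑ i, |A j i| * |p i| := by
        refine Finset.sum_le_sum fun j _ => (Finset.abs_sum_le_sum_abs _ _).trans_eq ?_
        simp only [abs_mul]
    _ = ∑ i, (∑ j, |A j i|) * |p i| := by
        rw [Finset.sum_comm]
        simp only [Finset.sum_mul]
    _ ≤ ∑ i, δ * |p i| := by gcongr with i; exact hA i
    _ = δ * ∑ i, |p i| := (Finset.mul_sum _ _ _).symm

theorem sum_abs_eq_one_of_mem_stdSimplex {p : S → ℝ} (hp : p ∈ stdSimplex ℝ S) :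
    ∑ i, |p i| = 1 := by
  simp only [abs_of_nonneg (hp.1 _), hp.2]

variable [DecidableEq S]

theorem sum_abs_sub_le_of_mem_colStochastic {A B : Matrix S S ℝ} (hA : A ∈ colStochastic ℝ S)
    (hB : B ∈ colStochastic ℝ S) (i : S) :
    ∑ j, |A j i - B j i| ≤ 2 * ∑ j ∈ Finset.univ.erase i, |A j i - B j i| := by
  have hsum : ∑ j, (A j i - B j i) = 0 := by
    rw [Finset.sum_sub_distrib, sum_col_of_mem_colStochastic hA, sum_col_of_mem_colStochastic hB,
      sub_self]
  rw [← Finset.add_sum_erase _ _ (Finset.mem_univ i)] at hsum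
  rw [← Finset.add_sum_erase _ _ (Finset.mem_univ i), eq_neg_of_add_eq_zero_left hsum, abs_neg,
    two_mul]
  gcongr
  exact Finset.abs_sum_le_sum_abs _ _

theorem mulVec_mem_stdSimplex {A : Matrix S S ℝ} (hA : A ∈ colStochastic ℝ S)
    {p : S → ℝ} (hp : p ∈ stdSimplex ℝ S) : A *ᵥ p ∈ stdSimplex ℝ S :=
  ⟨nonneg_mulVec_of_mem_colStochastic hA hp.1, by
    rw [sum_mulVec_of_mem_colStochastic hA, hp.2]⟩

theorem sum_abs_pow_mulVec_sub_le {A B : Matrix S S ℝ} (hA : A ∈ colStochastic ℝ S)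
    (hB : B ∈ colStochastic ℝ S) {δ : ℝ} (hδ : ∀ i, ∑ j, |A j i - B j i| ≤ δ)
    {p : S → ℝ} (hp : p ∈ stdSimplex ℝ S) (L : ℕ) :
    ∑ j, |(A ^ L *ᵥ p) j - (B ^ L *ᵥ p) j| ≤ L * δ := by
  induction L with
  | zero => simp
  | succ L ih =>
    have hnew : ∑ j, |((A - B) *ᵥ (A ^ L *ᵥ p)) j| ≤ δ := by
      simpa only [sum_abs_eq_one_of_mem_stdSimplex (mulVec_mem_stdSimplex (pow_mem hA L) hp),
        mul_one] using sum_abs_mulVec_le (A := A - B) hδ (A ^ L *ᵥ p)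
    have hB1 (i : S) : ∑ j, |B j i| ≤ 1 := by
      simp only [abs_of_nonneg (nonneg_of_mem_colStochastic hB),
        sum_col_of_mem_colStochastic hB i, le_refl]
    have hold : ∑ j, |(B *ᵥ (A ^ L *ᵥ p - B ^ L *ᵥ p)) j| ≤ L * δ := by
      simpa only [one_mul] using
        (sum_abs_mulVec_le hB1 (A ^ L *ᵥ p - B ^ L *ᵥ p)).trans ((one_mul _).trans_le ih)
    have hsplit : A ^ (L + 1) *ᵥ p - B ^ (L + 1) *ᵥ p =
        (A - B) *ᵥ (A ^ L *ᵥ p) + B *ᵥ (A ^ L *ᵥ p - B ^ L *ᵥ p) := by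
      rw [pow_succ', pow_succ', ← mulVec_mulVec, ← mulVec_mulVec, sub_mulVec, mulVec_sub,
        sub_add_sub_cancel]
    calc ∑ j, |(A ^ (L + 1) *ᵥ p - B ^ (L + 1) *ᵥ p) j|
        ≤ ∑ j, (|((A - B) *ᵥ (A ^ L *ᵥ p)) j| + |(B *ᵥ (A ^ L *ᵥ p - B ^ L *ᵥ p)) j|) := by
          rw [hsplit]
          exact Finset.sum_le_sum fun j _ => abs_add_le _ _
      _ ≤ δ + L * δ := by rw [Finset.sum_add_distrib]; exact add_le_add hnew hold
      _ = (L + 1 : ℕ) * δ := by push_cast; ring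

end Stochastic

/-! ## Error per interaction -/

section GoldenRule

/-- Fermi's golden rule, in units of `rescaledCoupling ^ 2`: the weak-coupling rate from the source
level (column) to the target level (row), averaged over the initial and summed over the final state
of the environment. Only the off-diagonal entries are meaningful. -/
def goldenRule {S : Type} (E : S → ℝ) (γ : ℝ) (q : Fin 2 → ℝ) (t : ℝ) : Matrix S S ℝ :=
  of fun j i => ∑ a, q a *
    ∑ c, Real.sinc ((totalEnergy E γ (j, c) - totalEnergy E γ (i, a)) * t / 2) ^ 2

theorem sum_abs_levelTransition_sub_goldenRule_le {S : Type} [Fintype S] [DecidableEq S]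
    (E : S → ℝ) (γ : ℝ) {q : Fin 2 → ℝ} (hq : q ∈ stdSimplex ℝ (Fin 2)) {α t : ℝ} (hα : 0 ≤ α)
    (ht : 0 ≤ t) (i : S) :
    ∑ j ∈ Finset.univ.erase i, |levelTransition E γ q α t j i -
        rescaledCoupling S α t ^ 2 * goldenRule E γ q t j i| ≤
      2 * Fintype.card S * gaussianMoment * (2 * (α * t) ^ 3 + (α * t) ^ 4) := by
  set e := totalEnergy E γ
  set M := 2 * Fintype.card S * gaussianMoment * (2 * (α * t) ^ 3 + (α * t) ^ 4)
  set err : S × Fin 2 → S × Fin 2 → ℝ := fun x y =>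
    ∫ ω, ‖propagator e α t (interaction ω) x y‖ ^ 2 ∂interactionLaw (S × Fin 2) -
      rescaledCoupling S α t ^ 2 * Real.sinc ((e x - e y) * t / 2) ^ 2
  have herr (y : S × Fin 2) : ∑ x ∈ Finset.univ.erase y, |err x y| ≤ M := by
    have h := sum_abs_integral_propagator_sub_le e hα ht y
    simp only [Fintype.card_prod, Fintype.card_fin, Nat.cast_mul, Nat.cast_ofNat,
      mul_comm (Fintype.card S : ℝ)] at h
    simpa only [err, rescaledCoupling_sq, div_mul_eq_mul_div] using h
  have hsum (a : Fin 2) : ∑ j ∈ Finset.univ.erase i, ∑ c, |err (j, c) (i, a)| ≤ M := by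
    refine le_trans ?_ (herr (i, a))
    rw [← Finset.sum_product' _ _ fun j c => |err (j, c) (i, a)|]
    refine Finset.sum_le_sum_of_subset_of_nonneg (fun x hx => ?_) fun _ _ _ => abs_nonneg _
    simp only [Finset.mem_product, Finset.mem_erase, Finset.mem_univ, and_true] at hx
    exact Finset.mem_erase.2 ⟨fun h => hx (congrArg Prod.fst h), Finset.mem_univ _⟩
  have hentry (j : S) : levelTransition E γ q α t j i -
      rescaledCoupling S α t ^ 2 * goldenRule E γ q t j i = ∑ a, q a * ∑ c, err (j, c) (i, a) := by
    simp only [levelTransition, goldenRule, of_apply, err, Fin.sum_univ_two, e]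
    ring
  calc _ ≤ ∑ j ∈ Finset.univ.erase i, ∑ a, q a * ∑ c, |err (j, c) (i, a)| := by
        refine Finset.sum_le_sum fun j _ => ?_
        rw [hentry]
        refine (Finset.abs_sum_le_sum_abs _ _).trans (Finset.sum_le_sum fun a _ => ?_)
        rw [abs_mul, abs_of_nonneg (hq.1 a)]
        exact mul_le_mul_of_nonneg_left (Finset.abs_sum_le_sum_abs _ _) (hq.1 a)
    _ = ∑ a, q a * ∑ j ∈ Finset.univ.erase i, ∑ c, |err (j, c) (i, a)| := by
        rw [Finset.sum_comm]
        simp only [Finset.mul_sum]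
    _ ≤ ∑ a, q a * M := Finset.sum_le_sum fun a _ => mul_le_mul_of_nonneg_left (hsum a) (hq.1 a)
    _ = M := by rw [← Finset.sum_mul, hq.2, one_mul]

variable {N : ℕ} {q : Fin 2 → ℝ} {Δ α t : ℝ}

theorem abs_sinc_sq_sub_ite_le (hΔ : 0 < Δ) (ht : 0 < t) (m : ℤ) :
    |Real.sinc (m * Δ * t / 2) ^ 2 - (if m = 0 then 1 else 0)| ≤ 4 / (Δ * t) ^ 2 := by
  split_ifs with hm
  · simp only [hm, Int.cast_zero, zero_mul, zero_div, Real.sinc_zero, one_pow, sub_self, abs_zero]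
    positivity
  · have hx : (m * Δ * t / 2 : ℝ) ≠ 0 :=
      div_ne_zero (mul_ne_zero (mul_ne_zero (Int.cast_ne_zero.2 hm) hΔ.ne') ht.ne') two_ne_zero
    have hm1 : (1 : ℝ) ≤ (m : ℝ) ^ 2 := by
      rw [one_le_sq_iff_one_le_abs]
      exact_mod_cast Int.one_le_abs hm
    rw [sub_zero, abs_of_nonneg (sq_nonneg _), Real.sinc_of_ne_zero hx, div_pow,
      div_le_div_iff₀ (sq_pos_of_ne_zero hx) (by positivity)]
    calc Real.sin (m * Δ * t / 2) ^ 2 * (Δ * t) ^ 2 ≤ 1 * (Δ * t) ^ 2 := by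
          gcongr
          exact Real.sin_sq_le_one _
      _ ≤ (m : ℝ) ^ 2 * (Δ * t) ^ 2 := by gcongr
      _ = 4 * (m * Δ * t / 2) ^ 2 := by ring

theorem totalEnergy_oscEnergy_sub (Δ b : ℝ) (x y : Fin N × Fin 2) :
    totalEnergy (oscEnergy N Δ b) Δ x - totalEnergy (oscEnergy N Δ b) Δ y =
      ((x.1 + x.2 - (y.1 + y.2) : ℤ) : ℝ) * Δ := by
  have henv (a : Fin 2) : envEnergy Δ a = (a : ℕ) * Δ := by fin_cases a <;> simp [envEnergy]
  simp only [totalEnergy, oscEnergy, henv]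
  push_cast
  ring

theorem abs_goldenRule_oscEnergy_sub_ladder_le (hq : q ∈ stdSimplex ℝ (Fin 2)) (hΔ : 0 < Δ)
    (ht : 0 < t) (b : ℝ) {i j : Fin N} (hji : j ≠ i) :
    |goldenRule (oscEnergy N Δ b) Δ q t j i - ladder N q j i| ≤ 8 / (Δ * t) ^ 2 := by
  have hladder : ladder N q j i =
      ∑ a : Fin 2, q a * ∑ c : Fin 2, if (j + c - (i + a) : ℤ) = 0 then 1 else 0 := by
    have hdiag : (j : ℤ) - i ≠ 0 := by simpa [sub_eq_zero, Fin.val_inj] using hji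
    have hdown : (j + 1 - i : ℤ) = 0 ↔ (i : ℕ) = j + 1 := by omega
    have hup : (j - (i + 1) : ℤ) = 0 ↔ (i : ℕ) + 1 = j := by omega
    rw [ladder_apply_of_ne q hji]
    simp [Fin.sum_univ_two, -Finset.sum_boole, hdiag, hdown, hup]
  have hsplit : goldenRule (oscEnergy N Δ b) Δ q t j i - ladder N q j i =
      ∑ a : Fin 2, q a * ∑ c : Fin 2, (Real.sinc ((j + c - (i + a) : ℤ) * Δ * t / 2) ^ 2 -
        if (j + c - (i + a) : ℤ) = 0 then 1 else 0) := by
    simp only [goldenRule, of_apply, totalEnergy_oscEnergy_sub, hladder, Finset.sum_sub_distrib,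
      mul_sub]
  rw [hsplit]
  calc _ ≤ ∑ a, q a * ∑ c : Fin 2, 4 / (Δ * t) ^ 2 := by
        refine (Finset.abs_sum_le_sum_abs _ _).trans (Finset.sum_le_sum fun a _ => ?_)
        rw [abs_mul, abs_of_nonneg (hq.1 a)]
        exact mul_le_mul_of_nonneg_left ((Finset.abs_sum_le_sum_abs _ _).trans
          (Finset.sum_le_sum fun c _ => abs_sinc_sq_sub_ite_le hΔ ht _)) (hq.1 a)
    _ = 8 / (Δ * t) ^ 2 := by
        rw [← Finset.sum_mul, hq.2, Fin.sum_univ_two]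
        ring

theorem sum_abs_levelTransition_sub_one_add_smul_ladder_le (hq : q ∈ stdSimplex ℝ (Fin 2))
    (hΔ : 0 < Δ) (hα : 0 ≤ α) (ht : 0 < t) (b : ℝ) (hs : rescaledCoupling (Fin N) α t ^ 2 ≤ 1)
    (i : Fin N) :
    ∑ j, |levelTransition (oscEnergy N Δ b) Δ q α t j i -
        (1 + rescaledCoupling (Fin N) α t ^ 2 • ladder N q) j i| ≤
      2 * (2 * N * gaussianMoment * (2 * (α * t) ^ 3 + (α * t) ^ 4) +
        N * (rescaledCoupling (Fin N) α t ^ 2 * (8 / (Δ * t) ^ 2))) := by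
  set E := oscEnergy N Δ b
  set s := rescaledCoupling (Fin N) α t ^ 2
  have hs0 : 0 ≤ s := sq_nonneg _
  refine (sum_abs_sub_le_of_mem_colStochastic (levelTransition_mem_colStochastic E Δ hq α t)
    (one_add_smul_ladder_mem_colStochastic hq.1 hs0 (by rwa [hq.2, mul_one])) i).trans ?_
  gcongr
  calc ∑ j ∈ Finset.univ.erase i, |levelTransition E Δ q α t j i - (1 + s • ladder N q) j i|
      ≤ ∑ j ∈ Finset.univ.erase i, (|levelTransition E Δ q α t j i - s * goldenRule E Δ q t j i| +
          s * (8 / (Δ * t) ^ 2)) := by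
        refine Finset.sum_le_sum fun j hj => ?_
        have hji := Finset.ne_of_mem_erase hj
        rw [Matrix.add_apply, one_apply_ne hji, zero_add, Matrix.smul_apply, smul_eq_mul]
        refine (abs_sub_le _ (s * goldenRule E Δ q t j i) _).trans (add_le_add le_rfl ?_)
        rw [← mul_sub, abs_mul, abs_of_nonneg hs0]
        gcongr
        exact abs_goldenRule_oscEnergy_sub_ladder_le hq hΔ ht b hji
    _ ≤ 2 * N * gaussianMoment * (2 * (α * t) ^ 3 + (α * t) ^ 4) + N * (s * (8 / (Δ * t) ^ 2)) := by
        rw [Finset.sum_add_distrib, Finset.sum_const, nsmul_eq_mul]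
        gcongr
        · simpa only [Fintype.card_fin] using
            sum_abs_levelTransition_sub_goldenRule_le E Δ hq hα ht.le i
        · simp

end GoldenRule

/-! ## Simulation cost -/

section Parameters

variable {N : ℕ} {Δ ε lam : ℝ}

theorem oscAlpha_pos (hN : 0 < N) (hΔ : 0 < Δ) (hε : 0 < ε) (hl : 0 < lam) :
    0 < oscAlpha N Δ ε lam := by
  rw [oscAlpha]
  positivity

theorem oscTime_pos (hN : 0 < N) (hΔ : 0 < Δ) (hε : 0 < ε) (hl : 0 < lam) :
    0 < oscTime N Δ ε lam := by
  rw [oscTime]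
  positivity

theorem oscSteps_pos (hN : 0 < N) (hΔ : 0 < Δ) (hε : 0 < ε) (hl : 0 < lam) :
    0 < oscSteps N Δ ε lam := by
  have hα := oscAlpha_pos hN hΔ hε hl
  have ht := oscTime_pos hN hΔ hε hl
  rw [oscSteps]
  positivity

theorem oscAlpha_mul_oscTime (hN : 0 < N) (hΔ : 0 < Δ) (hε : 0 < ε) (hl : 0 < lam) :
    oscAlpha N Δ ε lam * oscTime N Δ ε lam = ε * lam / (N : ℝ) ^ 3 := by
  obtain ⟨x, hx, rfl⟩ : ∃ x, 0 < x ∧ x ^ 2 = ε := ⟨√ε, Real.sqrt_pos.2 hε, Real.sq_sqrt hε.le⟩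
  obtain ⟨y, hy, rfl⟩ : ∃ y, 0 < y ∧ y ^ 2 = lam :=
    ⟨√lam, Real.sqrt_pos.2 hl, Real.sq_sqrt hl.le⟩
  rw [oscAlpha, oscTime, Real.rpow_div_two_eq_sqrt 3 hε.le, Real.rpow_div_two_eq_sqrt 3 hl.le,
    Real.rpow_ofNat, Real.rpow_ofNat, Real.sqrt_mul hε.le, Real.sqrt_sq hx.le, Real.sqrt_sq hy.le]
  field_simp

theorem mul_oscTime_sq (hΔ : Δ ≠ 0) (hel : 0 ≤ ε * lam) :
    (Δ * oscTime N Δ ε lam) ^ 2 = (N : ℝ) ^ 2 / (ε * lam) := by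
  rw [oscTime, ← mul_div_assoc, mul_div_mul_left _ _ hΔ, div_pow, Real.sq_sqrt hel]

theorem oscSteps_mul_oscTime (hN : 0 < N) (hΔ : 0 < Δ) (hε : 0 < ε) (hl : 0 < lam) :
    oscSteps N Δ ε lam * oscTime N Δ ε lam =
      (N : ℝ) ^ 9 / (Δ * ε ^ (5 / 2 : ℝ) * lam ^ (7 / 2 : ℝ)) := by
  obtain ⟨x, hx, rfl⟩ : ∃ x, 0 < x ∧ x ^ 2 = ε := ⟨√ε, Real.sqrt_pos.2 hε, Real.sq_sqrt hε.le⟩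
  obtain ⟨y, hy, rfl⟩ : ∃ y, 0 < y ∧ y ^ 2 = lam :=
    ⟨√lam, Real.sqrt_pos.2 hl, Real.sq_sqrt hl.le⟩
  rw [oscSteps, ← mul_pow, oscAlpha_mul_oscTime hN hΔ hε hl, oscTime, Real.sqrt_mul hε.le,
    Real.rpow_div_two_eq_sqrt 5 hε.le, Real.rpow_div_two_eq_sqrt 7 hl.le, Real.rpow_ofNat,
    Real.rpow_ofNat, Real.sqrt_sq hx.le, Real.sqrt_sq hy.le]
  field_simp

theorem oscAlpha_mul_oscTime_le_one (hN : 0 < N) (hΔ : 0 < Δ) (hε : 0 < ε) (hl : 0 < lam)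
    (hel : ε * lam ≤ 1) : oscAlpha N Δ ε lam * oscTime N Δ ε lam ≤ 1 := by
  rw [oscAlpha_mul_oscTime hN hΔ hε hl]
  exact div_le_one_of_le₀ (hel.trans (one_le_pow₀ (Nat.one_le_cast.2 hN))) (by positivity)

theorem rescaledCoupling_osc_sq_le_one (hN : 0 < N) (hΔ : 0 < Δ) (hε : 0 < ε) (hl : 0 < lam)
    (hel : ε * lam ≤ 1) :
    rescaledCoupling (Fin N) (oscAlpha N Δ ε lam) (oscTime N Δ ε lam) ^ 2 ≤ 1 := by
  have ha0 := mul_pos (oscAlpha_pos hN hΔ hε hl) (oscTime_pos hN hΔ hε hl)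
  have ha1 := oscAlpha_mul_oscTime_le_one hN hΔ hε hl hel
  rw [rescaledCoupling_sq]
  refine div_le_one_of_le₀ ((pow_le_one₀ ha0.le ha1).trans ?_) (by positivity)
  exact le_add_of_nonneg_left (by positivity)

theorem rescaledCoupling_osc_sq_mul_oscSteps (hN : 0 < N) (hΔ : 0 < Δ) (hε : 0 < ε)
    (hl : 0 < lam) :
    rescaledCoupling (Fin N) (oscAlpha N Δ ε lam) (oscTime N Δ ε lam) ^ 2 * lam *
      oscSteps N Δ ε lam = (N : ℝ) ^ 2 / (2 * N + 1) := by
  have hα := oscAlpha_pos hN hΔ hε hl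
  have ht := oscTime_pos hN hΔ hε hl
  rw [rescaledCoupling_sq, Fintype.card_fin, oscSteps]
  field_simp

theorem exp_neg_oscLog (hN : 0 < N) (hel : 0 < ε * lam) :
    Real.exp (-oscLog N ε lam) = ε * lam / N := by
  rw [oscLog, Real.exp_neg, Real.exp_log (by positivity), inv_div]

theorem log_two_le_oscLog (hN : 2 ≤ N) (hel : 0 < ε * lam) (hel1 : ε * lam ≤ 1) :
    Real.log 2 ≤ oscLog N ε lam := by
  refine Real.log_le_log two_pos ((le_div_iff₀ hel).2 ?_)
  calc 2 * (ε * lam) ≤ 2 * 1 := by gcongr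
    _ ≤ N := by rw [mul_one]; exact_mod_cast hN

theorem sum_abs_levelTransition_osc_sub_le {q : Fin 2 → ℝ} (hq : q ∈ stdSimplex ℝ (Fin 2))
    (hN : 0 < N) (hΔ : 0 < Δ) (b : ℝ) (hε : 0 < ε) (hl : 0 < lam) (hel : ε * lam ≤ 1)
    (i : Fin N) :
    ∑ j, |levelTransition (oscEnergy N Δ b) Δ q (oscAlpha N Δ ε lam) (oscTime N Δ ε lam) j i -
        (1 + rescaledCoupling (Fin N) (oscAlpha N Δ ε lam) (oscTime N Δ ε lam) ^ 2 •
          ladder N q) j i| ≤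
      (12 * gaussianMoment + 8) * ε / oscSteps N Δ ε lam := by
  have hα := oscAlpha_pos hN hΔ hε hl
  have ht := oscTime_pos hN hΔ hε hl
  have ha := mul_pos hα ht
  have ha1 := oscAlpha_mul_oscTime_le_one hN hΔ hε hl hel
  have hm := gaussianMoment_nonneg
  refine (sum_abs_levelTransition_sub_one_add_smul_ladder_le hq hΔ hα.le ht b
    (rescaledCoupling_osc_sq_le_one hN hΔ hε hl hel) i).trans ?_
  rw [rescaledCoupling_sq, Fintype.card_fin, mul_oscTime_sq hΔ.ne' (mul_pos hε hl).le, oscSteps,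
    ← mul_pow]
  have haeq := oscAlpha_mul_oscTime hN hΔ hε hl
  set a := oscAlpha N Δ ε lam * oscTime N Δ ε lam
  have hcubic : 2 * a ^ 3 + a ^ 4 ≤ 3 * a ^ 2 * (ε * lam / (N : ℝ) ^ 3) := by
    rw [← haeq]
    linarith [pow_le_pow_of_le_one ha.le ha1 (by norm_num : 3 ≤ 4)]
  calc 2 * (2 * N * gaussianMoment * (2 * a ^ 3 + a ^ 4) +
        N * (a ^ 2 / (2 * N + 1) * (8 / ((N : ℝ) ^ 2 / (ε * lam)))))
      ≤ 2 * (2 * N * gaussianMoment * (3 * a ^ 2 * (ε * lam / (N : ℝ) ^ 3)) +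
        N * (a ^ 2 / (2 * N) * (8 / ((N : ℝ) ^ 2 / (ε * lam))))) := by
        gcongr
        exact le_add_of_nonneg_right one_pos.le
    _ = (12 * gaussianMoment + 8) * ε / ((N : ℝ) ^ 2 / (a ^ 2 * lam)) := by
        field_simp
        ring

end Parameters

section Mixing

variable {N : ℕ} {q : Fin 2 → ℝ}

theorem one_add_smul_ladder_pow_mulVec_eq_self {π : Fin N → ℝ} (hπ : ladder N q *ᵥ π = 0) (s : ℝ)
    (L : ℕ) : (1 + s • ladder N q) ^ L *ᵥ π = π := by
  induction L with
  | zero => rw [pow_zero, one_mulVec]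
  | succ L ih => rw [pow_succ, ← mulVec_mulVec, add_mulVec, one_mulVec, smul_mulVec, hπ,
      smul_zero, add_zero, ih]

theorem four_mul_sq_le_four_pow (hN : 0 < N) : 4 * N ^ 2 ≤ 4 ^ N := by
  have hlin : N ≤ 2 ^ (N - 1) := by
    have := (N - 1).lt_two_pow_self
    omega
  calc 4 * N ^ 2 ≤ 4 * (2 ^ (N - 1)) ^ 2 := by gcongr
    _ = 4 ^ N := by
      rw [pow_right_comm]
      exact mul_pow_sub_one hN.ne' 4

theorem spectralGap_ladder_mem_Ioc (hN : 2 ≤ N) (hq : q ∈ stdSimplex ℝ (Fin 2))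
    (h10 : q 1 ≤ q 0) : spectralGap (ladder N q) ∈ Set.Ioc 0 1 := by
  have hq1 : q 0 + q 1 = 1 := by simpa [Fin.sum_univ_two] using hq.2
  have h0 : 0 < q 0 := by linarith
  exact ⟨spectralGap_ladder_pos h0 (hq.1 1) hN,
    (spectralGap_ladder_le_add h0 (hq.1 1) hN).trans_eq hq1⟩

theorem sum_abs_sub_one_add_smul_ladder_pow_mulVec_le (hN : 2 ≤ N)
    (hq : q ∈ stdSimplex ℝ (Fin 2)) (h10 : q 1 ≤ q 0) {s : ℝ} (hs : 0 ≤ s) (hs1 : s ≤ 1)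
    {π p : Fin N → ℝ} (hπ : π ∈ stdSimplex ℝ (Fin N)) (hπ0 : ladder N q *ᵥ π = 0)
    (hp : p ∈ stdSimplex ℝ (Fin N)) (L : ℕ) :
    ∑ j, |π j - ((1 + s • ladder N q) ^ L *ᵥ p) j| ≤
      12 ^ N * Real.exp (-(L * (s * (spectralGap (ladder N q) / 8)))) := by
  have hq1 : q 0 + q 1 = 1 := by simpa [Fin.sum_univ_two] using hq.2
  have h0 : 0 < q 0 := by linarith
  obtain ⟨hgap0, hgap1⟩ := spectralGap_ladder_mem_Ioc hN hq h10
  set gap := spectralGap (ladder N q)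
  obtain ⟨v, hv, hbound⟩ := exists_isCutWeight (N := N) (κ := gap / 8) h0 h10
    (by rw [← spectralGap_ladder h0 (hq.1 1) hN]; linarith) (by linarith)
  have hκ : s * (gap / 8) ≤ 1 := mul_le_one₀ hs1 (by linarith) (by linarith)
  have hd : ∑ i, (π - p) i = 0 := by
    simp only [Pi.sub_apply, Finset.sum_sub_distrib, hπ.2, hp.2, sub_self]
  have hd2 : ∑ i, |(π - p) i| ≤ 2 := by
    calc _ ≤ ∑ i, (|π i| + |p i|) := Finset.sum_le_sum fun i _ => abs_sub _ _
      _ = 2 := by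
        rw [Finset.sum_add_distrib, sum_abs_eq_one_of_mem_stdSimplex hπ,
          sum_abs_eq_one_of_mem_stdSimplex hp, one_add_one_eq_two]
  have hcontract := sum_abs_one_add_smul_ladder_pow_mulVec_le hv (by positivity) hbound hq.1 hs
    (by rwa [hq1, mul_one]) hκ hd L
  rw [mulVec_sub, one_add_smul_ladder_pow_mulVec_eq_self hπ0] at hcontract
  have hexp : (1 - s * (gap / 8)) ^ L ≤ Real.exp (-(L * (s * (gap / 8)))) := by
    rw [← mul_neg, Real.exp_nat_mul]
    exact pow_le_pow_left₀ (sub_nonneg.2 hκ) (Real.one_sub_le_exp_neg _) L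
  calc ∑ j, |π j - ((1 + s • ladder N q) ^ L *ᵥ p) j|
      ≤ 2 * Real.exp (-(L * (s * (gap / 8)))) * (N * (3 ^ N / (1 / N)) * 2) := by
        refine hcontract.trans ?_
        gcongr
        exact_mod_cast Nat.sub_le N 1
    _ = (4 * N ^ 2 : ℕ) * 3 ^ N * Real.exp (-(L * (s * (gap / 8)))) := by
        push_cast
        field_simp
        ring
    _ ≤ (4 ^ N : ℕ) * 3 ^ N * Real.exp (-(L * (s * (gap / 8)))) := by
        gcongr
        exact four_mul_sq_le_four_pow (by omega)
    _ = 12 ^ N * Real.exp (-(L * (s * (gap / 8)))) := by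
        push_cast
        rw [← mul_pow]
        norm_num

theorem twelve_pow_mul_exp_le (hN : 0 < N) {x : ℝ} (hx : Real.log 2 ≤ x) :
    12 ^ N * Real.exp (-(5 * N * x)) ≤ Real.exp (-x) := by
  set r := Real.exp (-x)
  have hr : r ≤ 1 / 2 := by
    rw [← Real.exp_log (show (0 : ℝ) < 1 / 2 by norm_num), one_div, Real.log_inv]
    exact Real.exp_le_exp.2 (neg_le_neg hx)
  have hr0 : 0 < r := Real.exp_pos _
  calc 12 ^ N * Real.exp (-(5 * N * x)) = (12 * r ^ 4 * r) ^ N := by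
        rw [mul_assoc 12, ← pow_succ, mul_pow, ← Real.exp_nat_mul, ← Real.exp_nat_mul]
        congr 2
        push_cast
        ring
    _ ≤ (12 * (1 / 2) ^ 4 * r) ^ N := by gcongr
    _ ≤ r ^ N := by gcongr; linarith
    _ ≤ r := pow_le_of_le_one hr0.le (by linarith) hN.ne'

end Mixing

section Cost

theorem traceNorm_diagOp_sub_iterate_channel_le {S : Type} [Fintype S] [DecidableEq S] (E : S → ℝ)
    (γ : ℝ) {q : Fin 2 → ℝ} (hq : q ∈ stdSimplex ℝ (Fin 2)) (α t : ℝ) {B : Matrix S S ℝ}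
    (hB : B ∈ colStochastic ℝ S) {δ : ℝ}
    (hδ : ∀ i, ∑ j, |levelTransition E γ q α t j i - B j i| ≤ δ) (π : S → ℝ) {p : S → ℝ}
    (hp : p ∈ stdSimplex ℝ S) (L : ℕ) :
    traceNorm (diagOp π - (channel E γ q α t)^[L] (diagOp p)) ≤
      ∑ j, |π j - (B ^ L *ᵥ p) j| + L * δ := by
  set A := levelTransition E γ q α t
  have hdiff : diagOp π - diagOp (A ^ L *ᵥ p) = diagOp fun j => π j - (A ^ L *ᵥ p) j := by
    simp only [diagOp, diagonal_sub, Complex.ofReal_sub]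
  rw [iterate_channel_diagOp, hdiff, traceNorm_diagOp]
  calc ∑ j, |π j - (A ^ L *ᵥ p) j|
      ≤ ∑ j, (|π j - (B ^ L *ᵥ p) j| + |(A ^ L *ᵥ p) j - (B ^ L *ᵥ p) j|) := by
        refine Finset.sum_le_sum fun j _ => ?_
        rw [abs_sub_comm ((A ^ L *ᵥ p) j)]
        exact abs_sub_le _ _ _
    _ ≤ ∑ j, |π j - (B ^ L *ᵥ p) j| + L * δ := by
        rw [Finset.sum_add_distrib]
        gcongr
        exact sum_abs_pow_mulVec_sub_le
          (levelTransition_mem_colStochastic E γ hq α t) hB hδ hp L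

variable {N : ℕ} {q : Fin 2 → ℝ} {Δ ε lam K : ℝ} {L : ℕ}

theorem mixing_error_osc_le (hN : 2 ≤ N) (hΔ : 0 < Δ) (hε : 0 < ε) (hε1 : ε ≤ 1)
    (hq : q ∈ stdSimplex ℝ (Fin 2)) (h10 : q 1 ≤ q 0) (hlam : spectralGap (ladder N q) = lam)
    {π p : Fin N → ℝ} (hπ : π ∈ stdSimplex ℝ (Fin N)) (hπ0 : ladder N q *ᵥ π = 0)
    (hp : p ∈ stdSimplex ℝ (Fin N)) (hL : 100 * oscSteps N Δ ε lam * oscLog N ε lam ≤ L) :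
    ∑ j, |π j - ((1 + rescaledCoupling (Fin N) (oscAlpha N Δ ε lam) (oscTime N Δ ε lam) ^ 2 •
      ladder N q) ^ L *ᵥ p) j| ≤ ε := by
  have hN0 : 0 < N := by omega
  obtain ⟨hl, hl1⟩ := hlam ▸ spectralGap_ladder_mem_Ioc hN hq h10
  have hel := mul_pos hε hl
  have hel1 : ε * lam ≤ 1 := mul_le_one₀ hε1 hl.le hl1
  have hlog := log_two_le_oscLog hN hel hel1
  set s := rescaledCoupling (Fin N) (oscAlpha N Δ ε lam) (oscTime N Δ ε lam) ^ 2
  set ℓ := oscLog N ε lam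
  have hℓ : 0 ≤ ℓ := (Real.log_nonneg one_le_two).trans hlog
  have hs : 0 ≤ s := sq_nonneg _
  have hmany : 5 * N * ℓ ≤ L * (s * (lam / 8)) := by
    calc 5 * N * ℓ ≤ 100 / 8 * ((N : ℝ) ^ 2 / (2 * N + 1)) * ℓ := by
          have hN2 : (2 : ℝ) ≤ N := by exact_mod_cast hN
          refine mul_le_mul_of_nonneg_right ?_ hℓ
          rw [← mul_div_assoc, le_div_iff₀ (by positivity)]
          nlinarith
      _ = 100 * oscSteps N Δ ε lam * ℓ * (s * (lam / 8)) := by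
          rw [← rescaledCoupling_osc_sq_mul_oscSteps hN0 hΔ hε hl]
          ring
      _ ≤ L * (s * (lam / 8)) := by gcongr
  calc _ ≤ 12 ^ N * Real.exp (-(L * (s * (lam / 8)))) :=
        hlam ▸ sum_abs_sub_one_add_smul_ladder_pow_mulVec_le hN hq h10 hs
          (rescaledCoupling_osc_sq_le_one hN0 hΔ hε hl hel1) hπ hπ0 hp L
    _ ≤ 12 ^ N * Real.exp (-(5 * N * ℓ)) := by gcongr
    _ ≤ Real.exp (-ℓ) := twelve_pow_mul_exp_le hN0 hlog
    _ = ε * (lam / N) := by rw [exp_neg_oscLog hN0 hel, mul_div_assoc]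
    _ ≤ ε := mul_le_of_le_one_right hε.le
        (div_le_one_of_le₀ (hl1.trans (Nat.one_le_cast.2 hN0)) (by positivity))

/-- The constant hidden in the error and run-time bounds when at most `K` times the prescribed
number of interactions is used. -/
def costConst (K : ℝ) : ℝ := 2 + K * (12 * gaussianMoment + 9)

theorem costConst_pos (hK : 0 < K) : 0 < costConst K := by
  have := gaussianMoment_nonneg
  rw [costConst]
  positivity

theorem traceNorm_sub_iterate_channel_osc_le (hN : 2 ≤ N) (hΔ : 0 < Δ) (b : ℝ) (hε : 0 < ε)
    (hε1 : ε ≤ 1) (hq : q ∈ stdSimplex ℝ (Fin 2)) (h10 : q 1 ≤ q 0)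
    (hlam : spectralGap (ladder N q) = lam) {π : Fin N → ℝ} (hπ : π ∈ stdSimplex ℝ (Fin N))
    (hπ0 : ladder N q *ᵥ π = 0) (hK : 0 < K)
    (hL : 100 * oscSteps N Δ ε lam * oscLog N ε lam ≤ L)
    (hLK : L ≤ K * oscSteps N Δ ε lam * oscLog N ε lam) {ρ : Matrix (Fin N) (Fin N) ℂ}
    (hρ : IsDensity ρ) (hcomm : Commute ρ (diagOp (oscEnergy N Δ b))) :
    traceNorm (diagOp π - (channel (oscEnergy N Δ b) Δ q
      (oscAlpha N Δ ε lam) (oscTime N Δ ε lam))^[L] ρ) ≤ costConst K * ε * oscLog N ε lam := by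
  obtain ⟨p, hp, rfl⟩ := exists_diagOp_eq_of_commute (oscEnergy_injective hΔ.ne' b) hρ hcomm
  have hN0 : 0 < N := by omega
  have hm := gaussianMoment_nonneg
  obtain ⟨hl, hl1⟩ := hlam ▸ spectralGap_ladder_mem_Ioc hN hq h10
  have hel1 : ε * lam ≤ 1 := mul_le_one₀ hε1 hl.le hl1
  have hsteps := oscSteps_pos hN0 hΔ hε hl
  have hlog := log_two_le_oscLog hN (mul_pos hε hl) hel1
  have hstoch := one_add_smul_ladder_mem_colStochastic (N := N) hq.1 (sq_nonneg _)
    (by simpa only [hq.2, mul_one] using rescaledCoupling_osc_sq_le_one hN0 hΔ hε hl hel1)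
  calc _ ≤ ε + L * ((12 * gaussianMoment + 8) * ε / oscSteps N Δ ε lam) :=
        (traceNorm_diagOp_sub_iterate_channel_le _ _ hq _ _ hstoch
          (sum_abs_levelTransition_osc_sub_le hq hN0 hΔ b hε hl hel1) π hp L).trans <|
          add_le_add (mixing_error_osc_le hN hΔ hε hε1 hq h10 hlam hπ hπ0 hp hL) le_rfl
    _ ≤ ε + K * oscSteps N Δ ε lam * oscLog N ε lam *
          ((12 * gaussianMoment + 8) * ε / oscSteps N Δ ε lam) := by gcongr
    _ = ε * 1 + K * (12 * gaussianMoment + 8) * ε * oscLog N ε lam := by field_simp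
    _ ≤ ε * (2 * oscLog N ε lam) + K * (12 * gaussianMoment + 9) * ε * oscLog N ε lam := by
        have hlog2 := Real.log_two_gt_d9
        gcongr <;> linarith
    _ = costConst K * ε * oscLog N ε lam := by rw [costConst]; ring

theorem mul_oscTime_le (hN : 0 < N) (hΔ : 0 < Δ) (hε : 0 < ε) (hl : 0 < lam)
    (hlog : 0 ≤ oscLog N ε lam) (hK : 0 < K)
    (hLK : L ≤ K * oscSteps N Δ ε lam * oscLog N ε lam) :
    L * oscTime N Δ ε lam ≤
      costConst K * ((N : ℝ) ^ 9 / (Δ * ε ^ (5 / 2 : ℝ) * lam ^ (7 / 2 : ℝ))) *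
        oscLog N ε lam := by
  have hm := gaussianMoment_nonneg
  have hsteps := oscSteps_pos hN hΔ hε hl
  have ht := oscTime_pos hN hΔ hε hl
  rw [← oscSteps_mul_oscTime hN hΔ hε hl]
  calc L * oscTime N Δ ε lam
      ≤ K * oscSteps N Δ ε lam * oscLog N ε lam * oscTime N Δ ε lam := by gcongr
    _ = K * 1 * (oscSteps N Δ ε lam * oscTime N Δ ε lam) * oscLog N ε lam := by ring
    _ ≤ costConst K * (oscSteps N Δ ε lam * oscTime N Δ ε lam) * oscLog N ε lam := by
        gcongr
        rw [costConst]
        refine (mul_le_mul_of_nonneg_left ?_ hK.le).trans (le_add_of_nonneg_left two_pos.le)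
        linarith

theorem simulation_cost_le (hN : 2 ≤ N) (hΔ : 0 < Δ) (b : ℝ) (hε : 0 < ε) (hε1 : ε ≤ 1)
    (hq : q ∈ stdSimplex ℝ (Fin 2)) (h10 : q 1 ≤ q 0) (hlam : spectralGap (ladder N q) = lam)
    {π : Fin N → ℝ} (hπ : π ∈ stdSimplex ℝ (Fin N)) (hπ0 : ladder N q *ᵥ π = 0) (hK : 0 < K)
    (hL : 100 * oscSteps N Δ ε lam * oscLog N ε lam ≤ L)
    (hLK : L ≤ K * oscSteps N Δ ε lam * oscLog N ε lam) :
    (∀ ρ : Matrix (Fin N) (Fin N) ℂ, IsDensity ρ → Commute ρ (diagOp (oscEnergy N Δ b)) →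
      traceNorm (diagOp π - (channel (oscEnergy N Δ b) Δ q
        (oscAlpha N Δ ε lam) (oscTime N Δ ε lam))^[L] ρ) ≤ costConst K * ε * oscLog N ε lam) ∧
    L * oscTime N Δ ε lam ≤
      costConst K * ((N : ℝ) ^ 9 / (Δ * ε ^ (5 / 2 : ℝ) * lam ^ (7 / 2 : ℝ))) *
        oscLog N ε lam := by
  obtain ⟨hl, hl1⟩ := hlam ▸ spectralGap_ladder_mem_Ioc hN hq h10
  have hlog := log_two_le_oscLog hN (mul_pos hε hl) (mul_le_one₀ hε1 hl.le hl1)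
  exact ⟨fun ρ => traceNorm_sub_iterate_channel_osc_le hN hΔ b hε hε1 hq h10 hlam hπ hπ0 hK hL hLK,
    mul_oscTime_le (by omega) hΔ hε hl ((Real.log_nonneg one_le_two).trans hlog) hK hLK⟩

end Cost

end OscThermal

end

theorem mainTheorem4 :
    -- the Markov chain, for every coupling `α` and time `t`
    (∀ (N : ℕ), 2 ≤ N → ∀ (Δ b α t : ℝ), 0 < Δ → 0 < α → 0 < t →
      (∀ β : ℝ, 0 ≤ β →
        OscThermal.transition (OscThermal.oscEnergy N Δ b) Δ
            (OscThermal.gibbs (OscThermal.envEnergy Δ) β) α t =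
          OscThermal.rescaledCoupling (Fin N) α t ^ 2 •
            OscThermal.ladder N (OscThermal.gibbs (OscThermal.envEnergy Δ) β) ∧
        (OscThermal.rescaledCoupling (Fin N) α t ≤ 1 →
          1 + OscThermal.transition (OscThermal.oscEnergy N Δ b) Δ
            (OscThermal.gibbs (OscThermal.envEnergy Δ) β) α t ∈
              Matrix.colStochastic ℝ (Fin N)) ∧
        {p ∈ stdSimplex ℝ (Fin N) |
            (1 + OscThermal.transition (OscThermal.oscEnergy N Δ b) Δ
              (OscThermal.gibbs (OscThermal.envEnergy Δ) β) α t) *ᵥ p = p} =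
          {OscThermal.gibbs (OscThermal.oscEnergy N Δ b) β} ∧
        0 < OscThermal.oscGap N Δ β) ∧
      -- the limit `β → ∞`
      Tendsto (fun β => OscThermal.transition (OscThermal.oscEnergy N Δ b) Δ
          (OscThermal.gibbs (OscThermal.envEnergy Δ) β) α t) atTop
        (𝓝 (OscThermal.transition (OscThermal.oscEnergy N Δ b) Δ (OscThermal.ground 2) α t)) ∧
      OscThermal.transition (OscThermal.oscEnergy N Δ b) Δ (OscThermal.ground 2) α t =
          OscThermal.rescaledCoupling (Fin N) α t ^ 2 •
            OscThermal.ladder N (OscThermal.ground 2) ∧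
      (OscThermal.transition (OscThermal.oscEnergy N Δ b) Δ
        (OscThermal.ground 2) α t).BlockTriangular id ∧
      spectrum ℝ (OscThermal.transition (OscThermal.oscEnergy N Δ b) Δ
          (OscThermal.ground 2) α t) =
        {0, -(OscThermal.rescaledCoupling (Fin N) α t ^ 2)} ∧
      (OscThermal.transition (OscThermal.oscEnergy N Δ b) Δ
          (OscThermal.ground 2) α t).charpoly =
        Polynomial.X * (Polynomial.X +
          Polynomial.C (OscThermal.rescaledCoupling (Fin N) α t ^ 2)) ^ (N - 1) ∧
      {p ∈ stdSimplex ℝ (Fin N) |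
          (1 + OscThermal.transition (OscThermal.oscEnergy N Δ b) Δ
            (OscThermal.ground 2) α t) *ᵥ p = p} = {OscThermal.ground N} ∧
      Tendsto (fun β => OscThermal.oscGap N Δ β) atTop (𝓝 1) ∧
      OscThermal.spectralGap (OscThermal.ladder N (OscThermal.ground 2)) = 1 ∧
      Tendsto (fun β => OscThermal.gibbs (OscThermal.envEnergy Δ) β) atTop
        (𝓝 (OscThermal.ground 2)) ∧
      Tendsto (fun β => OscThermal.gibbs (OscThermal.oscEnergy N Δ b) β) atTop
        (𝓝 (OscThermal.ground N)) ∧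
      (∀ ρ : Matrix (Fin N) (Fin N) ℂ,
        Tendsto (fun β => OscThermal.channel (OscThermal.oscEnergy N Δ b) Δ
            (OscThermal.gibbs (OscThermal.envEnergy Δ) β) α t ρ) atTop
          (𝓝 (OscThermal.channel (OscThermal.oscEnergy N Δ b) Δ (OscThermal.ground 2) α t ρ)))) ∧
    -- the simulation cost, with universal constants
    (∃ (c : ℝ) (k : ℕ), 0 < c ∧ ∀ K : ℝ, 0 < K → ∃ C : ℝ, 0 < C ∧
      ∀ (N : ℕ), 2 ≤ N → ∀ (Δ b ε : ℝ), 0 < Δ → 0 < ε → ε ≤ 1 →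
        -- finite inverse temperature
        (∀ β : ℝ, 0 ≤ β → ∀ lam : ℝ, lam = OscThermal.oscGap N Δ β → ∀ L : ℕ,
          c * OscThermal.oscSteps N Δ ε lam * OscThermal.oscLog N ε lam ^ k ≤ (L : ℝ) →
          (L : ℝ) ≤ K * OscThermal.oscSteps N Δ ε lam * OscThermal.oscLog N ε lam ^ k →
          (∀ ρ : Matrix (Fin N) (Fin N) ℂ, OscThermal.IsDensity ρ →
            Commute ρ (OscThermal.diagOp (OscThermal.oscEnergy N Δ b)) →
            OscThermal.traceNorm
              (OscThermal.diagOp (OscThermal.gibbs (OscThermal.oscEnergy N Δ b) β) -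
                (OscThermal.channel (OscThermal.oscEnergy N Δ b) Δ
                  (OscThermal.gibbs (OscThermal.envEnergy Δ) β)
                  (OscThermal.oscAlpha N Δ ε lam) (OscThermal.oscTime N Δ ε lam))^[L] ρ) ≤
              C * ε * OscThermal.oscLog N ε lam ^ k) ∧
          (L : ℝ) * OscThermal.oscTime N Δ ε lam ≤
            C * ((N : ℝ) ^ 9 / (Δ * ε ^ (5 / 2 : ℝ) * lam ^ (7 / 2 : ℝ))) *
              OscThermal.oscLog N ε lam ^ k) ∧
        -- zero temperature, where the gap is `1`
        (∀ L : ℕ,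
          c * OscThermal.oscSteps N Δ ε 1 * OscThermal.oscLog N ε 1 ^ k ≤ (L : ℝ) →
          (L : ℝ) ≤ K * OscThermal.oscSteps N Δ ε 1 * OscThermal.oscLog N ε 1 ^ k →
          (∀ ρ : Matrix (Fin N) (Fin N) ℂ, OscThermal.IsDensity ρ →
            Commute ρ (OscThermal.diagOp (OscThermal.oscEnergy N Δ b)) →
            OscThermal.traceNorm
              (OscThermal.diagOp (OscThermal.ground N) -
                (OscThermal.channel (OscThermal.oscEnergy N Δ b) Δ
                  (OscThermal.ground 2)
                  (OscThermal.oscAlpha N Δ ε 1) (OscThermal.oscTime N Δ ε 1))^[L] ρ) ≤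
              C * ε * OscThermal.oscLog N ε 1 ^ k) ∧
          (L : ℝ) * OscThermal.oscTime N Δ ε 1 ≤
            C * ((N : ℝ) ^ 9 / (Δ * ε ^ (5 / 2 : ℝ))) * OscThermal.oscLog N ε 1 ^ k)) := by
  refine ⟨fun N hN Δ b α t hΔ hα ht => ?_, 100, 1, by norm_num, fun K hK =>
    ⟨OscThermal.costConst K, OscThermal.costConst_pos hK, fun N hN Δ b ε hΔ hε hε1 => ?_⟩⟩
  · have hN0 : 0 < N := by omega
    have hr := OscThermal.rescaledCoupling_pos (Fin N) hα ht
    have hs := pow_pos hr 2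
    have hlim := OscThermal.tendsto_gibbs_envEnergy hΔ
    simp only [OscThermal.transition_oscEnergy hN hΔ]
    exact ⟨fun β _ => ⟨trivial, fun hr1 => OscThermal.one_add_smul_ladder_gibbs_mem_colStochastic
        N Δ β hs.le (pow_le_one₀ hr.le hr1),
        OscThermal.fixedPoints_one_add_smul_ladder_gibbs hN0 Δ b β hs.ne',
        OscThermal.oscGap_pos hN Δ β⟩,
      (((OscThermal.continuous_ladder N).tendsto _).comp hlim).const_smul _, trivial,
      OscThermal.smul_ladder_blockTriangular OscThermal.ground_two_one _,
      OscThermal.spectrum_smul_ladder_ground hN _, OscThermal.charpoly_smul_ladder_ground hN0 _,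
      OscThermal.fixedPoints_one_add_smul_ladder_ground hN0 hs.ne', OscThermal.tendsto_oscGap hN hΔ,
      OscThermal.spectralGap_ladder_ground hN, hlim, OscThermal.tendsto_gibbs_oscEnergy hN0 hΔ b,
      fun ρ => ((OscThermal.continuous_channel _ _ _ _ ρ).tendsto _).comp hlim⟩
  · have : Nonempty (Fin N) := ⟨⟨0, by omega⟩⟩
    simp only [pow_one]
    refine ⟨fun β hβ lam hlam L => OscThermal.simulation_cost_le hN hΔ b hε hε1
      (OscThermal.gibbs_mem_stdSimplex _ _) (OscThermal.gibbs_le_gibbs hβ hΔ.le) hlam.symm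
      (OscThermal.gibbs_mem_stdSimplex _ _) (OscThermal.ladder_mulVec_gibbs N Δ b β) hK,
      fun L => ?_⟩
    simpa using OscThermal.simulation_cost_le hN hΔ b hε hε1 (L := L)
      (OscThermal.ground_mem_stdSimplex two_pos) (by simp) (OscThermal.spectralGap_ladder_ground hN)
      (OscThermal.ground_mem_stdSimplex (by omega)) (OscThermal.ladder_mulVec_ground N) hK
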